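/- Write $\mathbb N=\{0,1,2,\dots\}$ and let $K\subseteq\{0,1\}^q\times\mathbb{N}^n$ be finite. Let $\langle K\rangle$ be the set of sums of finitely many elements of $K$ (taken in $\mathbb N^q\times\mathbb N^n$) that lie in $\{0,1\}^q\times\mathbb N^n$. Assume: (1) if $(I,m)\in K$ and $I_i=1$, then $(I-e_i,m)\in K$; (2) the elements $(x^m v)^{\pm1}$ with $(0,m)\in K$ generate the $\mathbb C$-algebra $\mathbb C[x_1^{\pm},\dots,x_n^{\pm},v^{\pm}]$; (3) for every $1\le i\le q$ there is an $m^i\in\mathbb N^n$ with $(e_i,m^i)\in\langle K\rangle$. Let $A=\mathbb C[\xi^I x^m v\mid (I,m)\in K]$ be the subalgebra generated by these monomials in the commutative superalgebra $\mathbb C[x_1^\pm,\dots,x_n^\pm,v^\pm,\xi_1,\dots,\xi_q]$, where the $\xi_i$ are odd. Then the superscheme $\operatorname{Spec}A$ is a (not necessarily normal) toric supervariety. That is, it is irreducible, separated, of finite type over $\mathbb C$, reduced and generically fermionically regular; and it carries a left action of a supertorus $T$ and a $T$-equivariant map $T\to\operatorname{Spec}A$ that factors as the quotient $T\to T/H$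 followed by an open immersion $T/H\to\operatorname{Spec}A$, for a closed subgroup $H$ with trivial even part. Moreover, let $c_{ij}=c_{ji}\in\mathbb C^n$ for $1\le i,j\le q$, and let $T_c$ be the supertorus with $\mathbb C[T_c]=\mathbb C[x^\pm,v^\pm,\xi]$ whose odd Lie algebra basis $\theta_1,\dots,\theta_q$ satisfies $[\theta_i,\theta_j]=\sum_l (c_{ij})_l X_l$, where $X_l$ is the basis vector of $\operatorname{Lie}(T_{c,\bar 0})$ belonging to the coordinate $x_l$; on $\mathbb C[T_c]$ the vector $\theta_i$ acts, through left translation, as $\tfrac12\sum_{j}\xi_j\sum_l (c_{ij})_l x_l\frac{\partial}{\partial x_l}-\frac{\partial}{\partial \xi_i}$. Let $\langle\,,\rangle$ be the standard bilinear product. Then there is an action of $T_c$ on $\operatorname{Spec}A$ that, with the map $T_c\to\operatorname{Spec}A$ given by the inclusion $A\subseteq\mathbb C[T_c]$, makes $\operatorname{Spec}A$ a toric supervariety, if and only if $$\langle m,c_{ij}\rangle=0\quad\text{for all } i,j \text{ and all }(I,m)\in K\text{ with } I_j=0\text{ and }(I+e_j,m)\notin K.$$ In particular, $\langle m,c_{ij}\rangle=0$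 must hold for all $i,j$ and all $(I,m)\in K$ with $I_j=0$ and $(I+e_j,m)\notin\langle K\rangle$. -/

import Mathlib

open TopologicalSpace

noncomputable section

universe u v

section SuperRings

/-- A (commutative) superring: a ring `A` with a `ℤ/2`-grading `𝒜` whose homogeneous elements
commute up to the usual sign. -/
class SuperRing {A : Type u} [Ring A] (𝒜 : ZMod 2 → AddSubgroup A) : Prop where
  one_mem : (1 : A) ∈ 𝒜 0
  mul_mem : ∀ {i j : ZMod 2} {a b : A}, a ∈ 𝒜 i → b ∈ 𝒜 j → a * b ∈ 𝒜 (i + j)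
  isCompl : IsCompl (𝒜 0) (𝒜 1)
  even_comm : ∀ {a : A}, a ∈ 𝒜 0 → ∀ b : A, a * b = b * a
  odd_anticomm : ∀ {a b : A}, a ∈ 𝒜 1 → b ∈ 𝒜 1 → a * b = -(b * a)
  odd_sq : ∀ {a : A}, a ∈ 𝒜 1 → a * a = 0

variable {A : Type u} [Ring A] (𝒜 : ZMod 2 → AddSubgroup A) [SuperRing 𝒜]

/-- The even part `A₀`, a subring of `A`. -/
def evenPart : Subring A where
  carrier := 𝒜 0
  one_mem' := SuperRing.one_mem
  mul_mem' ha hb := by simpa using SuperRing.mul_mem (𝒜 := 𝒜) ha hb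
  zero_mem' := (𝒜 0).zero_mem
  add_mem' := (𝒜 0).add_mem
  neg_mem' := (𝒜 0).neg_mem

instance evenPart.instCommRing : CommRing (evenPart 𝒜) :=
  { (inferInstance : Ring (evenPart 𝒜)) with
    mul_comm := fun a b => Subtype.ext (SuperRing.even_comm (𝒜 := 𝒜) a.2 b) }

instance evenPart.instAlgebra : Algebra (evenPart 𝒜) A where
  smul s a := (s : A) * a
  algebraMap := (evenPart 𝒜).subtype
  commutes' s a := SuperRing.even_comm (𝒜 := 𝒜) s.2 a
  smul_def' _ _ := rfl

theorem evenPart_smul_def (s : evenPart 𝒜) (a : A) : s • a = (s : A) * a := rfl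

theorem evenPart_smul_mem (s : evenPart 𝒜) {i : ZMod 2} {a : A} (ha : a ∈ 𝒜 i) :
    s • a ∈ 𝒜 i := by
  have := SuperRing.mul_mem (𝒜 := 𝒜) s.2 ha
  rwa [zero_add] at this

theorem exists_even_add_odd (a : A) : ∃ b ∈ 𝒜 0, ∃ c ∈ 𝒜 1, b + c = a :=
  AddSubgroup.mem_sup.1 ((SuperRing.isCompl (𝒜 := 𝒜)).sup_eq_top ▸ AddSubgroup.mem_top a)

theorem eq_zero_of_even_of_odd {a : A} (h0 : a ∈ 𝒜 0) (h1 : a ∈ 𝒜 1) : a = 0 := by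
  have h : a ∈ 𝒜 0 ⊓ 𝒜 1 := ⟨h0, h1⟩
  rwa [(SuperRing.isCompl (𝒜 := 𝒜)).inf_eq_bot, AddSubgroup.mem_bot] at h

variable (S : Submonoid (evenPart 𝒜))

theorem loc_mk_add (a b : A) (s : S) :
    (LocalizedModule.mk (a + b) s : LocalizedModule S A)
      = LocalizedModule.mk a s + LocalizedModule.mk b s := by
  rw [LocalizedModule.mk_add_mk, ← smul_add, LocalizedModule.mk_cancel_common_left]

theorem loc_one_def : (1 : LocalizedModule S A) = LocalizedModule.mk 1 1 :=
  OreLocalization.one_def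

/-- The grading of the localization `S⁻¹A`: the degree `i` part consists of the fractions
`a / s` with `a` of degree `i`. -/
def locGrading (i : ZMod 2) : AddSubgroup (LocalizedModule S A) where
  carrier := {x | ∃ a ∈ 𝒜 i, ∃ s : S, x = LocalizedModule.mk a s}
  zero_mem' := ⟨0, (𝒜 i).zero_mem, 1, (LocalizedModule.zero_mk 1).symm⟩
  add_mem' := by
    rintro _ _ ⟨a, ha, s, rfl⟩ ⟨b, hb, t, rfl⟩
    exact ⟨_, (𝒜 i).add_mem (evenPart_smul_mem 𝒜 t.1 ha) (evenPart_smul_mem 𝒜 s.1 hb), _,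
      LocalizedModule.mk_add_mk⟩
  neg_mem' := by
    rintro _ ⟨a, ha, s, rfl⟩
    exact ⟨-a, (𝒜 i).neg_mem ha, s, LocalizedModule.mk_neg.symm⟩

instance locGrading.instSuperRing : SuperRing (locGrading 𝒜 S) where
  one_mem := ⟨1, SuperRing.one_mem, 1, loc_one_def 𝒜 S⟩
  mul_mem := by
    rintro i j _ _ ⟨a, ha, s, rfl⟩ ⟨b, hb, t, rfl⟩
    exact ⟨a * b, SuperRing.mul_mem ha hb, s * t, LocalizedModule.mk_mul_mk⟩
  isCompl := by
    constructor
    · rw [disjoint_iff, eq_bot_iff]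
      rintro x ⟨⟨a, ha, s, rfl⟩, b, hb, t, h⟩
      obtain ⟨r, hr⟩ := LocalizedModule.mk_eq.1 h
      have h0 : r • t • a = 0 := by
        apply eq_zero_of_even_of_odd 𝒜
        · exact evenPart_smul_mem 𝒜 r.1 (evenPart_smul_mem 𝒜 t.1 ha)
        · rw [hr]
          exact evenPart_smul_mem 𝒜 r.1 (evenPart_smul_mem 𝒜 s.1 hb)
      rw [AddSubgroup.mem_bot, ← LocalizedModule.zero_mk t, LocalizedModule.mk_eq]
      exact ⟨r, by simpa using h0⟩
    · rw [codisjoint_iff, eq_top_iff]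
      intro x _
      induction x using LocalizedModule.induction_on with
      | h a s =>
        obtain ⟨b, hb, c, hc, rfl⟩ := exists_even_add_odd 𝒜 a
        rw [loc_mk_add]
        exact AddSubgroup.add_mem_sup ⟨b, hb, s, rfl⟩ ⟨c, hc, s, rfl⟩
  even_comm := by
    rintro _ ⟨a, ha, s, rfl⟩ y
    induction y using LocalizedModule.induction_on with
    | h b t =>
      rw [LocalizedModule.mk_mul_mk, LocalizedModule.mk_mul_mk,
        SuperRing.even_comm (𝒜 := 𝒜) ha, mul_comm s t]
  odd_anticomm := by
    rintro _ _ ⟨a, ha, s, rfl⟩ ⟨b, hb, t, rfl⟩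
    rw [LocalizedModule.mk_mul_mk, LocalizedModule.mk_mul_mk,
      SuperRing.odd_anticomm (𝒜 := 𝒜) ha hb, mul_comm s t, LocalizedModule.mk_neg]
  odd_sq := by
    rintro _ ⟨a, ha, s, rfl⟩
    rw [LocalizedModule.mk_mul_mk, SuperRing.odd_sq (𝒜 := 𝒜) ha, LocalizedModule.zero_mk]

/-- The natural ring homomorphism `A → S⁻¹A`. -/
def locMap : A →+* LocalizedModule S A where
  toFun a := LocalizedModule.mk a 1
  map_one' := (loc_one_def 𝒜 S).symm
  map_mul' a b := by rw [LocalizedModule.mk_mul_mk, one_mul]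
  map_zero' := LocalizedModule.zero_mk 1
  map_add' a b := loc_mk_add 𝒜 S a b 1


/-- The set of zero divisors of a ring. For superrings over `ℂ` the left and right zero divisors
are the same elements. -/
def zeroDivisorSet (R : Type u) [Ring R] : Set R := {a | ∃ b : R, b ≠ 0 ∧ a * b = 0}

/-- The multiplicative set of even non-zero-divisors of `A`. -/
def evenNonZeroDivisors : Submonoid (evenPart 𝒜) where
  carrier := {s | ∀ b : A, (s : A) * b = 0 → b = 0}
  one_mem' b hb := by simpa using hb
  mul_mem' {s t} hs ht b hb := ht b (hs _ (by simpa [mul_assoc] using hb))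

/-- The total superring of fractions `K(A)`. -/
abbrev TotalFractions : Type u := LocalizedModule (evenNonZeroDivisors 𝒜) A

/-- The ideal `J_A`: the preimage in `A` of the ideal of `K(A)` generated by the odd part. -/
def superJ : TwoSidedIdeal A :=
  TwoSidedIdeal.comap (locMap 𝒜 (evenNonZeroDivisors 𝒜))
    (TwoSidedIdeal.span (locGrading 𝒜 (evenNonZeroDivisors 𝒜) 1 : Set (TotalFractions 𝒜)))

/-- The underlying ring `A / J_A`. -/
abbrev UnderlyingRing : Type u := (superJ 𝒜).ringCon.Quotient

/-- A superring is reduced if `J_A` is the set of nilpotent elements and the zero divisors of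
`A / J_A` are exactly the images of the zero divisors of `A`. -/
structure IsReducedSuperRing : Prop where
  superJ_eq : (superJ 𝒜 : Set A) = {a | IsNilpotent a}
  image_zeroDivisorSet :
    (superJ 𝒜).ringCon.mk' '' zeroDivisorSet A = zeroDivisorSet (UnderlyingRing 𝒜)

/-- A superring is fermionically regular if it is isomorphic, as a superring, to the exterior
algebra of a module over a commutative ring. -/
def IsFermionicallyRegular {A : Type u} [Ring A] (𝒜 : ZMod 2 → AddSubgroup A) : Prop :=
  ∃ (R : Type u) (_ : CommRing R) (M : Type u) (_ : AddCommGroup M) (_ : Module R M)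
    (e : ExteriorAlgebra R M ≃+* A),
    ∀ (i : ZMod 2) (x : ExteriorAlgebra R M),
      e x ∈ 𝒜 i ↔ x ∈ CliffordAlgebra.evenOdd (0 : QuadraticForm R M) i

end SuperRings

section AffineSuperschemes

variable {A : Type u} [Ring A] (𝒜 : ZMod 2 → AddSubgroup A) [SuperRing 𝒜]

/-- The underlying space `|Spec A| = |Spec A₀|` of the affine superscheme `Spec A`. -/
abbrev SuperSpec : Type u := PrimeSpectrum (evenPart 𝒜)

/-- The stalk of the structure sheaf of `Spec A` at `p`: the localization `A_p`. -/
abbrev SuperStalk (p : SuperSpec 𝒜) : Type u := LocalizedModule p.asIdeal.primeCompl A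

/-- The grading of the stalk `A_p`. -/
abbrev stalkGrading (p : SuperSpec 𝒜) : ZMod 2 → AddSubgroup (SuperStalk 𝒜 p) :=
  locGrading 𝒜 p.asIdeal.primeCompl

/-- A family of germs on `U` is locally a fraction with even denominator. -/
def IsLocalFraction (U : Opens (SuperSpec 𝒜)) (s : ∀ p : U, SuperStalk 𝒜 p.1) : Prop :=
  ∀ p : U, ∃ (V : Opens (SuperSpec 𝒜)) (hVU : V ≤ U), p.1 ∈ V ∧ ∃ (a : A) (f : evenPart 𝒜),
    ∀ r : V, ∃ hf : f ∈ r.1.asIdeal.primeCompl,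
      s ⟨r.1, hVU r.2⟩ = LocalizedModule.mk a ⟨f, hf⟩

/-- The superring `𝒪_A(U)` of sections over `U` of the structure sheaf of `Spec A`, the sheaf
associated with the `A₀`-module `A`. -/
def superSections (U : Opens (SuperSpec 𝒜)) : Subring (∀ p : U, SuperStalk 𝒜 p.1) where
  carrier := {s | IsLocalFraction 𝒜 U s}
  one_mem' p := ⟨U, le_rfl, p.2, 1, 1, fun r => ⟨Submonoid.one_mem _, loc_one_def 𝒜 _⟩⟩
  zero_mem' p := ⟨U, le_rfl, p.2, 0, 1, fun r =>
    ⟨Submonoid.one_mem _, (LocalizedModule.zero_mk _).symm⟩⟩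
  mul_mem' {s t} hs ht p := by
    obtain ⟨V, hV, hpV, a, f, h⟩ := hs p
    obtain ⟨W, hW, hpW, b, g, h'⟩ := ht p
    refine ⟨V ⊓ W, inf_le_left.trans hV, ⟨hpV, hpW⟩, a * b, f * g, fun r => ?_⟩
    obtain ⟨hf, e⟩ := h ⟨r.1, r.2.1⟩
    obtain ⟨hg, e'⟩ := h' ⟨r.1, r.2.2⟩
    refine ⟨Submonoid.mul_mem _ hf hg, ?_⟩
    rw [Pi.mul_apply, e, e', LocalizedModule.mk_mul_mk]
    rfl
  add_mem' {s t} hs ht p := by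
    obtain ⟨V, hV, hpV, a, f, h⟩ := hs p
    obtain ⟨W, hW, hpW, b, g, h'⟩ := ht p
    refine ⟨V ⊓ W, inf_le_left.trans hV, ⟨hpV, hpW⟩, g • a + f • b, f * g, fun r => ?_⟩
    obtain ⟨hf, e⟩ := h ⟨r.1, r.2.1⟩
    obtain ⟨hg, e'⟩ := h' ⟨r.1, r.2.2⟩
    refine ⟨Submonoid.mul_mem _ hf hg, ?_⟩
    rw [Pi.add_apply, e, e', LocalizedModule.mk_add_mk]
    rfl
  neg_mem' {s} hs p := by
    obtain ⟨V, hV, hpV, a, f, h⟩ := hs p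
    refine ⟨V, hV, hpV, -a, f, fun r => ?_⟩
    obtain ⟨hf, e⟩ := h r
    exact ⟨hf, by rw [Pi.neg_apply, e, LocalizedModule.mk_neg]⟩

/-- The grading of `𝒪_A(U)`: a section is of degree `i` if all its germs are. -/
def sectionsGrading (U : Opens (SuperSpec 𝒜)) (i : ZMod 2) :
    AddSubgroup (superSections 𝒜 U) where
  carrier := {s | ∀ p : U, s.1 p ∈ stalkGrading 𝒜 p.1 i}
  zero_mem' p := (stalkGrading 𝒜 p.1 i).zero_mem
  add_mem' hs ht p := (stalkGrading 𝒜 p.1 i).add_mem (hs p) (ht p)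
  neg_mem' hs p := (stalkGrading 𝒜 p.1 i).neg_mem (hs p)

theorem sections_decompose (U : Opens (SuperSpec 𝒜)) (s : superSections 𝒜 U) :
    ∃ s₀ ∈ sectionsGrading 𝒜 U 0, ∃ s₁ ∈ sectionsGrading 𝒜 U 1, s₀ + s₁ = s := by
  have key : ∀ p : U, ∃ b ∈ stalkGrading 𝒜 p.1 0, ∃ c ∈ stalkGrading 𝒜 p.1 1, b + c = s.1 p :=
    fun p => exists_even_add_odd _ _
  choose b hb c hc hbc using key
  have huniq : ∀ (p : U) (b' c' : SuperStalk 𝒜 p.1), b' ∈ stalkGrading 𝒜 p.1 0 →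
      c' ∈ stalkGrading 𝒜 p.1 1 → b' + c' = s.1 p → b p = b' ∧ c p = c' := by
    intro p b' c' hb' hc' h
    have e : b p - b' = c' - c p := by
      rw [sub_eq_sub_iff_add_eq_add, hbc p, ← h, add_comm]
    have h0 : b p - b' = 0 := eq_zero_of_even_of_odd (stalkGrading 𝒜 p.1)
      (sub_mem (hb p) hb') (e ▸ sub_mem hc' (hc p))
    exact ⟨sub_eq_zero.1 h0, (sub_eq_zero.1 (e ▸ h0)).symm⟩
  have hloc : IsLocalFraction 𝒜 U b ∧ IsLocalFraction 𝒜 U c := by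
    constructor <;> intro p <;> obtain ⟨V, hV, hpV, a, f, h⟩ := s.2 p <;>
      obtain ⟨a₀, h₀, a₁, h₁, rfl⟩ := exists_even_add_odd 𝒜 a
    · refine ⟨V, hV, hpV, a₀, f, fun r => ?_⟩
      obtain ⟨hf, e⟩ := h r
      exact ⟨hf, (huniq ⟨r.1, hV r.2⟩ _ _ ⟨a₀, h₀, ⟨f, hf⟩, rfl⟩ ⟨a₁, h₁, ⟨f, hf⟩, rfl⟩
        (by rw [e, loc_mk_add])).1⟩
    · refine ⟨V, hV, hpV, a₁, f, fun r => ?_⟩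
      obtain ⟨hf, e⟩ := h r
      exact ⟨hf, (huniq ⟨r.1, hV r.2⟩ _ _ ⟨a₀, h₀, ⟨f, hf⟩, rfl⟩ ⟨a₁, h₁, ⟨f, hf⟩, rfl⟩
        (by rw [e, loc_mk_add])).2⟩
  exact ⟨⟨b, hloc.1⟩, hb, ⟨c, hloc.2⟩, hc, Subtype.ext (funext hbc)⟩

instance sectionsGrading.instSuperRing (U : Opens (SuperSpec 𝒜)) :
    SuperRing (sectionsGrading 𝒜 U) where
  one_mem p := SuperRing.one_mem (𝒜 := stalkGrading 𝒜 p.1)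
  mul_mem hs ht p := SuperRing.mul_mem (𝒜 := stalkGrading 𝒜 p.1) (hs p) (ht p)
  isCompl := by
    constructor
    · rw [disjoint_iff, eq_bot_iff]
      rintro s ⟨h0, h1⟩
      exact Subtype.ext (funext fun p =>
        eq_zero_of_even_of_odd (stalkGrading 𝒜 p.1) (h0 p) (h1 p))
    · rw [codisjoint_iff, eq_top_iff]
      intro s _
      obtain ⟨b, hb, c, hc, rfl⟩ := sections_decompose 𝒜 U s
      exact AddSubgroup.add_mem_sup hb hc
  even_comm hs t := Subtype.ext (funext fun p =>
    SuperRing.even_comm (𝒜 := stalkGrading 𝒜 p.1) (hs p) (t.1 p))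
  odd_anticomm hs ht := Subtype.ext (funext fun p =>
    SuperRing.odd_anticomm (𝒜 := stalkGrading 𝒜 p.1) (hs p) (ht p))
  odd_sq hs := Subtype.ext (funext fun p =>
    SuperRing.odd_sq (𝒜 := stalkGrading 𝒜 p.1) (hs p))

/-- `Spec A` is reduced: the superring of sections over every affine open is reduced. The affine
opens of `Spec A` are those of the even scheme `Spec A₀`, as the structure sheaf is
quasi-coherent. -/
def IsReducedSuperSpec : Prop :=
  ∀ U : Opens (SuperSpec 𝒜),
    AlgebraicGeometry.IsAffineOpen (X := AlgebraicGeometry.Spec (CommRingCat.of (evenPart 𝒜))) U →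
      IsReducedSuperRing (sectionsGrading 𝒜 U)

/-- `Spec A` is generically fermionically regular: there is a dense set of points at which the
stalks are fermionically regular. -/
def IsGFRSuperSpec : Prop :=
  ∃ Z : Set (SuperSpec 𝒜), closure Z = Set.univ ∧
    ∀ p ∈ Z, IsFermionicallyRegular (stalkGrading 𝒜 p)

/-- `Spec A` is an algebraic supervariety over `ℂ`: a separated superscheme of finite type over
`ℂ` that is generically fermionically regular and reduced. -/
structure IsAffineSupervariety [Algebra ℂ A] : Prop where
  /-- the complex scalars are even, that is, `A` is a superalgebra over `ℂ` -/
  algebraMap_mem : ∀ z : ℂ, algebraMap ℂ A z ∈ 𝒜 0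
  finiteType : Algebra.FiniteType ℂ A
  /-- the diagonal, given by the multiplication map of `A`, is a closed immersion -/
  separated : Function.Surjective (LinearMap.mul' ℂ A)
  gfr : IsGFRSuperSpec 𝒜
  reduced : IsReducedSuperSpec 𝒜

variable {C : Type v} [Ring C] (𝒞 : ZMod 2 → AddSubgroup C) [SuperRing 𝒞]

/-- A homomorphism of superrings; it is the same thing as a morphism
`Spec C → Spec A` of affine superschemes. -/
structure SuperHom {A : Type u} [Ring A] (𝒜 : ZMod 2 → AddSubgroup A)
    {C : Type v} [Ring C] (𝒞 : ZMod 2 → AddSubgroup C) where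
  toRingHom : A →+* C
  map_mem : ∀ (i : ZMod 2) (a : A), a ∈ 𝒜 i → toRingHom a ∈ 𝒞 i

variable {𝒜 𝒞}

/-- The homomorphism `A₀ → C₀` of even parts. -/
def SuperHom.evenHom (φ : SuperHom 𝒜 𝒞) : evenPart 𝒜 →+* evenPart 𝒞 where
  toFun a := ⟨φ.toRingHom a, φ.map_mem 0 a a.2⟩
  map_one' := Subtype.ext (map_one φ.toRingHom)
  map_mul' a b := Subtype.ext (map_mul φ.toRingHom (a : A) (b : A))
  map_zero' := Subtype.ext (map_zero φ.toRingHom)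
  map_add' a b := Subtype.ext (map_add φ.toRingHom (a : A) (b : A))

/-- The map `|Spec C| → |Spec A|` of underlying spaces. -/
def SuperHom.specMap (φ : SuperHom 𝒜 𝒞) : SuperSpec 𝒞 → SuperSpec 𝒜 :=
  PrimeSpectrum.comap φ.evenHom

/-- The map `A_{φ⁻¹(p)} → C_p` of stalks, `a / s ↦ φ a / φ s`. -/
def SuperHom.stalkMap (φ : SuperHom 𝒜 𝒞) (p : SuperSpec 𝒞)
    (x : SuperStalk 𝒜 (φ.specMap p)) : SuperStalk 𝒞 p :=
  LocalizedModule.liftOn x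
    (fun as => LocalizedModule.mk (φ.toRingHom as.1)
      (⟨φ.evenHom as.2, as.2.2⟩ : p.asIdeal.primeCompl)) <| by
    rintro ⟨a, s⟩ ⟨b, t⟩ ⟨r, hr⟩
    rw [LocalizedModule.mk_eq]
    refine ⟨⟨φ.evenHom r, r.2⟩, ?_⟩
    have h : φ.toRingHom ((r : evenPart 𝒜) * ((t : evenPart 𝒜) * a))
        = φ.toRingHom ((r : evenPart 𝒜) * ((s : evenPart 𝒜) * b)) := congrArg φ.toRingHom hr
    rw [map_mul, map_mul, map_mul, map_mul] at h
    exact h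

/-- The morphism `Spec C → Spec A` is an open immersion: it is an open embedding of the underlying
spaces and induces isomorphisms on all stalks. -/
structure SuperHom.IsOpenImmersion (φ : SuperHom 𝒜 𝒞) : Prop where
  isOpenEmbedding : Topology.IsOpenEmbedding φ.specMap
  stalkMap_bijective : ∀ p : SuperSpec 𝒞, Function.Bijective (φ.stalkMap p)

end AffineSuperschemes

section Supertori

/-- A supertorus, given by its Harish-Chandra pair `(T₀, 𝔱)`: `T₀ = (ℂˣ)^p`, `𝔱₀ = ℂ^p` with basis
`x_k`, and `𝔱₁ = ℂ^q` with basis `θ_i`. As `[𝔱₀, 𝔱] = 0` (so that the connected group `T₀` acts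
trivially on `𝔱`, and the Jacobi identity is automatic), the only datum is the symmetric bracket
`[θ_i, θ_j] = ∑ k, bracket i j k • x_k`. -/
@[ext]
structure Supertorus (p q : ℕ) where
  bracket : Fin q → Fin q → Fin p → ℂ
  symm : ∀ i j, bracket i j = bracket j i

/-- The superalgebra `ℂ[T] = ℂ[t₁^±, …, t_p^±, ξ₁, …, ξ_q]`: Laurent polynomials with coefficients
in the exterior algebra on `ξ₁, …, ξ_q`. -/
abbrev TorusRing (p q : ℕ) : Type :=
  AddMonoidAlgebra (ExteriorAlgebra ℂ (Fin q → ℂ)) (Fin p → ℤ)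

variable {p q : ℕ}

/-- The grading of `ℂ[T]`: the `t_k` are even and the `ξ_i` are odd. -/
def torusGrading (p q : ℕ) (i : ZMod 2) : AddSubgroup (TorusRing p q) where
  carrier := {f | ∀ χ, f.coeff χ ∈ CliffordAlgebra.evenOdd (0 : QuadraticForm ℂ (Fin q → ℂ)) i}
  zero_mem' _ := Submodule.zero_mem _
  add_mem' hf hg χ := Submodule.add_mem _ (hf χ) (hg χ)
  neg_mem' hf χ := Submodule.neg_mem _ (hf χ)

/-- The odd coordinate `ξ_i`. -/
def oddCoord (i : Fin q) : TorusRing p q :=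
  AddMonoidAlgebra.single 0 (ExteriorAlgebra.ι ℂ (Pi.single i 1))

/-- The operator that multiplies the `t^χ`-component by `w χ`. -/
def weightScale (w : (Fin p → ℤ) → ℂ) : TorusRing p q →ₗ[ℂ] TorusRing p q where
  toFun f := .ofCoeff (Finsupp.onFinset f.coeff.support (fun χ => w χ • f.coeff χ)
    fun χ h => Finsupp.mem_support_iff.2 fun h' => h (by rw [h', smul_zero]))
  map_add' f g := by
    ext χ : 2
    exact smul_add _ _ _
  map_smul' z f := by
    ext χ : 2
    exact smul_comm _ _ _

/-- The derivation `⟨t∂/∂t, x⟩ = ∑ k, x_k t_k ∂/∂t_k`. -/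
def evenDeriv (x : Fin p → ℂ) : TorusRing p q →ₗ[ℂ] TorusRing p q :=
  weightScale fun χ => ∑ k, (χ k : ℂ) * x k

/-- The odd derivation `∂/∂ξ_i`, the contraction of the coefficients with the `i`-th coordinate
functional. -/
def oddDeriv (i : Fin q) : TorusRing p q →ₗ[ℂ] TorusRing p q where
  toFun f := .ofCoeff (f.coeff.mapRange
    (CliffordAlgebra.contractLeft (Q := (0 : QuadraticForm ℂ (Fin q → ℂ))) (LinearMap.proj i))
    (map_zero _))
  map_add' f g := by
    ext χ : 2
    exact map_add (CliffordAlgebra.contractLeft (Q := (0 : QuadraticForm ℂ (Fin q → ℂ)))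
      (LinearMap.proj i)) (f.coeff χ) (g.coeff χ)
  map_smul' z f := by
    ext χ : 2
    exact map_smul (CliffordAlgebra.contractLeft (Q := (0 : QuadraticForm ℂ (Fin q → ℂ)))
      (LinearMap.proj i)) z (f.coeff χ)

/-- The element `z ∈ T₀` acts on `ℂ[T]` through left translation, `(z · f)(t) = f(z⁻¹t)`. -/
def leftTranslate (z : Fin p → ℂˣ) : TorusRing p q →ₗ[ℂ] TorusRing p q :=
  weightScale fun χ => ∏ k, ((z k ^ (-χ k) : ℂˣ) : ℂ)

/-- The action of `θ_i ∈ 𝔱₁` on `ℂ[T]` through left translation,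
`½ ∑ j, ξ_j ⟨t∂/∂t, [θ_i, θ_j]⟩ - ∂/∂ξ_i`. -/
def Supertorus.leftOdd (T : Supertorus p q) (i : Fin q) : TorusRing p q →ₗ[ℂ] TorusRing p q :=
  (1 / 2 : ℂ) • ∑ j, LinearMap.mulLeft ℂ (oddCoord j) ∘ₗ evenDeriv (T.bracket i j) - oddDeriv i

/-- The action of `θ_i ∈ 𝔱₁` on `ℂ[T]` through right translation,
`½ ∑ j, ξ_j ⟨t∂/∂t, [θ_i, θ_j]⟩ + ∂/∂ξ_i`. -/
def Supertorus.rightOdd (T : Supertorus p q) (i : Fin q) : TorusRing p q →ₗ[ℂ] TorusRing p q :=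
  (1 / 2 : ℂ) • ∑ j, LinearMap.mulLeft ℂ (oddCoord j) ∘ₗ evenDeriv (T.bracket i j) + oddDeriv i

/-- The parity involution of `ℂ[T]`. -/
def parityInvolution (p q : ℕ) : TorusRing p q →ₐ[ℂ] TorusRing p q :=
  AddMonoidAlgebra.mapAlgHom _ CliffordAlgebra.involute

theorem coeff_parityInvolution (f : TorusRing p q) (χ : Fin p → ℤ) :
    (parityInvolution p q f).coeff χ = CliffordAlgebra.involute (f.coeff χ) := rfl

theorem eq_zero_of_eq_neg_self {M : Type*} [AddCommGroup M] [Module ℂ M] {x : M}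
    (h : x = -x) : x = 0 := by
  have h2 : (2 : ℂ) • x = 0 := by rw [two_smul]; nth_rewrite 2 [h]; exact add_neg_cancel x
  exact (smul_eq_zero.1 h2).resolve_left two_ne_zero

theorem mem_evenOdd_iff (x : ExteriorAlgebra ℂ (Fin q → ℂ)) :
    (x ∈ CliffordAlgebra.evenOdd (0 : QuadraticForm ℂ (Fin q → ℂ)) 0 ↔
      CliffordAlgebra.involute x = x) ∧
    (x ∈ CliffordAlgebra.evenOdd (0 : QuadraticForm ℂ (Fin q → ℂ)) 1 ↔
      CliffordAlgebra.involute x = -x) := by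
  have hx : x ∈ CliffordAlgebra.evenOdd (0 : QuadraticForm ℂ (Fin q → ℂ)) 0 ⊔
      CliffordAlgebra.evenOdd (0 : QuadraticForm ℂ (Fin q → ℂ)) 1 :=
    (CliffordAlgebra.evenOdd_isCompl (0 : QuadraticForm ℂ (Fin q → ℂ))).sup_eq_top ▸
      Submodule.mem_top
  obtain ⟨b, hb, c, hc, rfl⟩ := Submodule.mem_sup.1 hx
  refine ⟨⟨CliffordAlgebra.involute_eq_of_mem_even, fun h => ?_⟩,
    ⟨CliffordAlgebra.involute_eq_of_mem_odd, fun h => ?_⟩⟩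
  · rw [map_add, CliffordAlgebra.involute_eq_of_mem_even hb,
      CliffordAlgebra.involute_eq_of_mem_odd hc] at h
    have h' : c = 0 := eq_zero_of_eq_neg_self (add_left_cancel h).symm
    simpa [h'] using hb
  · rw [map_add, CliffordAlgebra.involute_eq_of_mem_even hb,
      CliffordAlgebra.involute_eq_of_mem_odd hc, neg_add] at h
    have h' : b = 0 := eq_zero_of_eq_neg_self (add_right_cancel h)
    simpa [h'] using hc

theorem mem_torusGrading_zero (f : TorusRing p q) :
    f ∈ torusGrading p q 0 ↔ parityInvolution p q f = f := by
  refine ⟨fun h => ?_, fun h χ => ?_⟩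
  · ext χ : 2
    exact (mem_evenOdd_iff _).1.1 (h χ)
  · rw [(mem_evenOdd_iff _).1, ← coeff_parityInvolution, h]

theorem mem_torusGrading_one (f : TorusRing p q) :
    f ∈ torusGrading p q 1 ↔ parityInvolution p q f = -f := by
  refine ⟨fun h => ?_, fun h χ => ?_⟩
  · ext χ : 2
    exact (mem_evenOdd_iff _).2.1 (h χ)
  · rw [(mem_evenOdd_iff _).2, ← coeff_parityInvolution, h]
    rfl

theorem parityInvolution_parityInvolution (f : TorusRing p q) :
    parityInvolution p q (parityInvolution p q f) = f := by
  ext χ : 2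
  exact CliffordAlgebra.involute_involute _

theorem ext_ι_mul (v : Fin q → ℂ) (b : ExteriorAlgebra ℂ (Fin q → ℂ)) :
    CliffordAlgebra.ι (0 : QuadraticForm ℂ (Fin q → ℂ)) v * b =
      CliffordAlgebra.involute b * CliffordAlgebra.ι (0 : QuadraticForm ℂ (Fin q → ℂ)) v := by
  induction b using CliffordAlgebra.induction with
  | algebraMap r => rw [AlgHom.commutes, Algebra.commutes]
  | ι w =>
    rw [CliffordAlgebra.involute_ι, neg_mul, eq_neg_iff_add_eq_zero]
    exact ExteriorAlgebra.ι_add_mul_swap v w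
  | mul a b ha hb => rw [← mul_assoc, ha, mul_assoc, hb, map_mul, mul_assoc]
  | add a b ha hb => rw [mul_add, ha, hb, map_add, add_mul]

theorem ext_comm (a b : ExteriorAlgebra ℂ (Fin q → ℂ)) :
    (a ∈ CliffordAlgebra.evenOdd (0 : QuadraticForm ℂ (Fin q → ℂ)) 0 → a * b = b * a) ∧
    (a ∈ CliffordAlgebra.evenOdd (0 : QuadraticForm ℂ (Fin q → ℂ)) 1 →
      a * b = CliffordAlgebra.involute b * a) := by
  constructor <;> intro h
  · induction a, h using CliffordAlgebra.even_induction with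
    | algebraMap r => exact Algebra.commutes _ _
    | add x y hx hy ihx ihy => rw [add_mul, mul_add, ihx, ihy]
    | ι_mul_ι_mul v w x hx ih =>
      rw [mul_assoc, ih, ← mul_assoc, mul_assoc _ _ b, ext_ι_mul w b, ← mul_assoc, ext_ι_mul v,
        CliffordAlgebra.involute_involute, mul_assoc, mul_assoc, mul_assoc]
  · induction a, h using CliffordAlgebra.odd_induction with
    | ι v => exact ext_ι_mul v b
    | add x y hx hy ihx ihy => rw [add_mul, mul_add, ihx, ihy]
    | ι_mul_ι_mul v w x hx ih =>
      rw [mul_assoc, ih, ← mul_assoc, mul_assoc _ _ (CliffordAlgebra.involute b), ext_ι_mul w,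
        ← mul_assoc, ext_ι_mul v, CliffordAlgebra.involute_involute, mul_assoc, mul_assoc,
        mul_assoc]

theorem torus_sum_single (f : TorusRing p q) :
    f = ∑ χ ∈ f.coeff.support, AddMonoidAlgebra.single χ (f.coeff χ) := by
  classical
  ext χ : 2
  rw [AddMonoidAlgebra.coeff_sum, Finsupp.finsetSum_apply]
  simp only [AddMonoidAlgebra.coeff_single, Finsupp.single_apply]
  rw [Finset.sum_ite_eq']
  split_ifs with h
  · rfl
  · simpa using h

theorem parityInvolution_single (χ : Fin p → ℤ) (a : ExteriorAlgebra ℂ (Fin q → ℂ)) :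
    parityInvolution p q (AddMonoidAlgebra.single χ a)
      = AddMonoidAlgebra.single χ (CliffordAlgebra.involute a) :=
  AddMonoidAlgebra.mapAlgHom_single _ _ _

theorem torus_comm (f g : TorusRing p q) :
    (f ∈ torusGrading p q 0 → f * g = g * f) ∧
    (f ∈ torusGrading p q 1 → f * g = parityInvolution p q g * f) := by
  constructor <;> intro h <;>
    induction g using AddMonoidAlgebra.induction_linear with
    | zero => simp
    | add x y hx hy => simp only [mul_add, add_mul, map_add, hx, hy]
    | single ψ b =>
      rw [torus_sum_single f, Finset.sum_mul, Finset.mul_sum]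
      refine Finset.sum_congr rfl fun χ _ => ?_
      simp only [parityInvolution_single, AddMonoidAlgebra.single_mul_single]
      first
      | rw [(ext_comm _ _).1 (h χ), add_comm]
      | rw [(ext_comm _ _).2 (h χ), add_comm]

/-- The grading induced on a subalgebra of `ℂ[T]`. -/
def restrictGrading (S : Subalgebra ℂ (TorusRing p q)) (i : ZMod 2) : AddSubgroup S where
  carrier := {f | (f : TorusRing p q) ∈ torusGrading p q i}
  zero_mem' := (torusGrading p q i).zero_mem
  add_mem' hf hg := (torusGrading p q i).add_mem hf hg
  neg_mem' hf := (torusGrading p q i).neg_mem hf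

theorem superRing_restrictGrading (S : Subalgebra ℂ (TorusRing p q))
    (hS : ∀ f ∈ S, parityInvolution p q f ∈ S) : SuperRing (restrictGrading S) where
  one_mem := (mem_torusGrading_zero _).2 (map_one (parityInvolution p q))
  mul_mem := by
    rintro i j ⟨f, hfS⟩ ⟨g, hgS⟩ (hf : f ∈ torusGrading p q i) (hg : g ∈ torusGrading p q j)
    change f * g ∈ torusGrading p q (i + j)
    fin_cases i <;> fin_cases j
    · exact (mem_torusGrading_zero _).2 (by
        rw [map_mul, (mem_torusGrading_zero _).1 hf, (mem_torusGrading_zero _).1 hg])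
    · exact (mem_torusGrading_one _).2 (by
        rw [map_mul, (mem_torusGrading_zero _).1 hf, (mem_torusGrading_one _).1 hg, mul_neg])
    · exact (mem_torusGrading_one _).2 (by
        rw [map_mul, (mem_torusGrading_one _).1 hf, (mem_torusGrading_zero _).1 hg, neg_mul])
    · exact (mem_torusGrading_zero _).2 (by
        rw [map_mul, (mem_torusGrading_one _).1 hf, (mem_torusGrading_one _).1 hg, neg_mul_neg])
  isCompl := by
    constructor
    · rw [disjoint_iff, eq_bot_iff]
      rintro ⟨f, hfS⟩ ⟨(h0 : f ∈ torusGrading p q 0), (h1 : f ∈ torusGrading p q 1)⟩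
      exact Subtype.ext (eq_zero_of_eq_neg_self
        (((mem_torusGrading_zero f).1 h0).symm.trans ((mem_torusGrading_one f).1 h1)))
    · rw [codisjoint_iff, eq_top_iff]
      rintro ⟨f, hfS⟩ -
      have h0 : (1 / 2 : ℂ) • (f + parityInvolution p q f) ∈ S :=
        S.smul_mem (S.add_mem hfS (hS f hfS)) _
      have h1 : (1 / 2 : ℂ) • (f - parityInvolution p q f) ∈ S :=
        S.smul_mem (S.sub_mem hfS (hS f hfS)) _
      have e : (⟨f, hfS⟩ : S) = ⟨_, h0⟩ + ⟨_, h1⟩ := Subtype.ext (by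
        change f = (1 / 2 : ℂ) • (f + parityInvolution p q f)
          + (1 / 2 : ℂ) • (f - parityInvolution p q f)
        module)
      rw [e]
      refine AddSubgroup.add_mem_sup ((mem_torusGrading_zero _).2 ?_)
        ((mem_torusGrading_one _).2 ?_)
      · rw [map_smul, map_add, parityInvolution_parityInvolution, add_comm]
      · rw [map_smul, map_sub, parityInvolution_parityInvolution, ← smul_neg, neg_sub]
  even_comm := by
    rintro ⟨f, hfS⟩ hf ⟨g, hgS⟩
    exact Subtype.ext ((torus_comm f g).1 hf)
  odd_anticomm := by
    rintro ⟨f, hfS⟩ ⟨g, hgS⟩ hf hg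
    refine Subtype.ext (((torus_comm f g).2 hf).trans ?_)
    rw [(mem_torusGrading_one g).1 hg, neg_mul]
    rfl
  odd_sq := by
    rintro ⟨f, hfS⟩ hf
    refine Subtype.ext (eq_zero_of_eq_neg_self (((torus_comm f f).2 hf).trans ?_))
    rw [(mem_torusGrading_one f).1 hf, neg_mul]
    rfl

theorem oddDeriv_mul (i : Fin q) (f g : TorusRing p q) :
    oddDeriv i (f * g) = oddDeriv i f * g + parityInvolution p q f * oddDeriv i g := by
  have hext : ∀ a b : ExteriorAlgebra ℂ (Fin q → ℂ),
      CliffordAlgebra.contractLeft (Q := (0 : QuadraticForm ℂ (Fin q → ℂ)))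
        (LinearMap.proj i) (a * b)
      = CliffordAlgebra.contractLeft (Q := (0 : QuadraticForm ℂ (Fin q → ℂ)))
        (LinearMap.proj i) a * b + CliffordAlgebra.involute a *
        CliffordAlgebra.contractLeft (Q := (0 : QuadraticForm ℂ (Fin q → ℂ)))
        (LinearMap.proj i) b := by
    intro a b
    induction a using CliffordAlgebra.left_induction with
    | algebraMap r =>
      rw [CliffordAlgebra.contractLeft_algebraMap_mul, CliffordAlgebra.contractLeft_algebraMap,
        zero_mul, zero_add, AlgHom.commutes]
    | add x y hx hy => simp only [add_mul, map_add, hx, hy]; abel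
    | ι_mul x v hx =>
      rw [mul_assoc, CliffordAlgebra.contractLeft_ι_mul, CliffordAlgebra.contractLeft_ι_mul, hx,
        map_mul, CliffordAlgebra.involute_ι, sub_mul, mul_add, smul_mul_assoc]
      simp only [mul_assoc, neg_mul]
      abel
  have hsingle : ∀ (χ : Fin p → ℤ) (a : ExteriorAlgebra ℂ (Fin q → ℂ)),
      oddDeriv i (AddMonoidAlgebra.single χ a) = AddMonoidAlgebra.single χ
        (CliffordAlgebra.contractLeft (Q := (0 : QuadraticForm ℂ (Fin q → ℂ)))
        (LinearMap.proj i) a) := by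
    intro χ a
    refine AddMonoidAlgebra.coeff_injective ?_
    exact Finsupp.mapRange_single (hf := map_zero _)
  induction f using AddMonoidAlgebra.induction_linear with
  | zero => simp
  | add x y hx hy => simp only [add_mul, map_add, hx, hy]; abel
  | single χ a =>
    induction g using AddMonoidAlgebra.induction_linear with
    | zero => simp
    | add x y hx hy => simp only [mul_add, map_add, hx, hy]; abel
    | single ψ b =>
      simp only [hsingle, parityInvolution_single, AddMonoidAlgebra.single_mul_single, hext,
        AddMonoidAlgebra.single_add]

theorem weightScale_single (w : (Fin p → ℤ) → ℂ) (χ : Fin p → ℤ)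
    (a : ExteriorAlgebra ℂ (Fin q → ℂ)) :
    weightScale w (AddMonoidAlgebra.single χ a) = AddMonoidAlgebra.single χ (w χ • a) := by
  classical
  ext ψ : 2
  change w ψ • (AddMonoidAlgebra.single χ a).coeff ψ = _
  simp only [AddMonoidAlgebra.coeff_single, Finsupp.single_apply]
  split_ifs with h
  · rw [h]
  · rw [smul_zero]

theorem evenDeriv_mul (x : Fin p → ℂ) (f g : TorusRing p q) :
    evenDeriv x (f * g) = evenDeriv x f * g + f * evenDeriv x g := by
  induction f using AddMonoidAlgebra.induction_linear with
  | zero => simp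
  | add x y hx hy => simp only [add_mul, map_add, hx, hy]; abel
  | single χ a =>
    induction g using AddMonoidAlgebra.induction_linear with
    | zero => simp
    | add x y hx hy => simp only [mul_add, map_add, hx, hy]; abel
    | single ψ b =>
      simp only [evenDeriv, weightScale_single, AddMonoidAlgebra.single_mul_single,
        smul_mul_assoc, mul_smul_comm, ← AddMonoidAlgebra.single_add, ← add_smul,
        ← Finset.sum_add_distrib, Pi.add_apply, Int.cast_add, add_mul]

theorem oddCoord_mul (j : Fin q) (f : TorusRing p q) :
    oddCoord j * f = parityInvolution p q f * oddCoord j := by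
  refine (torus_comm _ f).2 ?_
  rw [mem_torusGrading_one, oddCoord, parityInvolution_single,
    ← AddMonoidAlgebra.single_neg]
  exact congrArg _ (CliffordAlgebra.involute_ι _)

theorem rightOdd_mul (T : Supertorus p q) (i : Fin q) (f g : TorusRing p q) :
    T.rightOdd i (f * g) = T.rightOdd i f * g + parityInvolution p q f * T.rightOdd i g := by
  have h : ∀ j, oddCoord j * evenDeriv (T.bracket i j) (f * g)
      = oddCoord j * evenDeriv (T.bracket i j) f * g
        + parityInvolution p q f * (oddCoord j * evenDeriv (T.bracket i j) g) := by
    intro j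
    rw [evenDeriv_mul, mul_add, ← mul_assoc, ← mul_assoc, oddCoord_mul j f, mul_assoc _ _ (evenDeriv _ g)]
  simp only [Supertorus.rightOdd, LinearMap.add_apply, LinearMap.smul_apply, LinearMap.sum_apply,
    LinearMap.comp_apply, LinearMap.mulLeft_apply, h, oddDeriv_mul, Finset.sum_add_distrib,
    smul_add, add_mul, mul_add, Finset.sum_mul, Finset.mul_sum, smul_mul_assoc, mul_smul_comm]
  abel

theorem rightOdd_parityInvolution (T : Supertorus p q) (i : Fin q) (f : TorusRing p q) :
    T.rightOdd i (parityInvolution p q f) = -parityInvolution p q (T.rightOdd i f) := by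
  have hext : ∀ a : ExteriorAlgebra ℂ (Fin q → ℂ),
      CliffordAlgebra.contractLeft (Q := (0 : QuadraticForm ℂ (Fin q → ℂ)))
        (LinearMap.proj i) (CliffordAlgebra.involute a)
      = -CliffordAlgebra.involute (CliffordAlgebra.contractLeft
        (Q := (0 : QuadraticForm ℂ (Fin q → ℂ))) (LinearMap.proj i) a) := by
    intro a
    induction a using CliffordAlgebra.left_induction with
    | algebraMap r =>
      rw [AlgHom.commutes, CliffordAlgebra.contractLeft_algebraMap, map_zero, neg_zero]
    | add x y hx hy => simp only [map_add, hx, hy]; abel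
    | ι_mul x v hx =>
      rw [map_mul, CliffordAlgebra.involute_ι, neg_mul, map_neg,
        CliffordAlgebra.contractLeft_ι_mul, CliffordAlgebra.contractLeft_ι_mul, hx, map_sub,
        map_smul, map_mul, CliffordAlgebra.involute_ι, mul_neg, neg_mul]
  have hodd : oddDeriv i (parityInvolution p q f) = -parityInvolution p q (oddDeriv i f) := by
    ext χ : 2
    exact hext (f.coeff χ)
  have heven : ∀ x, evenDeriv x (parityInvolution p q f) = parityInvolution p q (evenDeriv x f) := by
    intro x
    ext χ : 2
    exact (map_smul (CliffordAlgebra.involute (Q := (0 : QuadraticForm ℂ (Fin q → ℂ))))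
      (∑ k, (χ k : ℂ) * x k) (f.coeff χ)).symm
  have hcoord : ∀ j : Fin q,
      parityInvolution p q (oddCoord j : TorusRing p q) = -oddCoord j := by
    intro j
    rw [oddCoord, parityInvolution_single, ← AddMonoidAlgebra.single_neg]
    exact congrArg _ (CliffordAlgebra.involute_ι _)
  simp only [Supertorus.rightOdd, LinearMap.add_apply, LinearMap.smul_apply, LinearMap.sum_apply,
    LinearMap.comp_apply, LinearMap.mulLeft_apply, hodd, heven, map_add, map_smul, map_sum,
    map_mul, hcoord, neg_mul, Finset.sum_neg_distrib, smul_neg, neg_add, neg_neg]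

/-- For an odd vector `v = ∑ i, v_i θ_i ∈ 𝔱₁`, its action on `ℂ[T]` through right translation. -/
def Supertorus.rightOddVec (T : Supertorus p q) (v : Fin q → ℂ) :
    TorusRing p q →ₗ[ℂ] TorusRing p q :=
  ∑ i, v i • T.rightOdd i

theorem rightOddVec_mul (T : Supertorus p q) (v : Fin q → ℂ) (f g : TorusRing p q) :
    T.rightOddVec v (f * g)
      = T.rightOddVec v f * g + parityInvolution p q f * T.rightOddVec v g := by
  simp only [Supertorus.rightOddVec, LinearMap.sum_apply, LinearMap.smul_apply, rightOdd_mul,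
    smul_add, Finset.sum_add_distrib, Finset.sum_mul, Finset.mul_sum, smul_mul_assoc,
    mul_smul_comm]

/-- The superalgebra `ℂ[T/H]` of the homogeneous space `T/H`, where `H` is the closed subgroup
with `H₀ = 1` and `Lie H = 𝔥 ⊆ 𝔱₁`: the functions on `T` that are invariant under right translation
by `H`. -/
def Supertorus.homogeneousRing (T : Supertorus p q) (𝔥 : Submodule ℂ (Fin q → ℂ)) :
    Subalgebra ℂ (TorusRing p q) where
  carrier := {f | ∀ v ∈ 𝔥, T.rightOddVec v f = 0}
  mul_mem' hf hg v hv := by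
    rw [rightOddVec_mul, hf v hv, hg v hv, zero_mul, mul_zero, add_zero]
  add_mem' hf hg v hv := by rw [map_add, hf v hv, hg v hv, add_zero]
  algebraMap_mem' z v _ := by
    have h := rightOddVec_mul T v 1 1
    rw [map_one (parityInvolution p q), mul_one, mul_one, one_mul, left_eq_add] at h
    rw [Algebra.algebraMap_eq_smul_one, map_smul, h, smul_zero]

instance (T : Supertorus p q) (𝔥 : Submodule ℂ (Fin q → ℂ)) :
    SuperRing (restrictGrading (T.homogeneousRing 𝔥)) :=
  superRing_restrictGrading _ fun f hf v hv => by
    have h : T.rightOddVec v (parityInvolution p q f)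
        = -parityInvolution p q (T.rightOddVec v f) := by
      simp only [Supertorus.rightOddVec, LinearMap.sum_apply, LinearMap.smul_apply,
        rightOdd_parityInvolution, map_sum, map_smul, smul_neg, Finset.sum_neg_distrib]
    rw [h, hf v hv, map_zero, neg_zero]

/-- The subspace `𝔥 ⊆ 𝔱₁` is the Lie superalgebra of a closed subgroup `H ⊆ T` with `H₀ = 1`:
`[𝔥, 𝔥] = 0`. -/
def Supertorus.IsOddSubgroup (T : Supertorus p q) (𝔥 : Submodule ℂ (Fin q → ℂ)) : Prop :=
  ∀ v ∈ 𝔥, ∀ w ∈ 𝔥, ∀ k, ∑ i, ∑ j, v i * w j * T.bracket i j k = 0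

variable {A : Type u} [Ring A] [Algebra ℂ A]

/-- A left action of the supertorus `T` on the affine superscheme `Spec A`, in terms of the
Harish-Chandra pair: an algebraic action of the torus `T₀` on `A` by automorphisms and an action
of the Lie superalgebra `𝔱` by superderivations which are compatible with each other. -/
structure SupertorusAction (T : Supertorus p q) (𝒜 : ZMod 2 → AddSubgroup A) where
  /-- the action of `T₀` -/
  grp : (Fin p → ℂˣ) →* (A ≃ₐ[ℂ] A)
  grp_mem : ∀ z i a, a ∈ 𝒜 i → grp z a ∈ 𝒜 i
  /-- the action of `T₀` is algebraic: the orbit maps are Laurent polynomials -/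
  rational : ∀ a, ∃ f : (Fin p → ℤ) →₀ A,
    ∀ z, grp z a = f.sum fun χ b => ((∏ k, z k ^ χ k : ℂˣ) : ℂ) • b
  /-- the action of the basis vector `x_k` of `𝔱₀` -/
  even : Fin p → Module.End ℂ A
  /-- `𝔱₀` acts through the differential of the action of `T₀` -/
  even_apply : ∀ a (f : (Fin p → ℤ) →₀ A),
    (∀ z, grp z a = f.sum fun χ b => ((∏ k, z k ^ χ k : ℂˣ) : ℂ) • b) →
      ∀ k, even k a = f.sum fun χ b => (χ k : ℂ) • b
  /-- the action of the basis vector `θ_i` of `𝔱₁` -/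
  odd : Fin q → Module.End ℂ A
  odd_mem : ∀ i j a, a ∈ 𝒜 j → odd i a ∈ 𝒜 (j + 1)
  /-- `θ_i` acts as an odd superderivation -/
  odd_mul : ∀ i j a b, a ∈ 𝒜 j →
    odd i (a * b) = odd i a * b + (-1 : ℂ) ^ j.val • (a * odd i b)
  /-- the bracket of `𝔱₁` is respected -/
  odd_bracket : ∀ i j a, odd i (odd j a) + odd j (odd i a) = ∑ k, T.bracket i j k • even k a
  /-- equivariance under `T₀`, which acts trivially on `𝔱₁` -/
  grp_odd : ∀ z i a, grp z (odd i a) = odd i (grp z a)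

/-- The action of the supertorus `T` on `X = Spec A` together with the map `T → X` given by
`φ : A → ℂ[T]` makes `X` a toric supervariety: `X` is an irreducible supervariety, and `T → X` is
`T`-equivariant and factors as the quotient map `T → T/H` followed by an open immersion
`T/H → X`, for a closed subgroup `H` with `H₀ = 1`. -/
structure IsToric {T : Supertorus p q} {𝒜 : ZMod 2 → AddSubgroup A} [SuperRing 𝒜]
    (act : SupertorusAction T 𝒜) (φ : A →ₐ[ℂ] TorusRing p q) : Prop where
  irreducible : IrreducibleSpace (SuperSpec 𝒜)
  supervariety : IsAffineSupervariety 𝒜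
  map_grp : ∀ z a, φ (act.grp z a) = leftTranslate z (φ a)
  map_odd : ∀ i a, φ (act.odd i a) = T.leftOdd i (φ a)
  factors : ∃ 𝔥 : Submodule ℂ (Fin q → ℂ), T.IsOddSubgroup 𝔥 ∧
    ∃ ψ : SuperHom 𝒜 (restrictGrading (T.homogeneousRing 𝔥)),
      (∀ a, (ψ.toRingHom a : TorusRing p q) = φ a) ∧ ψ.IsOpenImmersion

/-- `Spec A` is a (not necessarily normal) toric supervariety for some supertorus. -/
def IsToricSupervariety (𝒜 : ZMod 2 → AddSubgroup A) [SuperRing 𝒜] : Prop :=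
  ∃ (p q : ℕ) (T : Supertorus p q) (act : SupertorusAction T 𝒜) (φ : A →ₐ[ℂ] TorusRing p q),
    IsToric act φ

end Supertori

section MonomialSuperalgebras

variable {q n : ℕ}

/-- The character `x^m v` of `(ℂˣ)^(n+1)`, with coordinates `v = t₀` and `x_l = t_l`. -/
def charXV (m : Fin n → ℕ) : Fin (n + 1) → ℤ := Fin.cons 1 fun l => (m l : ℤ)

/-- The monomial `ξ^I x^m v`, where `ξ^I` is the product of the `ξ_i^(I_i)` in increasing order. -/
def superMonomial (k : (Fin q → ℕ) × (Fin n → ℕ)) : TorusRing (n + 1) q :=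
  AddMonoidAlgebra.single (charXV k.2)
    ((List.finRange q).map fun i =>
      (ExteriorAlgebra.ι ℂ (Pi.single i 1 : Fin q → ℂ)) ^ k.1 i).prod

/-- The superalgebra `ℂ[ξ^I x^m v | (I, m) ∈ K]`. -/
def monomialAlgebra (K : Finset ((Fin q → ℕ) × (Fin n → ℕ))) :
    Subalgebra ℂ (TorusRing (n + 1) q) :=
  Algebra.adjoin ℂ (superMonomial '' (K : Set ((Fin q → ℕ) × (Fin n → ℕ))))

theorem parityInvolution_superMonomial (k : (Fin q → ℕ) × (Fin n → ℕ)) :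
    parityInvolution (n + 1) q (superMonomial k) = superMonomial k ∨
      parityInvolution (n + 1) q (superMonomial k) = -superMonomial k := by
  have h : ∀ l : List (Fin q),
      let a := (l.map fun i => (ExteriorAlgebra.ι ℂ (Pi.single i 1 : Fin q → ℂ)) ^ k.1 i).prod
      CliffordAlgebra.involute a = a ∨ CliffordAlgebra.involute a = -a := by
    intro l
    induction l with
    | nil => exact Or.inl (map_one _)
    | cons i l ih =>
      have hi : CliffordAlgebra.involute
          (ExteriorAlgebra.ι ℂ (Pi.single i 1 : Fin q → ℂ)) = -ExteriorAlgebra.ι ℂ _ :=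
        CliffordAlgebra.involute_ι _
      simp only [List.map_cons, List.prod_cons, map_mul, map_pow, hi] at ih ⊢
      rw [neg_pow]
      rcases neg_one_pow_eq_or (ExteriorAlgebra ℂ (Fin q → ℂ)) (k.1 i) with h | h <;>
        rcases ih with ih | ih <;> rw [h, ih] <;> simp
  rw [superMonomial, parityInvolution_single]
  rcases h (List.finRange q) with h | h
  · exact Or.inl (by rw [h])
  · exact Or.inr (by rw [h, AddMonoidAlgebra.single_neg])

instance (K : Finset ((Fin q → ℕ) × (Fin n → ℕ))) :
    SuperRing (restrictGrading (monomialAlgebra K)) :=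
  superRing_restrictGrading _ fun f hf => by
    have h : monomialAlgebra K ≤ (monomialAlgebra K).comap (parityInvolution (n + 1) q) := by
      refine Algebra.adjoin_le ?_
      rintro _ ⟨k, hk, rfl⟩
      have hmem : superMonomial k ∈ monomialAlgebra K := Algebra.subset_adjoin ⟨k, hk, rfl⟩
      rw [SetLike.mem_coe, Subalgebra.mem_comap]
      rcases parityInvolution_superMonomial k with h | h <;> rw [h]
      · exact hmem
      · exact neg_mem hmem
    exact h hf

/-- The set `⟨K⟩` of the sums of finitely many elements of `K` that lie in `{0,1}^q × ℕ^n`. -/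
def boundedSums (K : Finset ((Fin q → ℕ) × (Fin n → ℕ))) : Set ((Fin q → ℕ) × (Fin n → ℕ)) :=
  {k | k ∈ AddSubmonoid.closure (K : Set ((Fin q → ℕ) × (Fin n → ℕ))) ∧ ∀ i, k.1 i ≤ 1}

/-- The supertorus of dimension `n + 1 | q` with even coordinates `v, x₁, …, x_n` and bracket
`[θ_i, θ_j] = (0, c_ij)`. -/
def supertorusOf (c : Fin q → Fin q → Fin n → ℂ) (hc : ∀ i j, c i j = c j i) :
    Supertorus (n + 1) q where
  bracket i j := Fin.cons 0 (c i j)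
  symm i j := by rw [hc]

end MonomialSuperalgebras

end

/-! Write `A` for the monomial algebra inside `ℂ[T]`, and let `s` be the product of all even
generators `x^m v` with `(0, m) ∈ K`.

Inverting `s` turns `A` into `ℂ[T]`. The quotient of `s` by one even generator is the product of the
others, so every `(x^m v)⁻¹` becomes available and hypothesis (2) gives all Laurent polynomials.
Hypothesis (3) forces some `(e_i, m)` to lie in `K` itself, (1) then gives `(0, m) ∈ K`, and `ξ_i`
is the quotient of the two monomials. Hence `T → Spec A` is already an open immersion and `H` can be
taken trivial (`exists_evenProduct_pow_mul_mem`, `monomialAlgebra_factors`).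

For the geometry of `Spec A`, let `F` be the field of rational functions on the torus. The ring
`ℂ[T]` embeds into the exterior algebra of `F^q`, where every non-nilpotent element of `ℂ[T]`
becomes a unit. So in `A` an element is nilpotent or regular. Moreover `s` carries nilpotent
elements of `A` into the ideal generated by the odd part. These two properties are isolated in
`IsIntegralSuperRing`. They pass to the sections over nonempty open sets, because sections are
determined by their germ at the generic point, and they imply irreducibility and reducedness. The
stalk at the generic point is the full exterior algebra over `F`, which gives generic fermionic
regularity.

For the criterion, `A → ℂ[T_c]` is injective, so equivariance forces `θ_i` to act on `A` by
restriction of its action on `ℂ[T_c]`. The torus `T₀` and its Lie algebra preserve `A`, which is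
spanned by weight vectors, and the operators on `ℂ[T_c]` satisfy the required relations
(`Supertorus.leftOdd_mul`, `Supertorus.leftOdd_bracket`). An action therefore exists exactly if
every `θ_i` preserves `A`. By the Leibniz rule only generators matter, and `θ_i(ξ^I x^m v) = ½ ∑_j
⟨m, c_ij⟩ ξ_j ξ^I x^m v - ∂_i(ξ^I x^m v)`. The last term lies in `A` by (1), and the summands with
`I_j = 1` vanish. The other summands can be separated inside `A` by the operators `ξ_j ∂_j`
(`oddCoord_mul_oddDeriv_mem`). Since every generator has degree one in `v`, a monomial of degree one
in `v` lies in `A` only if it is a generator (`mem_of_superMonomial_mem`). So stability means that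
`⟨m, c_ij⟩ = 0` whenever `I_j = 0` and `(I + e_j, m) ∉ K`. The choice `c = 0` always satisfies this
and yields the toric structure. -/

noncomputable section

/-! ### Nilpotent elements of superrings -/

section SuperRingNilpotents

variable {A : Type u} [Ring A] (𝒜 : ZMod 2 → AddSubgroup A) [SuperRing 𝒜]

/-- The even component of an element of a superring. -/
def evenComponent (a : A) : evenPart 𝒜 :=
  ⟨(exists_even_add_odd 𝒜 a).choose, (exists_even_add_odd 𝒜 a).choose_spec.1⟩

theorem sub_evenComponent_mem (a : A) : a - evenComponent 𝒜 a ∈ 𝒜 1 := by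
  obtain ⟨_, c, hc, h⟩ := (exists_even_add_odd 𝒜 a).choose_spec
  have : a - evenComponent 𝒜 a = c := sub_eq_of_eq_add' h.symm
  rwa [this]

theorem evenComponent_unique {a b : A} (hb : b ∈ 𝒜 0) (h : a - b ∈ 𝒜 1) :
    (evenComponent 𝒜 a : A) = b := by
  refine sub_eq_zero.1 (eq_zero_of_even_of_odd 𝒜 (sub_mem (evenComponent 𝒜 a).2 hb) ?_)
  have := sub_mem h (sub_evenComponent_mem 𝒜 a)
  rwa [sub_sub_sub_cancel_left] at this

theorem evenComponent_of_even {a : A} (ha : a ∈ 𝒜 0) : (evenComponent 𝒜 a : A) = a :=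
  evenComponent_unique 𝒜 ha (by simp [zero_mem])

theorem odd_mul_odd_mem {a b : A} (ha : a ∈ 𝒜 1) (hb : b ∈ 𝒜 1) : a * b ∈ 𝒜 0 :=
  SuperRing.mul_mem (𝒜 := 𝒜) ha hb

theorem even_mul_even_mem {a b : A} (ha : a ∈ 𝒜 0) (hb : b ∈ 𝒜 0) : a * b ∈ 𝒜 0 := by
  simpa using SuperRing.mul_mem (𝒜 := 𝒜) ha hb

theorem even_mul_odd_mem {a b : A} (ha : a ∈ 𝒜 0) (hb : b ∈ 𝒜 1) : a * b ∈ 𝒜 1 := by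
  simpa using SuperRing.mul_mem (𝒜 := 𝒜) ha hb

theorem odd_mul_even_mem {a b : A} (ha : a ∈ 𝒜 1) (hb : b ∈ 𝒜 0) : a * b ∈ 𝒜 1 := by
  simpa using SuperRing.mul_mem (𝒜 := 𝒜) ha hb

theorem even_pow_mem {a : A} (ha : a ∈ 𝒜 0) (n : ℕ) : a ^ n ∈ 𝒜 0 :=
  pow_mem (S := evenPart 𝒜) (x := a) ha n

theorem isNilpotent_evenPart_iff {a : evenPart 𝒜} : IsNilpotent (a : A) ↔ IsNilpotent a :=
  IsNilpotent.map_iff (f := (evenPart 𝒜).subtype) Subtype.coe_injective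

/-- The difference is the product `a₁ b₁` of the odd components, and `(a₁ b₁)² = -a₁² b₁² = 0`. This
is what makes `bodyHom` multiplicative. -/
theorem evenComponent_mul_sub_mem (a b : A) :
    evenComponent 𝒜 (a * b) - evenComponent 𝒜 a * evenComponent 𝒜 b ∈
      nilradical (evenPart 𝒜) := by
  set a₀ := evenComponent 𝒜 a
  set b₀ := evenComponent 𝒜 b
  obtain ⟨a₁, ha₁⟩ : ∃ c, c = a - (a₀ : A) := ⟨_, rfl⟩
  obtain ⟨b₁, hb₁⟩ : ∃ c, c = b - (b₀ : A) := ⟨_, rfl⟩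
  have ha : a₁ ∈ 𝒜 1 := ha₁ ▸ sub_evenComponent_mem 𝒜 a
  have hb : b₁ ∈ 𝒜 1 := hb₁ ▸ sub_evenComponent_mem 𝒜 b
  have e : (evenComponent 𝒜 (a * b) : A) = a₀ * b₀ + a₁ * b₁ := by
    refine evenComponent_unique 𝒜
      ((𝒜 0).add_mem (even_mul_even_mem 𝒜 a₀.2 b₀.2) (odd_mul_odd_mem 𝒜 ha hb)) ?_
    have : a * b - (a₀ * b₀ + a₁ * b₁) = a₀ * b₁ + a₁ * b₀ := by
      rw [ha₁, hb₁]; noncomm_ring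
    rw [this]
    exact (𝒜 1).add_mem (even_mul_odd_mem 𝒜 a₀.2 hb) (odd_mul_even_mem 𝒜 ha b₀.2)
  rw [mem_nilradical, ← isNilpotent_evenPart_iff]
  refine ⟨2, ?_⟩
  have : ((evenComponent 𝒜 (a * b) - a₀ * b₀ : evenPart 𝒜) : A) = a₁ * b₁ := by
    change (evenComponent 𝒜 (a * b) : A) - a₀ * b₀ = _
    rw [e, add_sub_cancel_left]
  rw [this, sq, mul_assoc, ← mul_assoc b₁, SuperRing.odd_anticomm hb ha, neg_mul, mul_assoc,
    SuperRing.odd_sq hb]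
  simp

/-- The homomorphism from a superring to its even part modulo nilpotents. -/
def bodyHom : A →+* evenPart 𝒜 ⧸ nilradical (evenPart 𝒜) where
  toFun a := Ideal.Quotient.mk _ (evenComponent 𝒜 a)
  map_one' := by
    have : evenComponent 𝒜 (1 : A) = 1 := Subtype.ext (evenComponent_of_even 𝒜 SuperRing.one_mem)
    rw [this, map_one]
  map_zero' := by
    have : evenComponent 𝒜 (0 : A) = 0 := Subtype.ext (evenComponent_of_even 𝒜 (zero_mem _))
    rw [this, map_zero]
  map_mul' a b := by
    rw [← map_mul]
    exact Ideal.Quotient.eq.2 (evenComponent_mul_sub_mem 𝒜 a b)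
  map_add' a b := by
    rw [← map_add]
    congr 1
    refine Subtype.ext (evenComponent_unique 𝒜 (add_mem (evenComponent 𝒜 a).2
      (evenComponent 𝒜 b).2) ?_)
    have := add_mem (sub_evenComponent_mem 𝒜 a) (sub_evenComponent_mem 𝒜 b)
    rwa [sub_add_sub_comm] at this

/-- The odd component squares to zero and commutes with the even one, so adding or subtracting it
does not affect nilpotency. -/
theorem isNilpotent_evenComponent_iff (a : A) :
    IsNilpotent (evenComponent 𝒜 a : A) ↔ IsNilpotent a := by
  have h1 : IsNilpotent (a - evenComponent 𝒜 a) :=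
    ⟨2, by rw [sq, SuperRing.odd_sq (sub_evenComponent_mem 𝒜 a)]⟩
  have hc : Commute (evenComponent 𝒜 a : A) a :=
    SuperRing.even_comm (𝒜 := 𝒜) (evenComponent 𝒜 a).2 a
  constructor <;> intro h
  · have := Commute.isNilpotent_add (hc.sub_right (Commute.refl _)) h h1
    rwa [add_sub_cancel] at this
  · have := Commute.isNilpotent_sub ((Commute.refl a).sub_right hc.symm) h h1
    rwa [sub_sub_cancel] at this

theorem bodyHom_eq_zero_iff {a : A} : bodyHom 𝒜 a = 0 ↔ IsNilpotent a := by
  rw [← isNilpotent_evenComponent_iff 𝒜, isNilpotent_evenPart_iff, ← mem_nilradical]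
  exact Ideal.Quotient.eq_zero_iff_mem

/-- Odd elements square to zero, hence lie in the kernel of `bodyHom`, a two-sided ideal that
consists of the nilpotent elements. -/
theorem isNilpotent_of_mem_span_odd {a : A} (h : a ∈ TwoSidedIdeal.span (𝒜 1 : Set A)) :
    IsNilpotent a := by
  have hle : TwoSidedIdeal.span (𝒜 1 : Set A) ≤ TwoSidedIdeal.ker (bodyHom 𝒜) := by
    rw [TwoSidedIdeal.span_le]
    intro b hb
    rw [SetLike.mem_coe, TwoSidedIdeal.mem_ker, bodyHom_eq_zero_iff]
    exact ⟨2, by rw [sq, SuperRing.odd_sq (𝒜 := 𝒜) hb]⟩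
  exact (bodyHom_eq_zero_iff 𝒜).1 ((TwoSidedIdeal.mem_ker _).1 (hle h))

end SuperRingNilpotents

/-! ### Integral superrings: irreducibility and reducedness of the spectrum -/

section IntegralSuperRings

variable {A : Type u} [Ring A]

/-- A superring whose reduction is a domain which acts without torsion, and whose nilpotent
elements lie, up to regular even factors, in the ideal generated by the odd part. -/
structure IsIntegralSuperRing (𝒜 : ZMod 2 → AddSubgroup A) : Prop where
  nontrivial : Nontrivial A
  nilpotent_or_regular : ∀ a ∈ 𝒜 0, IsNilpotent a ∨ ∀ b, a * b = 0 → b = 0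
  exists_mul_mem_span : ∀ a ∈ 𝒜 0, IsNilpotent a → ∃ u ∈ 𝒜 0, (∀ b, u * b = 0 → b = 0) ∧
    u * a ∈ TwoSidedIdeal.span (𝒜 1 : Set A)

variable {𝒜 : ZMod 2 → AddSubgroup A} [SuperRing 𝒜]

namespace IsIntegralSuperRing

/-- If `(xy)^k = 0` and `x` is not nilpotent, then `x` is regular and `x^k` can be cancelled from
`x^k y^k = 0`. -/
theorem isPrime_nilradical (h : IsIntegralSuperRing 𝒜) : (nilradical (evenPart 𝒜)).IsPrime := by
  have := h.nontrivial
  refine ⟨fun htop => ?_, fun {x y} hxy => ?_⟩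
  · have h1 : (1 : evenPart 𝒜) ∈ nilradical (evenPart 𝒜) := htop ▸ Submodule.mem_top
    rw [mem_nilradical, ← isNilpotent_evenPart_iff] at h1
    exact not_isNilpotent_one h1
  · rw [mem_nilradical, mem_nilradical, or_iff_not_imp_left]
    intro hx
    obtain ⟨k, hk⟩ := mem_nilradical.1 hxy
    have hreg : ∀ b : A, (x : A) * b = 0 → b = 0 :=
      (h.nilpotent_or_regular x x.2).resolve_left fun h => hx ((isNilpotent_evenPart_iff 𝒜).1 h)
    have hpow : ∀ (n : ℕ) (b : A), (x : A) ^ n * b = 0 → b = 0 := by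
      intro n
      induction n with
      | zero => intro b hb; simpa using hb
      | succ n ih => intro b hb; exact ih b (hreg _ (by rwa [pow_succ', mul_assoc] at hb))
    refine ⟨k, Subtype.ext (hpow k _ ?_)⟩
    rw [mul_pow] at hk
    exact congrArg Subtype.val hk

/-- For `a = a₀ + a₁`, the relation `ab = 0` reads `a₀ b = -a₁ b`. Using it twice gives `a₀² b = a₁²
b = 0`, and the even element `a₀` is regular. -/
theorem regular_of_not_isNilpotent (h : IsIntegralSuperRing 𝒜) {a : A} (ha : ¬IsNilpotent a)
    {b : A} (hab : a * b = 0) : b = 0 := by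
  set a₀ := evenComponent 𝒜 a
  obtain ⟨a₁, ha₁⟩ : ∃ c, c = a - (a₀ : A) := ⟨_, rfl⟩
  have hodd : a₁ ∈ 𝒜 1 := ha₁ ▸ sub_evenComponent_mem 𝒜 a
  have hreg : ∀ b : A, (a₀ : A) * b = 0 → b = 0 :=
    (h.nilpotent_or_regular a₀ a₀.2).resolve_left fun h =>
      ha ((isNilpotent_evenComponent_iff 𝒜 a).1 h)
  have e : (a₀ : A) * b = -(a₁ * b) := by
    rw [ha₁, sub_mul, hab, zero_sub, neg_neg]
  refine hreg _ (hreg _ ?_)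
  rw [e, mul_neg, ← mul_assoc, SuperRing.even_comm a₀.2, mul_assoc, e, mul_neg, neg_neg,
    ← mul_assoc, SuperRing.odd_sq hodd, zero_mul]

theorem zeroDivisorSet_eq (h : IsIntegralSuperRing 𝒜) :
    zeroDivisorSet A = {a | IsNilpotent a} := by
  have := h.nontrivial
  ext a
  constructor
  · rintro ⟨b, hb, hab⟩
    by_contra ha
    exact hb (h.regular_of_not_isNilpotent ha hab)
  · rintro ⟨k, hk⟩
    induction k with
    | zero => exact absurd hk (by simp)
    | succ k ih =>
      -- The last nonzero power of `a` is the witness that `a` is a zero divisor.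
      by_cases hk' : a ^ k = 0
      · exact ih hk'
      · exact ⟨a ^ k, hk', by rw [← pow_succ', hk]⟩

/-- The odd ideal of the total fractions is nil, and nilpotency descends to `A` because the
denominators are regular. Conversely, a regular even `u` with `u a` in the odd ideal becomes
invertible in the total fractions, so the image of `a` lies in the odd ideal there. -/
theorem superJ_eq (h : IsIntegralSuperRing 𝒜) : (superJ 𝒜 : Set A) = {a | IsNilpotent a} := by
  ext a
  rw [SetLike.mem_coe, superJ, TwoSidedIdeal.mem_comap]
  constructor
  · intro ha
    obtain ⟨k, hk⟩ := isNilpotent_of_mem_span_odd _ ha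
    refine ⟨k, ?_⟩
    rw [← map_pow] at hk
    obtain ⟨s, hs⟩ := LocalizedModule.mk_eq.1 (hk.trans (LocalizedModule.zero_mk 1).symm)
    refine s.2 _ ?_
    simpa [evenPart_smul_def, Submonoid.smul_def] using hs
  · intro (ha : IsNilpotent a)
    have hodd : ∀ b ∈ 𝒜 1, locMap 𝒜 (evenNonZeroDivisors 𝒜) b ∈ TwoSidedIdeal.span
        (locGrading 𝒜 (evenNonZeroDivisors 𝒜) 1 : Set (TotalFractions 𝒜)) :=
      fun b hb => TwoSidedIdeal.subset_span ⟨b, hb, 1, rfl⟩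
    rw [← add_sub_cancel (evenComponent 𝒜 a : A) a, map_add]
    refine add_mem ?_ (hodd _ (sub_evenComponent_mem 𝒜 a))
    obtain ⟨u, hu, hreg, hmem⟩ := h.exists_mul_mem_span _ (evenComponent 𝒜 a).2
      ((isNilpotent_evenComponent_iff 𝒜 a).2 ha)
    have hle : TwoSidedIdeal.span (𝒜 1 : Set A) ≤
        TwoSidedIdeal.comap (locMap 𝒜 (evenNonZeroDivisors 𝒜)) (TwoSidedIdeal.span
          (locGrading 𝒜 (evenNonZeroDivisors 𝒜) 1 : Set (TotalFractions 𝒜))) :=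
      TwoSidedIdeal.span_le.2 fun b hb => (TwoSidedIdeal.mem_comap _).2 (hodd b hb)
    have h1 := (TwoSidedIdeal.mem_comap _).1 (hle hmem)
    have e : locMap 𝒜 (evenNonZeroDivisors 𝒜) (evenComponent 𝒜 a) =
        LocalizedModule.mk 1 (⟨⟨u, hu⟩, hreg⟩ : evenNonZeroDivisors 𝒜) *
          locMap 𝒜 (evenNonZeroDivisors 𝒜) (u * evenComponent 𝒜 a) := by
      change LocalizedModule.mk _ 1 = LocalizedModule.mk _ _ * LocalizedModule.mk _ 1
      rw [LocalizedModule.mk_mul_mk, one_mul, mul_one, LocalizedModule.mk_eq]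
      exact ⟨1, by simp [evenPart_smul_def, Submonoid.smul_def]⟩
    rw [e]
    exact TwoSidedIdeal.mul_mem_left _ _ _ h1

/-- By `superJ_eq` the underlying ring is `A` modulo its nilpotents. `bodyHom` has the same kernel
and takes values in a domain, so the only zero divisor of the quotient is zero, which is the image
of the nilpotents, the zero divisors of `A`. -/
theorem isReducedSuperRing (h : IsIntegralSuperRing 𝒜) : IsReducedSuperRing 𝒜 := by
  refine ⟨h.superJ_eq, ?_⟩
  have := h.nontrivial
  have := h.isPrime_nilradical
  have hmem : ∀ a : A, (superJ 𝒜).ringCon.mk' a = 0 ↔ IsNilpotent a := by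
    intro a
    have : a ∈ (superJ 𝒜 : Set A) ↔ IsNilpotent a := by rw [h.superJ_eq]; rfl
    rw [← this, SetLike.mem_coe, TwoSidedIdeal.mem_iff, ← map_zero ((superJ 𝒜).ringCon.mk')]
    exact RingCon.eq _
  rw [h.zeroDivisorSet_eq]
  ext x
  obtain ⟨a, rfl⟩ := RingCon.mk'_surjective _ x
  constructor
  · rintro ⟨b, hb, hba⟩
    rw [← hba, (hmem b).2 hb]
    exact ⟨1, fun h1 => not_isNilpotent_one ((hmem 1).1 (by rw [map_one]; exact h1)), zero_mul _⟩
  · rintro ⟨y, hy, hxy⟩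
    obtain ⟨b, rfl⟩ := RingCon.mk'_surjective _ y
    refine ⟨a, ?_, rfl⟩
    rw [← map_mul, hmem, ← bodyHom_eq_zero_iff 𝒜, map_mul] at hxy
    rw [Ne, hmem, ← bodyHom_eq_zero_iff 𝒜] at hy
    exact (bodyHom_eq_zero_iff 𝒜).1 ((mul_eq_zero.1 hxy).resolve_right hy)

/-- The generic point of the spectrum of an integral superring. -/
def genericPoint (h : IsIntegralSuperRing 𝒜) : SuperSpec 𝒜 :=
  ⟨nilradical (evenPart 𝒜), h.isPrime_nilradical⟩

theorem closure_genericPoint (h : IsIntegralSuperRing 𝒜) :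
    closure ({h.genericPoint} : Set (SuperSpec 𝒜)) = Set.univ := by
  rw [PrimeSpectrum.closure_singleton, Set.eq_univ_iff_forall]
  exact fun p => nilradical_le_prime p.asIdeal

theorem irreducibleSpace (h : IsIntegralSuperRing 𝒜) : IrreducibleSpace (SuperSpec 𝒜) := by
  have h' : IsIrreducible (Set.univ : Set (SuperSpec 𝒜)) :=
    h.closure_genericPoint ▸ isIrreducible_singleton.closure
  exact (irreducibleSpace_def _).2 h'

theorem genericPoint_mem (h : IsIntegralSuperRing 𝒜) {U : Opens (SuperSpec 𝒜)} {p : SuperSpec 𝒜}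
    (hp : p ∈ U) : h.genericPoint ∈ U := by
  have hp' : p ∈ closure ({h.genericPoint} : Set (SuperSpec 𝒜)) :=
    h.closure_genericPoint ▸ Set.mem_univ p
  obtain ⟨_, hq, rfl⟩ := mem_closure_iff.1 hp' U U.2 hp
  exact hq

theorem regular_of_mem_primeCompl (h : IsIntegralSuperRing 𝒜) {s : evenPart 𝒜}
    (hs : s ∈ h.genericPoint.asIdeal.primeCompl) {b : A} (hb : (s : A) * b = 0) : b = 0 :=
  h.regular_of_not_isNilpotent (fun hn => hs ((isNilpotent_evenPart_iff 𝒜).1 hn)) hb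

/-- Denominators at the generic point are not nilpotent, hence regular, so no numerator is lost. -/
theorem mk_genericPoint_eq_zero_iff (h : IsIntegralSuperRing 𝒜) {a : A}
    {s : h.genericPoint.asIdeal.primeCompl} :
    (LocalizedModule.mk a s : SuperStalk 𝒜 h.genericPoint) = 0 ↔ a = 0 := by
  constructor
  · intro ha
    obtain ⟨r, hr⟩ := LocalizedModule.mk_eq.1 (ha.trans (LocalizedModule.zero_mk 1).symm)
    refine h.regular_of_mem_primeCompl r.2 ?_
    simpa [evenPart_smul_def, Submonoid.smul_def] using hr
  · rintro rfl
    exact LocalizedModule.zero_mk _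

section Sections

variable (h : IsIntegralSuperRing 𝒜) {U : Opens (SuperSpec 𝒜)} (hU : h.genericPoint ∈ U)

include h

/-- Near any point the section is a single fraction `a / f`, on a neighbourhood that contains the
generic point. Vanishing there forces `a = 0`. -/
theorem section_eq_zero (s : superSections 𝒜 U) (hs : s.1 ⟨h.genericPoint, hU⟩ = 0) : s = 0 := by
  refine Subtype.ext (funext fun p => ?_)
  obtain ⟨V, _, hpV, a, f, hV⟩ := s.2 p
  obtain ⟨hf, e⟩ := hV ⟨h.genericPoint, h.genericPoint_mem hpV⟩
  have ha : a = 0 := h.mk_genericPoint_eq_zero_iff.1 (e.symm.trans hs)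
  obtain ⟨hf', e'⟩ := hV ⟨p.1, hpV⟩
  refine e'.trans ?_
  rw [ha]
  exact LocalizedModule.zero_mk _

theorem section_exists_germ (s : superSections 𝒜 U) :
    ∃ (a : A) (f : h.genericPoint.asIdeal.primeCompl),
      s.1 ⟨h.genericPoint, hU⟩ = LocalizedModule.mk a f := by
  obtain ⟨V, hVU, hpV, a, f, hV⟩ := s.2 ⟨h.genericPoint, hU⟩
  obtain ⟨hf, e⟩ := hV ⟨h.genericPoint, hpV⟩
  exact ⟨a, ⟨f, hf⟩, e⟩

theorem even_section_exists_germ {s : superSections 𝒜 U} (hs : s ∈ sectionsGrading 𝒜 U 0) :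
    ∃ a ∈ 𝒜 0, ∃ f : h.genericPoint.asIdeal.primeCompl,
      s.1 ⟨h.genericPoint, hU⟩ = LocalizedModule.mk a f :=
  hs ⟨h.genericPoint, hU⟩

end Sections

end IsIntegralSuperRing

/-- The restriction map `A → 𝒪_A(U)`. -/
def toSections (𝒜 : ZMod 2 → AddSubgroup A) [SuperRing 𝒜] (U : Opens (SuperSpec 𝒜)) :
    A →+* superSections 𝒜 U where
  toFun a := ⟨fun _ => locMap 𝒜 _ a,
    fun p => ⟨U, le_rfl, p.2, a, 1, fun _ => ⟨Submonoid.one_mem _, rfl⟩⟩⟩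
  map_one' := Subtype.ext (funext fun _ => map_one _)
  map_zero' := Subtype.ext (funext fun _ => map_zero _)
  map_mul' _ _ := Subtype.ext (funext fun _ => map_mul _ _ _)
  map_add' _ _ := Subtype.ext (funext fun _ => map_add _ _ _)

theorem toSections_mem (U : Opens (SuperSpec 𝒜)) {i : ZMod 2} {a : A} (ha : a ∈ 𝒜 i) :
    toSections 𝒜 U a ∈ sectionsGrading 𝒜 U i :=
  fun _ => ⟨a, ha, 1, rfl⟩

namespace IsIntegralSuperRing

theorem sections_regular (h : IsIntegralSuperRing 𝒜) {U : Opens (SuperSpec 𝒜)}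
    (hU : h.genericPoint ∈ U) {s t : superSections 𝒜 U} {a : A}
    {f : h.genericPoint.asIdeal.primeCompl}
    (e : s.1 ⟨h.genericPoint, hU⟩ = LocalizedModule.mk a f)
    (hreg : ∀ b, a * b = 0 → b = 0) (hst : s * t = 0) : t = 0 := by
  obtain ⟨b, g, e'⟩ := h.section_exists_germ hU t
  have h0 : s.1 ⟨h.genericPoint, hU⟩ * t.1 ⟨h.genericPoint, hU⟩ = 0 :=
    congrFun (congrArg Subtype.val hst) _
  rw [e, e', LocalizedModule.mk_mul_mk, h.mk_genericPoint_eq_zero_iff] at h0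
  refine h.section_eq_zero hU _ ?_
  rw [e', hreg b h0]
  exact LocalizedModule.zero_mk _

/-- Sections embed into the generic stalk, where an even section is `a / f` with `a` even.
Nilpotency and regularity are then read off from `a`. -/
theorem sections (h : IsIntegralSuperRing 𝒜) {U : Opens (SuperSpec 𝒜)}
    (hU : h.genericPoint ∈ U) : IsIntegralSuperRing (sectionsGrading 𝒜 U) where
  nontrivial := by
    have := h.nontrivial
    refine ⟨0, 1, fun h01 => one_ne_zero (α := A) ?_⟩
    have : (0 : SuperStalk 𝒜 h.genericPoint) = 1 :=
      congrFun (congrArg Subtype.val h01) ⟨h.genericPoint, hU⟩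
    rw [loc_one_def] at this
    exact h.mk_genericPoint_eq_zero_iff.1 this.symm
  nilpotent_or_regular s hs := by
    obtain ⟨a, ha, f, e⟩ := h.even_section_exists_germ hU hs
    refine (h.nilpotent_or_regular a ha).imp ?_ fun hreg t ht => h.sections_regular hU e hreg ht
    rintro ⟨k, hk⟩
    refine ⟨k, h.section_eq_zero hU _ ?_⟩
    change s.1 ⟨h.genericPoint, hU⟩ ^ k = 0
    rw [e, LocalizedModule.mk_pow, hk]
    exact LocalizedModule.zero_mk _
  exists_mul_mem_span s hs hn := by
    obtain ⟨a, ha, f, e⟩ := h.even_section_exists_germ hU hs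
    have hna : IsNilpotent a := by
      obtain ⟨k, hk⟩ := hn
      have hk' : s.1 ⟨h.genericPoint, hU⟩ ^ k = 0 :=
        congrFun (congrArg Subtype.val hk) ⟨h.genericPoint, hU⟩
      rw [e, LocalizedModule.mk_pow, h.mk_genericPoint_eq_zero_iff] at hk'
      exact ⟨k, hk'⟩
    obtain ⟨u, hu, hreg, hmem⟩ := h.exists_mul_mem_span a ha hna
    -- The factor `f` clears the denominator, `(u f)(a / f) = u a`, and so reduces the claim to the
    -- global element `u a`.
    refine ⟨toSections 𝒜 U (u * (f : evenPart 𝒜)),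
      toSections_mem U (even_mul_even_mem 𝒜 hu f.1.2), fun t ht => ?_, ?_⟩
    · refine h.sections_regular hU (s := toSections 𝒜 U (u * (f : evenPart 𝒜)))
        (f := 1) rfl (fun b hb => ?_) ht
      rw [mul_assoc] at hb
      exact h.regular_of_mem_primeCompl f.2 (hreg _ hb)
    · have hle : TwoSidedIdeal.span (𝒜 1 : Set A) ≤ TwoSidedIdeal.comap (toSections 𝒜 U)
          (TwoSidedIdeal.span (sectionsGrading 𝒜 U 1 : Set (superSections 𝒜 U))) :=
        TwoSidedIdeal.span_le.2 fun b hb => (TwoSidedIdeal.mem_comap _).2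
          (TwoSidedIdeal.subset_span (toSections_mem U hb))
      have hkey : toSections 𝒜 U (u * (f : evenPart 𝒜)) * s = toSections 𝒜 U (u * a) := by
        rw [← sub_eq_zero]
        refine h.section_eq_zero hU _ ?_
        rw [AddSubgroupClass.coe_sub, Subring.coe_mul, Pi.sub_apply, Pi.mul_apply, e, sub_eq_zero]
        change LocalizedModule.mk (u * (f : evenPart 𝒜)) 1 * LocalizedModule.mk a f
          = LocalizedModule.mk (u * a) 1
        rw [LocalizedModule.mk_mul_mk, one_mul, LocalizedModule.mk_eq]
        refine ⟨1, ?_⟩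
        simp only [one_smul, Submonoid.smul_def, evenPart_smul_def]
        rw [← mul_assoc, SuperRing.even_comm f.1.2 u]
      rw [hkey]
      exact (TwoSidedIdeal.mem_comap _).1 (hle hmem)

theorem isReducedSuperSpec (h : IsIntegralSuperRing 𝒜) : IsReducedSuperSpec 𝒜 := by
  intro U _
  by_cases hU : h.genericPoint ∈ U
  · exact (h.sections hU).isReducedSuperRing
  -- An open set that misses the generic point is empty. Its sections form the zero ring, where
  -- everything is nilpotent and there are no zero divisors.
  · have hempty : IsEmpty U := ⟨fun p => hU (h.genericPoint_mem p.2)⟩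
    have hsub : Subsingleton (superSections 𝒜 U) :=
      ⟨fun _ _ => Subtype.ext (funext fun p => hempty.elim p)⟩
    have hsub' : Subsingleton (UnderlyingRing (sectionsGrading 𝒜 U)) :=
      (RingCon.mk'_surjective (superJ (sectionsGrading 𝒜 U)).ringCon).subsingleton
    refine ⟨Set.ext fun s => ?_, Set.ext fun x => ?_⟩
    · rw [Subsingleton.elim s 0]
      exact iff_of_true (zero_mem _) IsNilpotent.zero
    · refine iff_of_false ?_ ?_
      · rintro ⟨_, ⟨b, hb, _⟩, _⟩
        exact hb (Subsingleton.elim _ _)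
      · rintro ⟨b, hb, _⟩
        exact hb (Subsingleton.elim _ _)

end IsIntegralSuperRing

end IntegralSuperRings

end

noncomputable section

/-! ### Open immersions from inverting an even element -/

section OpenImmersions

variable {A : Type u} [Ring A] {𝒜 : ZMod 2 → AddSubgroup A} [SuperRing 𝒜]
variable {C : Type v} [Ring C] {𝒞 : ZMod 2 → AddSubgroup C} [SuperRing 𝒞]

/-- The image of the odd component of `a` is both even and odd, hence zero. -/
theorem SuperHom.mem_zero_of_injective (φ : SuperHom 𝒜 𝒞)
    (hinj : Function.Injective φ.toRingHom) {a : A} (ha : φ.toRingHom a ∈ 𝒞 0) : a ∈ 𝒜 0 := by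
  have h1 := φ.map_mem 1 _ (sub_evenComponent_mem 𝒜 a)
  have h0 := φ.map_mem 0 _ (evenComponent 𝒜 a).2
  have h : φ.toRingHom (a - evenComponent 𝒜 a) = 0 := by
    refine eq_zero_of_even_of_odd 𝒞 ?_ h1
    rw [map_sub]
    exact sub_mem ha h0
  rw [map_eq_zero_iff _ hinj, sub_eq_zero] at h
  rw [h]
  exact (evenComponent 𝒜 a).2

/-- Inverting an even element gives an open immersion. -/
theorem SuperHom.isOpenImmersion_of_away (φ : SuperHom 𝒜 𝒞)
    (hinj : Function.Injective φ.toRingHom) (s : evenPart 𝒜) (hs : IsUnit (φ.evenHom s))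
    (hsurj : ∀ c : C, ∃ (n : ℕ) (a : A), φ.toRingHom s ^ n * c = φ.toRingHom a) :
    φ.IsOpenImmersion := by
  have hinj' : Function.Injective φ.evenHom := fun a b hab =>
    Subtype.ext (hinj (congrArg Subtype.val hab))
  constructor
  -- On even parts the map is an ordinary localization away from `s`: if `s^n c = φ a` with `c`
  -- even, then `a` is even by injectivity.
  · let : Algebra (evenPart 𝒜) (evenPart 𝒞) := φ.evenHom.toAlgebra
    have : IsLocalization.Away s (evenPart 𝒞) := by
      refine ⟨⟨?_, ?_, ?_⟩⟩
      · rintro ⟨_, n, rfl⟩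
        change IsUnit (φ.evenHom (s ^ n))
        rw [map_pow]
        exact hs.pow n
      · intro c
        obtain ⟨n, a, h⟩ := hsurj c
        have ha : a ∈ 𝒜 0 := by
          refine φ.mem_zero_of_injective hinj ?_
          rw [← h]
          exact even_mul_even_mem 𝒞 (even_pow_mem 𝒞 (φ.map_mem 0 s s.2) n) c.2
        refine ⟨⟨⟨a, ha⟩, ⟨s ^ n, n, rfl⟩⟩, Subtype.ext ?_⟩
        change (c : C) * φ.toRingHom ((s : A) ^ n) = φ.toRingHom a
        rw [map_pow, ← h]
        exact SuperRing.even_comm c.2 _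
      · intro a b hab
        exact ⟨1, by rw [hinj' hab]⟩
    exact PrimeSpectrum.localization_away_isOpenEmbedding (evenPart 𝒞) s
  · intro p
    have hmem : s ∈ (φ.specMap p).asIdeal.primeCompl := fun hmem =>
      p.2.ne_top (Ideal.eq_top_of_isUnit_mem _ hmem hs)
    have hpow : ∀ n, s ^ n ∈ (φ.specMap p).asIdeal.primeCompl := fun n => pow_mem hmem n
    constructor
    · intro x y
      induction x using LocalizedModule.induction_on with
      | h a f =>
        induction y using LocalizedModule.induction_on with
        | h b g =>
          intro hab
          obtain ⟨r, hr⟩ := LocalizedModule.mk_eq.1 hab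
          -- The element `r` that identifies the two fractions need not come from `A`. Its multiple
          -- `s^n r` does, and it still avoids `p`.
          obtain ⟨n, r', hr'⟩ := hsurj (r : evenPart 𝒞)
          have hr0 : r' ∈ 𝒜 0 := by
            refine φ.mem_zero_of_injective hinj ?_
            rw [← hr']
            exact even_mul_even_mem 𝒞 (even_pow_mem 𝒞 (φ.map_mem 0 s s.2) n) r.1.2
          have hr1 : (⟨r', hr0⟩ : evenPart 𝒜) ∈ (φ.specMap p).asIdeal.primeCompl := by
            change φ.evenHom ⟨r', hr0⟩ ∈ p.asIdeal.primeCompl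
            have : φ.evenHom ⟨r', hr0⟩ = φ.evenHom s ^ n * r := Subtype.ext hr'.symm
            rw [this]
            exact mul_mem (pow_mem (S := p.asIdeal.primeCompl) hmem n) r.2
          refine LocalizedModule.mk_eq.2 ⟨⟨_, hr1⟩, hinj ?_⟩
          have e : (r : C) * (φ.toRingHom (g : evenPart 𝒜) * φ.toRingHom a)
              = (r : C) * (φ.toRingHom (f : evenPart 𝒜) * φ.toRingHom b) := hr
          change φ.toRingHom (r' * ((g : evenPart 𝒜) * a)) =
            φ.toRingHom (r' * ((f : evenPart 𝒜) * b))
          simp only [map_mul, ← hr', mul_assoc, e]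
    · intro y
      induction y using LocalizedModule.induction_on with
      | h c r =>
        obtain ⟨n, a, ha⟩ := hsurj c
        obtain ⟨m, r', hr'⟩ := hsurj (r : evenPart 𝒞)
        have hr0 : r' ∈ 𝒜 0 := by
          refine φ.mem_zero_of_injective hinj ?_
          rw [← hr']
          exact even_mul_even_mem 𝒞 (even_pow_mem 𝒞 (φ.map_mem 0 s s.2) m) r.1.2
        have hr1 : (⟨r', hr0⟩ : evenPart 𝒜) ∈ (φ.specMap p).asIdeal.primeCompl := by
          change φ.evenHom ⟨r', hr0⟩ ∈ p.asIdeal.primeCompl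
          have : φ.evenHom ⟨r', hr0⟩ = φ.evenHom s ^ m * r := Subtype.ext hr'.symm
          rw [this]
          exact mul_mem (pow_mem (S := p.asIdeal.primeCompl) hmem m) r.2
        -- With `a = s^n c` and `r' = s^m r`, the crossed powers of `s` balance: `s^m a / (s^n r') =
        -- c / r`.
        refine ⟨LocalizedModule.mk ((s ^ m : evenPart 𝒜) * a) (⟨_, hpow n⟩ * ⟨_, hr1⟩), ?_⟩
        refine LocalizedModule.mk_eq.2 ⟨1, ?_⟩
        rw [one_smul, one_smul]
        change (r : C) * φ.toRingHom ((s : A) ^ m * a) = φ.toRingHom ((s : A) ^ n * r') * c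
        rw [map_mul, map_mul, map_pow, map_pow, ← ha, ← hr', ← mul_assoc, ← mul_assoc, ← mul_assoc,
          mul_assoc (r : C), ← pow_add, ← pow_add, SuperRing.even_comm r.1.2, add_comm]

end OpenImmersions

/-! ### Localizations that are exterior algebras -/

section FermionicRegularity

variable {A : Type u} [Ring A] {𝒜 : ZMod 2 → AddSubgroup A} [SuperRing 𝒜]
variable {E : Type v} [Ring E]

/-- The homomorphism `S⁻¹A → E` induced by a homomorphism `A → E` which maps `S` to units. -/
def locLift (S : Submonoid (evenPart 𝒜)) (φ : A →+* E)
    (hφ : ∀ s : S, IsUnit (φ (s : evenPart 𝒜))) : LocalizedModule S A →+* E := by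
  -- The target is noncommutative. Denominators can be moved past numerators because even elements
  -- are central in `A`.
  have hcomm : ∀ (s : S) (x : A), Commute (↑(hφ s).unit⁻¹ : E) (φ x) := fun s x => by
    refine Commute.units_inv_left ?_
    change φ (s : evenPart 𝒜) * φ x = φ x * φ (s : evenPart 𝒜)
    rw [← map_mul, ← map_mul, SuperRing.even_comm s.1.2]
  have hinv : ∀ (s t : S), (↑(hφ (s * t)).unit⁻¹ : E) = ↑(hφ s).unit⁻¹ * ↑(hφ t).unit⁻¹ := by
    intro s t
    rw [← Units.val_mul, ← mul_inv_rev]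
    congr 2
    ext
    change φ (((s * t : S) : evenPart 𝒜) : A) = φ (t : evenPart 𝒜) * φ (s : evenPart 𝒜)
    rw [← map_mul, SuperRing.even_comm t.1.2]
    rfl
  have hcancel : ∀ (s : S), (↑(hφ s).unit⁻¹ : E) * φ (s : evenPart 𝒜) = 1 :=
    fun s => (hφ s).val_inv_mul
  let F : LocalizedModule S A → E := fun x => LocalizedModule.liftOn x
    (fun as => ↑(hφ as.2).unit⁻¹ * φ as.1) <| by
      rintro ⟨a, s⟩ ⟨b, t⟩ ⟨r, hr⟩
      have h : φ (r : evenPart 𝒜) * (φ (t : evenPart 𝒜) * φ a)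
          = φ (r : evenPart 𝒜) * (φ (s : evenPart 𝒜) * φ b) := by
        simpa only [map_mul] using (congrArg φ hr :
          φ ((r : evenPart 𝒜) * ((t : evenPart 𝒜) * a))
            = φ ((r : evenPart 𝒜) * ((s : evenPart 𝒜) * b)))
      have h' := (hφ r).mul_left_cancel h
      change ↑(hφ s).unit⁻¹ * φ a = ↑(hφ t).unit⁻¹ * φ b
      calc ↑(hφ s).unit⁻¹ * φ a = ↑(hφ s).unit⁻¹ * (↑(hφ t).unit⁻¹ * φ (t : evenPart 𝒜)) * φ a := by
            rw [hcancel, mul_one]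
        _ = ↑(hφ (s * t)).unit⁻¹ * (φ (t : evenPart 𝒜) * φ a) := by rw [hinv]; simp only [mul_assoc]
        _ = ↑(hφ (t * s)).unit⁻¹ * (φ (s : evenPart 𝒜) * φ b) := by rw [h', mul_comm s t]
        _ = ↑(hφ t).unit⁻¹ * (↑(hφ s).unit⁻¹ * φ (s : evenPart 𝒜)) * φ b := by
            rw [hinv]; simp only [mul_assoc]
        _ = _ := by rw [hcancel, mul_one]
  exact
    { toFun := F
      map_one' := by
        rw [loc_one_def]
        change ↑(hφ 1).unit⁻¹ * φ 1 = 1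
        exact hcancel 1
      map_zero' := by
        rw [← LocalizedModule.zero_mk 1]
        change ↑(hφ 1).unit⁻¹ * φ 0 = 0
        rw [map_zero, mul_zero]
      map_mul' := by
        intro x y
        induction x using LocalizedModule.induction_on with
        | h a s =>
          induction y using LocalizedModule.induction_on with
          | h b t =>
            rw [LocalizedModule.mk_mul_mk]
            change ↑(hφ (s * t)).unit⁻¹ * φ (a * b)
              = ↑(hφ s).unit⁻¹ * φ a * (↑(hφ t).unit⁻¹ * φ b)
            rw [hinv, map_mul, mul_assoc, mul_assoc, ← mul_assoc _ (φ a), (hcomm t a).eq, mul_assoc]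
      map_add' := by
        intro x y
        induction x using LocalizedModule.induction_on with
        | h a s =>
          induction y using LocalizedModule.induction_on with
          | h b t =>
            rw [LocalizedModule.mk_add_mk]
            change ↑(hφ (s * t)).unit⁻¹ * φ ((t : evenPart 𝒜) * a + (s : evenPart 𝒜) * b)
              = ↑(hφ s).unit⁻¹ * φ a + ↑(hφ t).unit⁻¹ * φ b
            rw [map_add, map_mul, map_mul, mul_add, hinv, mul_assoc, ← mul_assoc _ _ (φ a), hcancel,
              one_mul, ← hinv, mul_comm s t, hinv, mul_assoc, ← mul_assoc _ _ (φ b), hcancel,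
              one_mul] }

theorem locLift_mk (S : Submonoid (evenPart 𝒜)) (φ : A →+* E)
    (hφ : ∀ s : S, IsUnit (φ (s : evenPart 𝒜))) (a : A) (s : S) :
    locLift S φ hφ (LocalizedModule.mk a s) = ↑(hφ s).unit⁻¹ * φ a := rfl

end FermionicRegularity

section

/-- A criterion for a localization to be an exterior algebra. -/
theorem isFermionicallyRegular_localization {A : Type u} [Ring A] {𝒜 : ZMod 2 → AddSubgroup A}
    [SuperRing 𝒜] (S : Submonoid (evenPart 𝒜)) {L : Type u} [CommRing L] {M : Type u}
    [AddCommGroup M] [Module L M] (φ : A →+* ExteriorAlgebra L M)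
    (hinj : Function.Injective φ)
    (hgr : ∀ i, ∀ a ∈ 𝒜 i, φ a ∈ CliffordAlgebra.evenOdd (0 : QuadraticForm L M) i)
    (hφ : ∀ s : S, IsUnit (φ (s : evenPart 𝒜)))
    (hsurj : ∀ x, ∃ s : S, ∃ a, φ (s : evenPart 𝒜) * x = φ a) :
    IsFermionicallyRegular (locGrading 𝒜 S) := by
  have hbij : Function.Bijective (locLift S φ hφ) := by
    constructor
    · rw [injective_iff_map_eq_zero]
      intro x hx
      induction x using LocalizedModule.induction_on with
      | h a s =>
        rw [locLift_mk, Units.mul_right_eq_zero, map_eq_zero_iff _ hinj] at hx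
        rw [hx]
        exact LocalizedModule.zero_mk _
    · intro x
      obtain ⟨s, a, h⟩ := hsurj x
      refine ⟨LocalizedModule.mk a s, ?_⟩
      rw [locLift_mk, ← h, ← mul_assoc, (hφ s).val_inv_mul, one_mul]
  let e := RingEquiv.ofBijective _ hbij
  have he : ∀ x, e x = locLift S φ hφ x := fun _ => rfl
  have hmem : ∀ (s : S), ∀ y ∈ CliffordAlgebra.evenOdd (0 : QuadraticForm L M) 1,
      φ (s : evenPart 𝒜) * y ∈ CliffordAlgebra.evenOdd (0 : QuadraticForm L M) 1 := by
    intro s y hy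
    have := SetLike.mul_mem_graded (hgr 0 _ s.1.2) hy
    rwa [zero_add] at this
  have hmem0 : ∀ (s : S), ∀ y ∈ CliffordAlgebra.evenOdd (0 : QuadraticForm L M) 0,
      φ (s : evenPart 𝒜) * y ∈ CliffordAlgebra.evenOdd (0 : QuadraticForm L M) 0 := by
    intro s y hy
    have := SetLike.mul_mem_graded (hgr 0 _ s.1.2) hy
    rwa [zero_add] at this
  have hcompl := CliffordAlgebra.evenOdd_isCompl (0 : QuadraticForm L M)
  have hzero : ∀ y, y ∈ CliffordAlgebra.evenOdd (0 : QuadraticForm L M) 0 →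
      y ∈ CliffordAlgebra.evenOdd (0 : QuadraticForm L M) 1 → y = 0 := fun y h0 h1 =>
    (Submodule.disjoint_def.1 hcompl.disjoint) y h0 h1
  have hsplit : ∀ y, ∃ b ∈ CliffordAlgebra.evenOdd (0 : QuadraticForm L M) 0,
      ∃ c ∈ CliffordAlgebra.evenOdd (0 : QuadraticForm L M) 1, b + c = y := fun y =>
    Submodule.mem_sup.1 (hcompl.sup_eq_top ▸ Submodule.mem_top)
  -- Multiplication by the even unit `φ s` preserves parity, so it annihilates the component of
  -- `φ(s)⁻¹ φ(a)` of the wrong parity. That component is therefore zero.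
  have hgr' : ∀ i, ∀ x ∈ locGrading 𝒜 S i, e x ∈ CliffordAlgebra.evenOdd 0 i := by
    rintro i _ ⟨a, ha, s, rfl⟩
    rw [he, locLift_mk]
    obtain ⟨b, hb, c, hc, hbc⟩ := hsplit (↑(hφ s).unit⁻¹ * φ a)
    have h1 : φ (s : evenPart 𝒜) * b + φ (s : evenPart 𝒜) * c = φ a := by
      rw [← mul_add, hbc, ← mul_assoc, (hφ s).mul_val_inv, one_mul]
    rw [← hbc]
    fin_cases i
    · have : φ (s : evenPart 𝒜) * c = 0 := by
        refine hzero _ ?_ (hmem s c hc)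
        rw [← sub_eq_iff_eq_add'.2 h1.symm]
        exact Submodule.sub_mem _ (hgr 0 a ha) (hmem0 s b hb)
      rw [(hφ s).mul_right_eq_zero.1 this, add_zero]
      exact hb
    · have : φ (s : evenPart 𝒜) * b = 0 := by
        refine hzero _ (hmem0 s b hb) ?_
        rw [← sub_eq_iff_eq_add.2 h1.symm]
        exact Submodule.sub_mem _ (hgr 1 a ha) (hmem s c hc)
      rw [(hφ s).mul_right_eq_zero.1 this, zero_add]
      exact hc
  refine ⟨L, inferInstance, M, inferInstance, inferInstance, e.symm, fun i x => ⟨fun h => ?_, ?_⟩⟩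
  · have := hgr' i _ h
    rwa [e.apply_symm_apply] at this
  · intro hx
    obtain ⟨b, hb, c, hc, hbc⟩ := exists_even_add_odd (locGrading 𝒜 S) (e.symm x)
    have hb' := hgr' 0 b hb
    have hc' := hgr' 1 c hc
    have hx' : e b + e c = x := by rw [← map_add, hbc, e.apply_symm_apply]
    rw [← hbc]
    fin_cases i
    · have : e c = 0 := by
        refine hzero _ ?_ hc'
        rw [← sub_eq_iff_eq_add'.2 hx'.symm]
        exact Submodule.sub_mem _ hx hb'
      rw [(map_eq_zero_iff e e.injective).1 this, add_zero]
      exact hb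
    · have : e b = 0 := by
        refine hzero _ hb' ?_
        rw [← sub_eq_iff_eq_add.2 hx'.symm]
        exact Submodule.sub_mem _ hx hc'
      rw [(map_eq_zero_iff e e.injective).1 this, zero_add]
      exact hc

end

end

noncomputable section

/-! ### Monomials in the exterior algebra -/

section ExteriorMonomials

variable {q : ℕ}

/-- The monomial `ξ^I`, the product of the `ξ_i^(I_i)` in increasing order. -/
def extMonomial (R : Type*) [CommRing R] (I : Fin q → ℕ) : ExteriorAlgebra R (Fin q → R) :=
  ((List.finRange q).map fun i => ExteriorAlgebra.ι R (Pi.single i 1 : Fin q → R) ^ I i).prod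

theorem List.prod_map_pow_indicator {ι M : Type*} [DecidableEq ι] [Monoid M] (f : ι → M)
    (s : Finset ι) (l : List ι) :
    (l.map fun i => f i ^ (if i ∈ s then 1 else 0)).prod = ((l.filter (· ∈ s)).map f).prod := by
  induction l with
  | nil => rfl
  | cons i l ih =>
    rw [List.map_cons, List.prod_cons, ih]
    by_cases hi : i ∈ s <;> simp [hi]

/-- Both sides multiply the `ξ_i` with `i ∈ s` in increasing order: two strictly increasing lists
with the same members coincide. -/
theorem exteriorBasis_eq_extMonomial (R : Type*) [CommRing R] (s : Finset (Fin q)) :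
    (Pi.basisFun R (Fin q)).ExteriorAlgebra s
      = extMonomial R (fun i => if i ∈ s then 1 else 0) := by
  rw [ExteriorAlgebra.basis_apply, extMonomial, List.prod_map_pow_indicator]
  refine (ExteriorAlgebra.ιMulti_apply _).trans ?_
  congr 1
  set t := (Set.powersetCard.prodEquiv.symm s).2
  have hl : List.ofFn (Set.powersetCard.ofFinEmbEquiv.symm t)
      = (List.finRange q).filter (· ∈ s) := by
    refine List.SortedLT.eq_of_mem_iff ?_ ?_ fun i => ?_
    · exact List.sortedLT_ofFn_iff.2 (OrderEmbedding.strictMono _)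
    · exact ((List.sortedLT_finRange q).pairwise.filter _).sortedLT
    · rw [List.mem_ofFn, ← Set.mem_range, Set.powersetCard.mem_range_ofFinEmbEquiv_symm_iff_mem]
      simp only [List.mem_filter, List.mem_finRange, true_and, decide_eq_true_eq]
      rfl
  rw [← hl, List.map_ofFn]
  simp only [Function.comp_def, Pi.basisFun_apply]
  rfl

theorem extMonomial_eq_basis (R : Type*) [CommRing R] {I : Fin q → ℕ} (hI : ∀ i, I i ≤ 1) :
    extMonomial R I = (Pi.basisFun R (Fin q)).ExteriorAlgebra
      (Finset.univ.filter fun i => I i = 1) := by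
  rw [exteriorBasis_eq_extMonomial]
  congr 1
  ext i
  have := hI i
  simp only [Finset.mem_filter, Finset.mem_univ, true_and]
  split_ifs <;> omega

theorem extMonomial_zero (R : Type*) [CommRing R] : extMonomial R (0 : Fin q → ℕ) = 1 := by
  simp [extMonomial]

/-- The factor `ξ_j` is moved to the right, at the cost of a sign for each `ξ_i` that it passes,
until it reaches its own slot. The sign is left undetermined, as subalgebras are closed under
negation. The induction needs arbitrary lists without repetitions. -/
theorem ι_mul_list_prod {R : Type*} [CommRing R] {j : Fin q} {I : Fin q → ℕ} (hj : I j = 0)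
    (hI : ∀ i, I i ≤ 1) (l : List (Fin q)) (hl : l.Nodup) (hjl : j ∈ l) :
    let f : (Fin q → ℕ) → ExteriorAlgebra R (Fin q → R) := fun I =>
      (l.map fun i => ExteriorAlgebra.ι R (Pi.single i 1 : Fin q → R) ^ I i).prod
    ExteriorAlgebra.ι R (Pi.single j 1 : Fin q → R) * f I = f (I + Pi.single j 1) ∨
    ExteriorAlgebra.ι R (Pi.single j 1 : Fin q → R) * f I = -f (I + Pi.single j 1) := by
  induction l with
  | nil => simp at hjl
  | cons i l ih =>
    obtain ⟨hil, hl⟩ := List.nodup_cons.1 hl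
    by_cases hij : i = j
    · subst hij
      left
      have h : (l.map fun k => ExteriorAlgebra.ι R (Pi.single k 1 : Fin q → R) ^ I k) =
          l.map fun k => ExteriorAlgebra.ι R (Pi.single k 1 : Fin q → R) ^
            (I + Pi.single i 1 : Fin q → ℕ) k := by
        refine List.map_congr_left fun k hk => ?_
        have : k ≠ i := fun h => hil (h ▸ hk)
        simp [this]
      simp only [List.map_cons, List.prod_cons, h]
      simp [hj]
    · have hjl' : j ∈ l := (List.mem_cons.1 hjl).resolve_left (Ne.symm hij)
      have := ih hl hjl'
      simp only [List.map_cons, List.prod_cons] at this ⊢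
      have h1 : (I + Pi.single j 1 : Fin q → ℕ) i = I i := by simp [hij]
      rw [h1]
      have hc : ExteriorAlgebra.ι R (Pi.single j 1 : Fin q → R) *
          ExteriorAlgebra.ι R (Pi.single i 1 : Fin q → R) ^ I i =
          ExteriorAlgebra.ι R (Pi.single i 1 : Fin q → R) ^ I i *
            ExteriorAlgebra.ι R (Pi.single j 1 : Fin q → R) ∨
          ExteriorAlgebra.ι R (Pi.single j 1 : Fin q → R) *
          ExteriorAlgebra.ι R (Pi.single i 1 : Fin q → R) ^ I i =
          -(ExteriorAlgebra.ι R (Pi.single i 1 : Fin q → R) ^ I i *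
            ExteriorAlgebra.ι R (Pi.single j 1 : Fin q → R)) := by
        have := hI i
        interval_cases h : I i
        · left; simp
        · right
          rw [pow_one, eq_neg_iff_add_eq_zero]
          exact ExteriorAlgebra.ι_add_mul_swap _ _
      rcases hc with hc | hc <;> rcases this with h | h <;>
        rw [← mul_assoc, hc] <;> simp [mul_assoc, h]

theorem ι_mul_extMonomial (R : Type*) [CommRing R] {j : Fin q} {I : Fin q → ℕ} (hj : I j = 0)
    (hI : ∀ i, I i ≤ 1) :
    ExteriorAlgebra.ι R (Pi.single j 1 : Fin q → R) * extMonomial R I =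
      extMonomial R (I + Pi.single j 1) ∨
    ExteriorAlgebra.ι R (Pi.single j 1 : Fin q → R) * extMonomial R I =
      -extMonomial R (I + Pi.single j 1) :=
  ι_mul_list_prod hj hI _ (List.nodup_finRange q) (List.mem_finRange j)

/-- Contraction is a skew derivation, and the `j`-th coordinate functional kills each factor `ξ_i`
with `i ≠ j`. -/
theorem contractLeft_extMonomial {R : Type*} [CommRing R] {j : Fin q} {I : Fin q → ℕ}
    (hj : I j = 0) (hI : ∀ i, I i ≤ 1) :
    CliffordAlgebra.contractLeft (Q := (0 : QuadraticForm R (Fin q → R))) (LinearMap.proj j)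
      (extMonomial R I) = 0 := by
  unfold extMonomial
  induction List.finRange q with
  | nil => exact CliffordAlgebra.contractLeft_one (Q := (0 : QuadraticForm R (Fin q → R))) _
  | cons i l ih =>
    rw [List.map_cons, List.prod_cons]
    have := hI i
    interval_cases h : I i
    · rwa [pow_zero, one_mul]
    · have hij : i ≠ j := by rintro rfl; omega
      rw [pow_one]
      refine (CliffordAlgebra.contractLeft_ι_mul _ _ _).trans ?_
      rw [ih, mul_zero, LinearMap.proj_apply, Pi.single_eq_of_ne (Ne.symm hij), zero_smul, sub_zero]

end ExteriorMonomials

/-! ### Base change of exterior algebras -/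

section BaseChange

variable {q : ℕ} (R S : Type*) [CommRing R] [CommRing S] [Algebra R S]

/-- The homomorphism `Λ_R(R^q) → Λ_S(S^q)` of exterior algebras. -/
def exteriorBaseChange :
    ExteriorAlgebra R (Fin q → R) →ₐ[R] ExteriorAlgebra S (Fin q → S) :=
  ExteriorAlgebra.lift R
    ⟨(ExteriorAlgebra.ι S (M := Fin q → S)).restrictScalars R ∘ₗ
      (Algebra.linearMap R S).compLeft (Fin q), fun _ => ExteriorAlgebra.ι_sq_zero _⟩

theorem exteriorBaseChange_ι (v : Fin q → R) :
    exteriorBaseChange R S (ExteriorAlgebra.ι R v) =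
      ExteriorAlgebra.ι S (fun i => algebraMap R S (v i)) :=
  ExteriorAlgebra.lift_ι_apply _ _ _ _

theorem exteriorBaseChange_extMonomial (I : Fin q → ℕ) :
    exteriorBaseChange R S (extMonomial R I) = extMonomial S I := by
  rw [extMonomial, map_list_prod, List.map_map, extMonomial]
  congr 2
  ext i
  rw [Function.comp_apply, map_pow, exteriorBaseChange_ι]
  congr 2
  ext j
  rcases eq_or_ne j i with rfl | h
  · simp
  · simp [h]

/-- Basis monomials go to basis monomials, so it suffices to compare two linear maps on the basis.
-/
theorem basis_repr_exteriorBaseChange (a : ExteriorAlgebra R (Fin q → R)) (s : Finset (Fin q)) :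
    (Pi.basisFun S (Fin q)).ExteriorAlgebra.repr (exteriorBaseChange R S a) s =
      algebraMap R S ((Pi.basisFun R (Fin q)).ExteriorAlgebra.repr a s) := by
  have h : ((Pi.basisFun S (Fin q)).ExteriorAlgebra.coord s).restrictScalars R ∘ₗ
      (exteriorBaseChange R S).toLinearMap =
      Algebra.linearMap R S ∘ₗ (Pi.basisFun R (Fin q)).ExteriorAlgebra.coord s := by
    refine (Pi.basisFun R (Fin q)).ExteriorAlgebra.ext fun t => ?_
    simp only [LinearMap.comp_apply, LinearMap.restrictScalars_apply, AlgHom.toLinearMap_apply,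
      Module.Basis.coord_apply, Module.Basis.repr_self, Algebra.linearMap_apply]
    rw [exteriorBasis_eq_extMonomial, exteriorBaseChange_extMonomial,
      ← exteriorBasis_eq_extMonomial, Module.Basis.repr_self, Finsupp.single_apply,
      Finsupp.single_apply]
    split_ifs <;> simp
  exact LinearMap.congr_fun h a

variable {R S}

theorem exteriorBaseChange_mem {i : ZMod 2} {a : ExteriorAlgebra R (Fin q → R)}
    (ha : a ∈ CliffordAlgebra.evenOdd (0 : QuadraticForm R (Fin q → R)) i) :
    exteriorBaseChange R S a ∈
      CliffordAlgebra.evenOdd (0 : QuadraticForm S (Fin q → S)) i := by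
  have hι : ∀ v w : Fin q → R, ∀ j, ∀ x ∈ CliffordAlgebra.evenOdd
      (0 : QuadraticForm S (Fin q → S)) j, exteriorBaseChange R S (ExteriorAlgebra.ι R v) *
        exteriorBaseChange R S (ExteriorAlgebra.ι R w) * x ∈
          CliffordAlgebra.evenOdd (0 : QuadraticForm S (Fin q → S)) j := by
    intro v w j x hx
    rw [exteriorBaseChange_ι, exteriorBaseChange_ι]
    have := SetLike.mul_mem_graded (CliffordAlgebra.ι_mul_ι_mem_evenOdd_zero
      (0 : QuadraticForm S (Fin q → S)) (fun i => algebraMap R S (v i))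
        (fun i => algebraMap R S (w i))) hx
    rwa [zero_add] at this
  fin_cases i
  · refine CliffordAlgebra.even_induction (0 : QuadraticForm R (Fin q → R))
      (motive := fun a _ => exteriorBaseChange R S a ∈
        CliffordAlgebra.evenOdd (0 : QuadraticForm S (Fin q → S)) 0) ?_ ?_ ?_ a ha
    · intro r
      rw [AlgHom.commutes, IsScalarTower.algebraMap_apply R S]
      exact SetLike.algebraMap_mem_graded
        (CliffordAlgebra.evenOdd (0 : QuadraticForm S (Fin q → S))) _
    · intro x y _ _ hx hy
      rw [map_add]
      exact Submodule.add_mem _ hx hy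
    · intro v w x _ hx
      rw [map_mul, map_mul]
      exact hι v w 0 _ hx
  · refine CliffordAlgebra.odd_induction (0 : QuadraticForm R (Fin q → R))
      (P := fun a _ => exteriorBaseChange R S a ∈
        CliffordAlgebra.evenOdd (0 : QuadraticForm S (Fin q → S)) 1) ?_ ?_ ?_ a ha
    · intro v
      rw [exteriorBaseChange_ι R S v]
      exact CliffordAlgebra.ι_mem_evenOdd_one _ _
    · intro x y _ _ hx hy
      rw [map_add]
      exact Submodule.add_mem _ hx hy
    · intro v w x _ hx
      rw [map_mul, map_mul]
      exact hι v w 1 _ hx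

end BaseChange

/-! ### Embedding `ℂ[T]` into an exterior algebra over a field -/

section TorusFractions

variable (p q : ℕ)

instance torusGrading.instSuperRing : SuperRing (torusGrading p q) := by
  have : SuperRing (restrictGrading (⊤ : Subalgebra ℂ (TorusRing p q))) :=
    superRing_restrictGrading _ fun _ _ => trivial
  refine ⟨this.one_mem, fun {i j a b} ha hb =>
    this.mul_mem (a := ⟨a, trivial⟩) (b := ⟨b, trivial⟩) ha hb, ⟨?_, ?_⟩, fun {a} ha b =>
    congrArg Subtype.val (this.even_comm (a := ⟨a, trivial⟩) ha ⟨b, trivial⟩), fun {a b} ha hb =>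
    congrArg Subtype.val (this.odd_anticomm (a := ⟨a, trivial⟩) (b := ⟨b, trivial⟩) ha hb),
    fun {a} ha => congrArg Subtype.val (this.odd_sq (a := ⟨a, trivial⟩) ha)⟩
  · rw [disjoint_iff, eq_bot_iff]
    rintro a ⟨h0, h1⟩
    exact congrArg Subtype.val (eq_zero_of_even_of_odd
      (restrictGrading (⊤ : Subalgebra ℂ (TorusRing p q))) (a := ⟨a, trivial⟩) h0 h1)
  · rw [codisjoint_iff, eq_top_iff]
    intro a _
    obtain ⟨b, hb, c, hc, h⟩ := exists_even_add_odd
      (restrictGrading (⊤ : Subalgebra ℂ (TorusRing p q))) ⟨a, trivial⟩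
    have h' : (b : TorusRing p q) + c = a := congrArg Subtype.val h
    rw [← h']
    exact AddSubgroup.add_mem_sup hb hc

variable {p q}

/-- The inclusion of the Laurent polynomials into `ℂ[T]`. -/
def laurentHom (p q : ℕ) : AddMonoidAlgebra ℂ (Fin p → ℤ) →ₐ[ℂ] TorusRing p q :=
  AddMonoidAlgebra.mapAlgHom _ (Algebra.ofId ℂ (ExteriorAlgebra ℂ (Fin q → ℂ)))

theorem laurentHom_single (χ : Fin p → ℤ) (z : ℂ) :
    laurentHom p q (AddMonoidAlgebra.single χ z) =
      AddMonoidAlgebra.single χ (algebraMap ℂ _ z) :=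
  AddMonoidAlgebra.mapAlgHom_single _ _ _

theorem laurentHom_mem (r : AddMonoidAlgebra ℂ (Fin p → ℤ)) :
    laurentHom p q r ∈ torusGrading p q 0 := by
  intro χ
  rw [laurentHom, AddMonoidAlgebra.coeff_mapAlgHom]
  exact (mem_evenOdd_iff _).1.2 (AlgHom.commutes _ _)

theorem single_mul_single_zero (χ : Fin p → ℤ) (a : ExteriorAlgebra ℂ (Fin q → ℂ)) :
    AddMonoidAlgebra.single χ a =
      AddMonoidAlgebra.single χ 1 * (AddMonoidAlgebra.single 0 a : TorusRing p q) := by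
  rw [AddMonoidAlgebra.single_mul_single, add_zero, one_mul]

/-- An induction principle for subalgebras of `ℂ[T]`. -/
theorem torusRing_subalgebra_eq_top (S : Subalgebra ℂ (TorusRing p q))
    (h : ∀ r, laurentHom p q r ∈ S) (hodd : ∀ i, oddCoord i ∈ S) : S = ⊤ := by
  rw [eq_top_iff]
  rintro f -
  induction f using AddMonoidAlgebra.induction_linear with
  | zero => exact zero_mem S
  | add x y hx hy => exact add_mem hx hy
  | single χ a =>
    rw [single_mul_single_zero]
    refine mul_mem (by simpa [laurentHom_single] using h (AddMonoidAlgebra.single χ 1)) ?_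
    induction a using ExteriorAlgebra.induction with
    | algebraMap z => simpa [laurentHom_single] using h (AddMonoidAlgebra.single 0 z)
    | ι v =>
      have hv : v = ∑ i, v i • (Pi.single i 1 : Fin q → ℂ) := by
        ext j; simp [Finset.sum_apply, Pi.single_apply]
      have : AddMonoidAlgebra.single 0 (ExteriorAlgebra.ι ℂ v) =
          ∑ i, v i • (oddCoord i : TorusRing p q) := by
        conv_lhs => rw [hv, map_sum]
        refine (map_sum (AddMonoidAlgebra.singleAddHom (0 : Fin p → ℤ)) _ _).trans ?_
        refine Finset.sum_congr rfl fun i _ => ?_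
        rw [map_smul, oddCoord, AddMonoidAlgebra.smul_single]
        rfl
      rw [this]
      exact sum_mem fun i _ => S.smul_mem (hodd i) _
    | mul a b ha hb =>
      have := mul_mem ha hb
      rwa [AddMonoidAlgebra.single_mul_single, add_zero] at this
    | add a b ha hb =>
      rw [AddMonoidAlgebra.single_add]
      exact add_mem ha hb

theorem oddCoord_mem (i : Fin q) : oddCoord i ∈ torusGrading p q 1 := by
  rw [mem_torusGrading_one, oddCoord, parityInvolution_single, ← AddMonoidAlgebra.single_neg]
  exact congrArg _ (CliffordAlgebra.involute_ι _)

/-- Every element of `ℂ[T]` is a Laurent polynomial up to nilpotents. -/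
theorem exists_bodyHom_eq (f : TorusRing p q) :
    ∃ r, bodyHom (torusGrading p q) f = bodyHom (torusGrading p q) (laurentHom p q r) := by
  -- The elements with this property form a subalgebra. It contains the Laurent polynomials, and
  -- each `ξ_i` with `r = 0`.
  let S : Subalgebra ℂ (TorusRing p q) :=
    { carrier := {f | ∃ r, bodyHom (torusGrading p q) f =
        bodyHom (torusGrading p q) (laurentHom p q r)}
      mul_mem' := by
        rintro f g ⟨r, hr⟩ ⟨s, hs⟩
        exact ⟨r * s, by rw [map_mul, map_mul, map_mul, hr, hs]⟩
      add_mem' := by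
        rintro f g ⟨r, hr⟩ ⟨s, hs⟩
        exact ⟨r + s, by rw [map_add, map_add, map_add, hr, hs]⟩
      algebraMap_mem' := fun z => ⟨algebraMap _ _ z, by rw [AlgHom.commutes]⟩ }
  have hS : S = ⊤ := by
    refine torusRing_subalgebra_eq_top S (fun r => ⟨r, rfl⟩) fun i => ⟨0, ?_⟩
    rw [map_zero, map_zero, bodyHom_eq_zero_iff]
    exact ⟨2, by rw [sq, SuperRing.odd_sq (oddCoord_mem i)]⟩
  exact (hS ▸ Algebra.mem_top : f ∈ S)

/-- The field of rational functions on the torus. -/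
abbrev TorusFractions (p : ℕ) : Type := FractionRing (AddMonoidAlgebra ℂ (Fin p → ℤ))

/-- The embedding of `ℂ[T]` into an exterior algebra over a field. -/
def torusFractionHom (p q : ℕ) :
    TorusRing p q →+* ExteriorAlgebra (TorusFractions p) (Fin q → TorusFractions p) :=
  AddMonoidAlgebra.liftNCRingHom (exteriorBaseChange ℂ (TorusFractions p)).toRingHom
    (((algebraMap (TorusFractions p) _).comp
      (algebraMap (AddMonoidAlgebra ℂ (Fin p → ℤ)) (TorusFractions p))).toMonoidHom.comp
      (AddMonoidAlgebra.of ℂ (Fin p → ℤ)))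
    fun _ _ => (Algebra.commutes _ _).symm

theorem torusFractionHom_single (χ : Fin p → ℤ) (a : ExteriorAlgebra ℂ (Fin q → ℂ)) :
    torusFractionHom p q (AddMonoidAlgebra.single χ a) =
      exteriorBaseChange ℂ (TorusFractions p) a * algebraMap (TorusFractions p) _
        (algebraMap (AddMonoidAlgebra ℂ (Fin p → ℤ)) (TorusFractions p)
          (AddMonoidAlgebra.single χ 1)) :=
  AddMonoidAlgebra.liftNCRingHom_single _ _ _ _ _

theorem torusFractionHom_laurentHom (r : AddMonoidAlgebra ℂ (Fin p → ℤ)) :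
    torusFractionHom p q (laurentHom p q r) =
      algebraMap (TorusFractions p) _ (algebraMap _ (TorusFractions p) r) := by
  induction r using AddMonoidAlgebra.induction_linear with
  | zero => simp
  | add x y hx hy => simp only [map_add, hx, hy]
  | single χ z =>
    have h : (AddMonoidAlgebra.single χ z : AddMonoidAlgebra ℂ (Fin p → ℤ)) =
        algebraMap ℂ _ z * AddMonoidAlgebra.single χ 1 := by
      rw [← Algebra.smul_def, AddMonoidAlgebra.smul_single, smul_eq_mul, mul_one]
    rw [laurentHom_single, torusFractionHom_single, h, map_mul, map_mul, AlgHom.commutes,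
      ← IsScalarTower.algebraMap_apply, ← IsScalarTower.algebraMap_apply,
      ← IsScalarTower.algebraMap_apply]

theorem torusFractionHom_oddCoord (i : Fin q) :
    torusFractionHom p q (oddCoord i) =
      ExteriorAlgebra.ι (TorusFractions p) (Pi.single i 1) := by
  rw [oddCoord, torusFractionHom_single, ← AddMonoidAlgebra.one_def, map_one, map_one, mul_one,
    exteriorBaseChange_ι]
  congr 1
  ext j
  rcases eq_or_ne j i with rfl | h
  · simp
  · simp [h]

/-- The coordinate at `ξ^s` is the Laurent polynomial that multiplies `ξ^s` in `f`. Injectivity of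
`torusFractionHom` thereby reduces to that of the Laurent polynomials in their field of fractions.
-/
theorem basis_repr_torusFractionHom (f : TorusRing p q) (s : Finset (Fin q)) :
    (Pi.basisFun (TorusFractions p) (Fin q)).ExteriorAlgebra.repr (torusFractionHom p q f) s =
      algebraMap (AddMonoidAlgebra ℂ (Fin p → ℤ)) (TorusFractions p) (.ofCoeff (f.coeff.mapRange
        ((Pi.basisFun ℂ (Fin q)).ExteriorAlgebra.coord s) (map_zero _))) := by
  induction f using AddMonoidAlgebra.induction_linear with
  | zero => simp
  | add x y hx hy =>
    rw [map_add, map_add, Finsupp.add_apply, hx, hy, ← map_add]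
    congr 1
    ext χ
    exact (map_add ((Pi.basisFun ℂ (Fin q)).ExteriorAlgebra.coord s) _ _).symm
  | single χ a =>
    rw [AddMonoidAlgebra.coeff_single, Finsupp.mapRange_single, torusFractionHom_single,
      ← Algebra.commutes, ← Algebra.smul_def, map_smul, Finsupp.smul_apply, basis_repr_exteriorBaseChange, smul_eq_mul,
      IsScalarTower.algebraMap_apply ℂ (AddMonoidAlgebra ℂ (Fin p → ℤ)) (TorusFractions p),
      ← map_mul, ← Algebra.commutes, ← Algebra.smul_def, AddMonoidAlgebra.smul_single, smul_eq_mul,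
      mul_one]
    rfl

theorem torusFractionHom_injective : Function.Injective (torusFractionHom p q) := by
  rw [injective_iff_map_eq_zero]
  intro f hf
  ext χ : 2
  refine (Pi.basisFun ℂ (Fin q)).ExteriorAlgebra.ext_elem fun s => ?_
  have h := basis_repr_torusFractionHom f s
  rw [hf, map_zero, Finsupp.zero_apply, eq_comm, map_eq_zero_iff _
    (IsFractionRing.injective (AddMonoidAlgebra ℂ (Fin p → ℤ)) (TorusFractions p))] at h
  have h' := congrArg (fun r : AddMonoidAlgebra ℂ (Fin p → ℤ) => r.coeff χ) h
  rw [AddMonoidAlgebra.coeff_zero, Finsupp.zero_apply, map_zero, Finsupp.zero_apply]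
  exact h'

theorem isUnit_torusFractionHom_laurentHom {r : AddMonoidAlgebra ℂ (Fin p → ℤ)} (hr : r ≠ 0) :
    IsUnit (torusFractionHom p q (laurentHom p q r)) := by
  rw [torusFractionHom_laurentHom]
  have h : algebraMap _ (TorusFractions p) r ≠ 0 := by
    rwa [Ne, map_eq_zero_iff _ (IsFractionRing.injective _ _)]
  exact (IsUnit.mk0 _ h).map (algebraMap (TorusFractions p)
    (ExteriorAlgebra (TorusFractions p) (Fin q → TorusFractions p)))

/-- Up to a nilpotent, `f` is a Laurent polynomial `r`. If `r ≠ 0`, its image is an invertible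
scalar, and a unit plus a commuting nilpotent is a unit. -/
theorem isNilpotent_or_isUnit_torusFractionHom (f : TorusRing p q) :
    IsNilpotent f ∨ IsUnit (torusFractionHom p q f) := by
  obtain ⟨r, hr⟩ := exists_bodyHom_eq f
  rw [← sub_eq_zero, ← map_sub, bodyHom_eq_zero_iff] at hr
  by_cases h : r = 0
  · left
    simpa [h] using hr
  · right
    have hu := isUnit_torusFractionHom_laurentHom (q := q) h
    have := IsNilpotent.isUnit_add_left_of_commute (hr.map (torusFractionHom p q)) hu ?_
    · rwa [← map_add, add_sub_cancel] at this
    · rw [torusFractionHom_laurentHom]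
      exact (Algebra.commutes _ _).symm

theorem isUnit_torusFractionHom_of_not_isNilpotent {f : TorusRing p q} (hf : ¬IsNilpotent f) :
    IsUnit (torusFractionHom p q f) :=
  (isNilpotent_or_isUnit_torusFractionHom f).resolve_left hf

theorem eq_zero_of_mul_eq_zero_of_not_isNilpotent {f g : TorusRing p q} (hf : ¬IsNilpotent f)
    (h : f * g = 0) : g = 0 := by
  have h' := congrArg (torusFractionHom p q) h
  rw [map_mul, map_zero, (isUnit_torusFractionHom_of_not_isNilpotent hf).mul_right_eq_zero] at h'
  exact (map_eq_zero_iff _ torusFractionHom_injective).1 h'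

/-- Every element of the exterior algebra over the field of fractions is a fraction with a Laurent
polynomial as denominator. -/
theorem exists_laurentHom_mul_eq
    (x : ExteriorAlgebra (TorusFractions p) (Fin q → TorusFractions p)) :
    ∃ r : AddMonoidAlgebra ℂ (Fin p → ℤ), r ≠ 0 ∧ ∃ f,
      torusFractionHom p q (laurentHom p q r) * x = torusFractionHom p q f := by
  -- Fractions with Laurent denominators form a subalgebra over the field, which contains the odd
  -- generators with denominator `1`.
  let S : Subalgebra (TorusFractions p)
      (ExteriorAlgebra (TorusFractions p) (Fin q → TorusFractions p)) :=
    { carrier := {x | ∃ r : AddMonoidAlgebra ℂ (Fin p → ℤ), r ≠ 0 ∧ ∃ f,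
        torusFractionHom p q (laurentHom p q r) * x = torusFractionHom p q f}
      mul_mem' := by
        rintro x y ⟨r, hr, f, hf⟩ ⟨s, hs, g, hg⟩
        refine ⟨r * s, mul_ne_zero hr hs, f * g, ?_⟩
        rw [map_mul, map_mul, map_mul, ← hf, ← hg, mul_assoc, mul_assoc, ← mul_assoc _ x,
          ← mul_assoc x, torusFractionHom_laurentHom, torusFractionHom_laurentHom,
          Algebra.commutes _ x]
      add_mem' := by
        rintro x y ⟨r, hr, f, hf⟩ ⟨s, hs, g, hg⟩
        refine ⟨r * s, mul_ne_zero hr hs, laurentHom p q s * f + laurentHom p q r * g, ?_⟩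
        rw [map_add, map_mul, map_mul _ _ f, map_mul _ _ g, ← hf, ← hg, map_mul, ← mul_assoc,
          ← mul_assoc, mul_add, ← map_mul, ← map_mul, ← map_mul, ← map_mul, mul_comm r s]
      algebraMap_mem' := by
        intro l
        obtain ⟨a, b, hb, rfl⟩ := IsFractionRing.div_surjective
          (A := AddMonoidAlgebra ℂ (Fin p → ℤ)) l
        have hb' := nonZeroDivisors.ne_zero hb
        refine ⟨b, hb', laurentHom p q a, ?_⟩
        rw [torusFractionHom_laurentHom, torusFractionHom_laurentHom, ← map_mul, mul_div_cancel₀]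
        rwa [Ne, map_eq_zero_iff _ (IsFractionRing.injective _ _)] }
  have hι : ∀ v, ExteriorAlgebra.ι (TorusFractions p) v ∈ S := by
    intro v
    have hv : v = ∑ i, v i • (Pi.single i 1 : Fin q → TorusFractions p) := by
      ext j; simp [Finset.sum_apply, Pi.single_apply]
    rw [hv, map_sum]
    refine sum_mem fun i _ => ?_
    rw [map_smul]
    refine S.smul_mem ⟨1, one_ne_zero, oddCoord i, ?_⟩ _
    rw [map_one, map_one, one_mul, torusFractionHom_oddCoord]
  change x ∈ S
  induction x using ExteriorAlgebra.induction with
  | algebraMap l => exact S.algebraMap_mem l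
  | ι v => exact hι v
  | mul a b ha hb => exact mul_mem ha hb
  | add a b ha hb => exact add_mem ha hb

theorem torusFractionHom_mem {i : ZMod 2} {f : TorusRing p q} (hf : f ∈ torusGrading p q i) :
    torusFractionHom p q f ∈ CliffordAlgebra.evenOdd
      (0 : QuadraticForm (TorusFractions p) (Fin q → TorusFractions p)) i := by
  have h0 : ∀ l, algebraMap (TorusFractions p) (ExteriorAlgebra (TorusFractions p)
      (Fin q → TorusFractions p)) l ∈ CliffordAlgebra.evenOdd
        (0 : QuadraticForm (TorusFractions p) (Fin q → TorusFractions p)) 0 := fun l =>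
    SetLike.algebraMap_mem_graded _ l
  rw [torus_sum_single f, map_sum]
  refine Submodule.sum_mem _ fun χ _ => ?_
  rw [torusFractionHom_single]
  have h := SetLike.mul_mem_graded (exteriorBaseChange_mem (S := TorusFractions p) (hf χ))
    (h0 (algebraMap (AddMonoidAlgebra ℂ (Fin p → ℤ)) (TorusFractions p)
          (AddMonoidAlgebra.single χ 1)))
  rwa [add_zero] at h

end TorusFractions

end

noncomputable section

theorem single_one_mem {p q : ℕ} (χ : Fin p → ℤ) :
    (AddMonoidAlgebra.single χ 1 : TorusRing p q) ∈ torusGrading p q 0 := by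
  have := laurentHom_mem (q := q) (AddMonoidAlgebra.single χ 1)
  rwa [laurentHom_single, map_one] at this

/-! ### Odd coordinates and odd derivations on monomials -/

section MonomialCalculus

variable {q n : ℕ}

theorem superMonomial_eq_single (k : (Fin q → ℕ) × (Fin n → ℕ)) :
    superMonomial k = AddMonoidAlgebra.single (charXV k.2) (extMonomial ℂ k.1) := rfl

theorem superMonomial_zero_fst (m : Fin n → ℕ) :
    superMonomial ((0, m) : (Fin q → ℕ) × (Fin n → ℕ)) =
      AddMonoidAlgebra.single (charXV m) 1 := by
  rw [superMonomial_eq_single, extMonomial_zero]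

theorem oddCoord_mul_superMonomial {k : (Fin q → ℕ) × (Fin n → ℕ)} {j : Fin q}
    (hk : ∀ i, k.1 i ≤ 1) (hj : k.1 j = 0) :
    oddCoord j * superMonomial k = superMonomial (k.1 + Pi.single j 1, k.2) ∨
      oddCoord j * superMonomial k = -superMonomial (k.1 + Pi.single j 1, k.2) := by
  simp only [superMonomial_eq_single, oddCoord, AddMonoidAlgebra.single_mul_single, zero_add,
    ← AddMonoidAlgebra.single_neg]
  exact (ι_mul_extMonomial ℂ hj hk).imp (congrArg _) (congrArg _)

theorem superMonomial_eq_oddCoord_mul {k : (Fin q → ℕ) × (Fin n → ℕ)} {j : Fin q}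
    (hk : ∀ i, k.1 i ≤ 1) (hj : k.1 j = 1) :
    superMonomial k = oddCoord j * superMonomial (k.1 - Pi.single j 1, k.2) ∨
      superMonomial k = -(oddCoord j * superMonomial (k.1 - Pi.single j 1, k.2)) := by
  have h0 : (k.1 - Pi.single j 1 : Fin q → ℕ) j = 0 := by simp [hj]
  have h1 : ∀ i, (k.1 - Pi.single j 1 : Fin q → ℕ) i ≤ 1 := fun i =>
    (Nat.sub_le _ _).trans (hk i)
  have h2 : (k.1 - Pi.single j 1 + Pi.single j 1 : Fin q → ℕ) = k.1 := by
    ext i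
    rcases eq_or_ne i j with rfl | h
    · simp [hj]
    · simp [h]
  have := oddCoord_mul_superMonomial (k := (k.1 - Pi.single j 1, k.2)) h1 h0
  simp only [h2] at this
  exact this.imp Eq.symm fun h => by rw [h, neg_neg]

theorem oddDeriv_single {p : ℕ} (i : Fin q) (χ : Fin p → ℤ) (a : ExteriorAlgebra ℂ (Fin q → ℂ)) :
    oddDeriv i (AddMonoidAlgebra.single χ a) = AddMonoidAlgebra.single χ
      (CliffordAlgebra.contractLeft (Q := (0 : QuadraticForm ℂ (Fin q → ℂ)))
        (LinearMap.proj i) a) :=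
  AddMonoidAlgebra.coeff_injective (Finsupp.mapRange_single (hf := map_zero _))

theorem oddDeriv_superMonomial_eq_zero {k : (Fin q → ℕ) × (Fin n → ℕ)} {j : Fin q}
    (hk : ∀ i, k.1 i ≤ 1) (hj : k.1 j = 0) : oddDeriv j (superMonomial k) = 0 := by
  rw [superMonomial_eq_single, oddDeriv_single, contractLeft_extMonomial hj hk,
    AddMonoidAlgebra.single_zero]

/-- The canonical relation `∂_i ξ_j + ξ_j ∂_i = δ_ij`. -/
theorem oddDeriv_oddCoord_mul {p : ℕ} (i j : Fin q) (f : TorusRing p q) :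
    oddDeriv i (oddCoord j * f) = (if i = j then f else 0) - oddCoord j * oddDeriv i f := by
  have h1 : oddDeriv i (oddCoord j : TorusRing p q) = if i = j then 1 else 0 := by
    have h : CliffordAlgebra.contractLeft (Q := (0 : QuadraticForm ℂ (Fin q → ℂ)))
        (LinearMap.proj i) (ExteriorAlgebra.ι ℂ (Pi.single j 1)) = if i = j then 1 else 0 := by
      refine (CliffordAlgebra.contractLeft_ι _ _ _).trans ?_
      rw [LinearMap.proj_apply, Pi.single_apply]
      split_ifs <;> simp
    rw [oddCoord, oddDeriv_single, h]
    split_ifs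
    · rfl
    · exact AddMonoidAlgebra.single_zero _
  rw [oddDeriv_mul, h1, (mem_torusGrading_one _).1 (oddCoord_mem j), neg_mul, ← sub_eq_add_neg]
  congr 1
  split_ifs <;> simp

theorem oddDeriv_superMonomial {k : (Fin q → ℕ) × (Fin n → ℕ)} {j : Fin q}
    (hk : ∀ i, k.1 i ≤ 1) (hj : k.1 j = 1) :
    oddDeriv j (superMonomial k) = superMonomial (k.1 - Pi.single j 1, k.2) ∨
      oddDeriv j (superMonomial k) = -superMonomial (k.1 - Pi.single j 1, k.2) := by
  have h0 : (k.1 - Pi.single j 1 : Fin q → ℕ) j = 0 := by simp [hj]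
  have h1 : ∀ i, (k.1 - Pi.single j 1 : Fin q → ℕ) i ≤ 1 := fun i =>
    (Nat.sub_le _ _).trans (hk i)
  have h2 : oddDeriv j (oddCoord j * superMonomial (k.1 - Pi.single j 1, k.2)) =
      superMonomial (k.1 - Pi.single j 1, k.2) := by
    rw [oddDeriv_oddCoord_mul, if_pos rfl,
      oddDeriv_superMonomial_eq_zero (k := (k.1 - Pi.single j 1, k.2)) h1 h0, mul_zero, sub_zero]
  refine (superMonomial_eq_oddCoord_mul hk hj).imp (fun h => ?_) fun h => ?_
  · rw [h, h2]
  · rw [h, map_neg, h2]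

theorem superMonomial_single_mem (i : Fin q) (m : Fin n → ℕ) :
    superMonomial ((Pi.single i 1, m) : (Fin q → ℕ) × (Fin n → ℕ)) ∈
      torusGrading (n + 1) q 1 := by
  have h := oddCoord_mul_superMonomial (k := ((0, m) : (Fin q → ℕ) × (Fin n → ℕ))) (j := i)
    (fun _ => Nat.zero_le 1) rfl
  have h0 : superMonomial ((0, m) : (Fin q → ℕ) × (Fin n → ℕ)) ∈ torusGrading (n + 1) q 0 := by
    rw [superMonomial_zero_fst]
    exact single_one_mem _
  have h1 := odd_mul_even_mem (torusGrading (n + 1) q) (oddCoord_mem i) h0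
  simp only [zero_add] at h
  rcases h with h | h
  · rwa [h] at h1
  · rw [h] at h1
    exact neg_mem_iff.1 h1

end MonomialCalculus

/-! ### Monomial superalgebras as supervarieties with open torus -/

section MonomialAlgebras

variable {q n : ℕ} {K : Finset ((Fin q → ℕ) × (Fin n → ℕ))}

theorem superMonomial_mem {k : (Fin q → ℕ) × (Fin n → ℕ)} (hk : k ∈ K) :
    superMonomial k ∈ monomialAlgebra K :=
  Algebra.subset_adjoin ⟨k, hk, rfl⟩

/-- If a sum has odd exponent `e_i`, then one of any two partial sums has odd exponent `e_i` and the
other has `0`. Descending to the summands produces a generator, so hypothesis (3) holds with `K` in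
place of `⟨K⟩`. -/
theorem exists_single_mem_of_mem_boundedSums {i : Fin q} {m : Fin n → ℕ}
    (h : (Pi.single i 1, m) ∈ boundedSums K) : ∃ m' : Fin n → ℕ, (Pi.single i 1, m') ∈ K := by
  have key : ∀ k ∈ AddSubmonoid.closure (K : Set ((Fin q → ℕ) × (Fin n → ℕ))),
      k.1 = Pi.single i 1 → ∃ m' : Fin n → ℕ, ((Pi.single i 1, m') : _ × _) ∈ K := by
    intro k hk
    induction hk using AddSubmonoid.closure_induction with
    | mem k hk =>
      intro h
      exact ⟨k.2, h ▸ hk⟩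
    | zero =>
      intro h
      have := congrFun h i
      simp at this
    | add x y _ _ hx hy =>
      intro h
      have hi := congrFun h i
      simp only [Prod.fst_add, Pi.add_apply, Pi.single_eq_same] at hi
      have hne : ∀ j, j ≠ i → x.1 j = 0 ∧ y.1 j = 0 := by
        intro j hj
        have := congrFun h j
        simp only [Prod.fst_add, Pi.add_apply, Pi.single_eq_of_ne hj] at this
        omega
      rcases Nat.eq_zero_or_pos (x.1 i) with h0 | h0
      · refine hy (funext fun j => ?_)
        rcases eq_or_ne j i with rfl | hj
        · rw [Pi.single_eq_same]; omega
        · rw [Pi.single_eq_of_ne hj, (hne j hj).2]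
      · refine hx (funext fun j => ?_)
        rcases eq_or_ne j i with rfl | hj
        · rw [Pi.single_eq_same]; omega
        · rw [Pi.single_eq_of_ne hj, (hne j hj).1]
  exact key _ h.1 rfl

variable (K) in
/-- The sum of the characters of the even generators of a monomial superalgebra. -/
def evenCharSum : Fin (n + 1) → ℤ := ∑ k ∈ K.filter (fun k => k.1 = 0), charXV k.2

theorem single_sum_mem (F : Finset ((Fin q → ℕ) × (Fin n → ℕ)))
    (hF : ∀ k ∈ F, k ∈ K ∧ k.1 = 0) :
    (AddMonoidAlgebra.single (∑ k ∈ F, charXV k.2) 1 : TorusRing (n + 1) q) ∈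
      monomialAlgebra K := by
  induction F using Finset.induction_on with
  | empty => exact one_mem _
  | insert k F hk ih =>
    have h := mul_mem (superMonomial_mem (hF k (Finset.mem_insert_self _ _)).1)
      (ih fun k hk => hF k (Finset.mem_insert_of_mem hk))
    have hk0 : k = (0, k.2) := Prod.ext (hF k (Finset.mem_insert_self _ _)).2 rfl
    rw [hk0, superMonomial_zero_fst, AddMonoidAlgebra.single_mul_single, one_mul] at h
    rwa [Finset.sum_insert hk]

variable (K) in
/-- The product of the even generators of a monomial superalgebra. -/
def evenProduct : TorusRing (n + 1) q := AddMonoidAlgebra.single (evenCharSum K) 1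

theorem evenProduct_mem : evenProduct K ∈ monomialAlgebra K :=
  single_sum_mem _ fun k hk => by simpa using hk

theorem evenProduct_eq_laurentHom :
    evenProduct K = laurentHom (n + 1) q (AddMonoidAlgebra.single (evenCharSum K) 1) := by
  rw [laurentHom_single, map_one]
  rfl

theorem evenProduct_even : evenProduct K ∈ torusGrading (n + 1) q 0 := by
  rw [evenProduct_eq_laurentHom]
  exact laurentHom_mem _

/-- Dividing the product of the even generators by one of them leaves the product of the others. -/
theorem single_sub_mem {m : Fin n → ℕ} (hm : ((0, m) : _ × _) ∈ K) :
    (AddMonoidAlgebra.single (evenCharSum K - charXV m) 1 : TorusRing (n + 1) q) ∈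
      monomialAlgebra K := by
  have h := single_sum_mem (K := K) ((K.filter fun k => k.1 = 0).erase (0, m)) fun k hk => by
    simpa using (Finset.mem_erase.1 hk).2
  rwa [Finset.sum_erase_eq_sub (by simpa using hm)] at h

theorem evenProduct_comm (f : TorusRing (n + 1) q) : Commute (evenProduct K) f :=
  SuperRing.even_comm evenProduct_even f

theorem isUnit_evenProduct : IsUnit (evenProduct K) := by
  refine isUnit_iff_exists.2 ⟨AddMonoidAlgebra.single (-evenCharSum K) 1, ?_, ?_⟩ <;>
  · rw [evenProduct, AddMonoidAlgebra.single_mul_single]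
    simp [AddMonoidAlgebra.one_def]

section

variable (hK_even : Algebra.adjoin ℂ
  {f : AddMonoidAlgebra ℂ (Fin (n + 1) → ℤ) | ∃ m : Fin n → ℕ, ((0, m) : _ × _) ∈ K ∧
    (f = AddMonoidAlgebra.single (charXV m) 1 ∨ f = AddMonoidAlgebra.single (-charXV m) 1)} = ⊤)
  (hK_closed : ∀ k ∈ K, ∀ i, k.1 i = 1 → (k.1 - Pi.single i 1, k.2) ∈ K)

include hK_closed in
theorem zero_fst_mem {i : Fin q} {m : Fin n → ℕ} (h : (Pi.single i 1, m) ∈ K) :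
    ((0, m) : _ × _) ∈ K := by
  simpa using hK_closed _ h i (Pi.single_eq_same _ _)

include hK_even hK_closed in
/-- Inverting the product of the even generators of a monomial superalgebra gives `ℂ[T]`. -/
theorem exists_evenProduct_pow_mul_mem
    (hK_odd : ∀ i : Fin q, ∃ m : Fin n → ℕ, (Pi.single i 1, m) ∈ K) (f : TorusRing (n + 1) q) :
    ∃ N : ℕ, evenProduct K ^ N * f ∈ monomialAlgebra K := by
  have hpow : ∀ N, evenProduct K ^ N ∈ monomialAlgebra K := fun N => pow_mem evenProduct_mem N
  -- Since `evenProduct K` is central, the elements that some power of it carries into the algebra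
  -- form a subalgebra. It remains to treat the generators of `ℂ[T]`.
  let S : Subalgebra ℂ (TorusRing (n + 1) q) :=
    { carrier := {f | ∃ N : ℕ, evenProduct K ^ N * f ∈ monomialAlgebra K}
      mul_mem' := by
        rintro f g ⟨N, hN⟩ ⟨M, hM⟩
        refine ⟨N + M, ?_⟩
        have := mul_mem hN hM
        rwa [mul_assoc, ← mul_assoc f, ← ((evenProduct_comm f).pow_left M).eq, mul_assoc,
          ← mul_assoc, ← pow_add] at this
      add_mem' := by
        rintro f g ⟨N, hN⟩ ⟨M, hM⟩
        refine ⟨N + M, ?_⟩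
        have := add_mem (mul_mem (hpow M) hN) (mul_mem (hpow N) hM)
        rwa [← mul_assoc, ← mul_assoc, ← pow_add, ← pow_add, add_comm M N, ← mul_add] at this
      algebraMap_mem' := fun z => ⟨0, by
        rw [pow_zero, one_mul]
        exact Subalgebra.algebraMap_mem _ z⟩ }
  have hle : monomialAlgebra K ≤ S := fun f hf => ⟨0, by rwa [pow_zero, one_mul]⟩
  have hneg : ∀ m : Fin n → ℕ, ((0, m) : _ × _) ∈ K →
      (AddMonoidAlgebra.single (-charXV m) 1 : TorusRing (n + 1) q) ∈ S := by
    intro m hm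
    refine ⟨1, ?_⟩
    rw [pow_one, evenProduct, AddMonoidAlgebra.single_mul_single, ← sub_eq_add_neg, one_mul]
    exact single_sub_mem hm
  have hlaurent : ∀ r, laurentHom (n + 1) q r ∈ S := by
    have : (⊤ : Subalgebra ℂ (AddMonoidAlgebra ℂ (Fin (n + 1) → ℤ))) ≤
        S.comap (laurentHom (n + 1) q) := by
      rw [← hK_even]
      refine Algebra.adjoin_le ?_
      rintro _ ⟨m, hm, rfl | rfl⟩
      · rw [SetLike.mem_coe, Subalgebra.mem_comap, laurentHom_single, map_one,
          ← superMonomial_zero_fst]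
        exact hle (superMonomial_mem hm)
      · rw [SetLike.mem_coe, Subalgebra.mem_comap, laurentHom_single, map_one]
        exact hneg m hm
    exact fun r => this trivial
  have hodd : ∀ i, oddCoord i ∈ S := by
    intro i
    obtain ⟨m, hm⟩ := hK_odd i
    have hm0 := zero_fst_mem hK_closed hm
    have h := oddCoord_mul_superMonomial (k := ((0, m) : (Fin q → ℕ) × (Fin n → ℕ))) (j := i)
      (fun _ => Nat.zero_le 1) rfl
    simp only [zero_add] at h
    -- Here `ξ_i` is recovered as `(ξ_i x^m v)(x^m v)⁻¹`.
    have h' : oddCoord i * superMonomial ((0, m) : (Fin q → ℕ) × (Fin n → ℕ)) ∈ S := by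
      rcases h with h | h <;> rw [h]
      · exact hle (superMonomial_mem hm)
      · exact neg_mem (hle (superMonomial_mem hm))
    have := mul_mem h' (hneg m hm0)
    rw [superMonomial_zero_fst, mul_assoc, AddMonoidAlgebra.single_mul_single, add_neg_cancel,
      one_mul] at this
    rwa [← mul_one (oddCoord i)]
  have hS := torusRing_subalgebra_eq_top S hlaurent hodd
  exact (hS ▸ Algebra.mem_top : f ∈ S)

theorem isNilpotent_coe_iff {a : monomialAlgebra K} :
    IsNilpotent (a : TorusRing (n + 1) q) ↔ IsNilpotent a :=
  IsNilpotent.map_iff (f := (monomialAlgebra K).val) Subtype.coe_injective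

variable (hK : ∀ k ∈ K, ∀ i, k.1 i ≤ 1)

include hK_closed hK in
-- Choose `i` with `I_i = 1` and a generator `ξ_i x^m v`. The factor `ξ_i` need not lie in the
-- algebra, but `s ξ_i` is, up to sign, this odd generator times `s / (x^m v)`. What remains of the
-- monomial is a generator by hypothesis (1).
theorem evenProduct_mul_superMonomial
    (hK_odd : ∀ i : Fin q, ∃ m : Fin n → ℕ, (Pi.single i 1, m) ∈ K)
    {k : (Fin q → ℕ) × (Fin n → ℕ)} (hk : k ∈ K) (hk0 : k.1 ≠ 0) :
    ∃ x : monomialAlgebra K, x ∈ restrictGrading (monomialAlgebra K) 1 ∧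
      ∃ y : monomialAlgebra K, evenProduct K * superMonomial k = x * y := by
  obtain ⟨i, hi⟩ := Function.ne_iff.1 hk0
  have hi1 : k.1 i = 1 := le_antisymm (hK k hk i) (Nat.one_le_iff_ne_zero.2 hi)
  obtain ⟨m, hm⟩ := hK_odd i
  have hm0 := zero_fst_mem hK_closed hm
  have h := oddCoord_mul_superMonomial (k := ((0, m) : (Fin q → ℕ) × (Fin n → ℕ))) (j := i)
    (fun _ => Nat.zero_le 1) rfl
  simp only [zero_add] at h
  have hsplit : evenProduct K = AddMonoidAlgebra.single (evenCharSum K - charXV m) 1 *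
      superMonomial ((0, m) : (Fin q → ℕ) × (Fin n → ℕ)) := by
    rw [superMonomial_zero_fst, AddMonoidAlgebra.single_mul_single, one_mul, sub_add_cancel]
    rfl
  have hx : evenProduct K * oddCoord i = superMonomial (Pi.single i 1, m) *
        AddMonoidAlgebra.single (evenCharSum K - charXV m) 1 ∨
      evenProduct K * oddCoord i = -(superMonomial (Pi.single i 1, m) *
        AddMonoidAlgebra.single (evenCharSum K - charXV m) 1) := by
    have hc : ∀ f : TorusRing (n + 1) q,
        AddMonoidAlgebra.single (evenCharSum K - charXV m) 1 * f =
          f * AddMonoidAlgebra.single (evenCharSum K - charXV m) 1 := by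
      intro f
      exact SuperRing.even_comm (𝒜 := torusGrading (n + 1) q) (single_one_mem _) f
    rw [(evenProduct_comm _).eq, hsplit, hc, ← mul_assoc]
    rcases h with h | h <;> rw [h]
    · exact Or.inl rfl
    · exact Or.inr (neg_mul _ _)
  let x : monomialAlgebra K := ⟨_, superMonomial_mem hm⟩
  let y : monomialAlgebra K := ⟨_, single_sub_mem hm0⟩ *
    ⟨_, superMonomial_mem (hK_closed k hk i hi1)⟩
  refine ⟨x, superMonomial_single_mem i m, ?_⟩
  have hpm : evenProduct K * superMonomial k = x * y ∨
      evenProduct K * superMonomial k = -(x * y) := by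
    change _ = superMonomial (Pi.single i 1, m) * (AddMonoidAlgebra.single _ 1 * superMonomial _) ∨
      _ = -(superMonomial (Pi.single i 1, m) * (AddMonoidAlgebra.single _ 1 * superMonomial _))
    rcases superMonomial_eq_oddCoord_mul (hK k hk) hi1 with h1 | h1 <;> rcases hx with h2 | h2 <;>
      rw [h1] <;> simp only [mul_neg, ← mul_assoc, h2, neg_mul, neg_neg] <;> simp
  rcases hpm with h | h
  · exact ⟨y, h⟩
  · exact ⟨-y, by rw [h]; exact (mul_neg _ _).symm⟩

include hK_closed hK in
-- After multiplication by `s`, every element agrees with a Laurent polynomial of the algebra modulo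
-- the odd ideal. This is clear for generators by `evenProduct_mul_superMonomial`, and a single
-- factor `s` persists under products.
theorem monomialAlgebra_exists_mul_sub_mem_span
    (hK_odd : ∀ i : Fin q, ∃ m : Fin n → ℕ, (Pi.single i 1, m) ∈ K) (a : monomialAlgebra K) :
    ∃ (r : AddMonoidAlgebra ℂ (Fin (n + 1) → ℤ))
      (hr : laurentHom (n + 1) q r ∈ monomialAlgebra K),
      (⟨_, evenProduct_mem⟩ : monomialAlgebra K) * (a - ⟨_, hr⟩) ∈
        TwoSidedIdeal.span (restrictGrading (monomialAlgebra K) 1 : Set (monomialAlgebra K)) := by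
  set s : monomialAlgebra K := ⟨_, evenProduct_mem⟩
  set J := TwoSidedIdeal.span
    (restrictGrading (monomialAlgebra K) 1 : Set (monomialAlgebra K))
  obtain ⟨a, ha⟩ := a
  induction ha using Algebra.adjoin_induction with
  | mem a ha =>
    obtain ⟨k, hk, rfl⟩ := ha
    by_cases hk0 : k.1 = 0
    · have e : superMonomial k =
          laurentHom (n + 1) q (AddMonoidAlgebra.single (charXV k.2) 1) := by
        rw [laurentHom_single, map_one, ← superMonomial_zero_fst, ← hk0]
      refine ⟨AddMonoidAlgebra.single (charXV k.2) 1, e ▸ superMonomial_mem hk, ?_⟩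
      have : (⟨superMonomial k, superMonomial_mem hk⟩ : monomialAlgebra K) -
          ⟨laurentHom (n + 1) q (AddMonoidAlgebra.single (charXV k.2) 1),
            e ▸ superMonomial_mem hk⟩ = 0 := Subtype.ext (sub_eq_zero.2 e)
      rw [this, mul_zero]
      exact zero_mem J
    · obtain ⟨x, hx, y, h⟩ := evenProduct_mul_superMonomial hK_closed hK hK_odd hk hk0
      refine ⟨0, (map_zero (laurentHom (n + 1) q)).symm ▸ zero_mem _, ?_⟩
      have : s * (⟨superMonomial k, superMonomial_mem hk⟩ - ⟨laurentHom (n + 1) q 0,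
          (map_zero (laurentHom (n + 1) q)).symm ▸ zero_mem _⟩) = x * y := by
        refine Subtype.ext ?_
        change evenProduct K * (superMonomial k - laurentHom (n + 1) q 0) = x * y
        rw [map_zero, sub_zero, h]
      rw [this]
      exact J.mul_mem_right _ _ (TwoSidedIdeal.subset_span hx)
  | algebraMap z =>
    have e : laurentHom (n + 1) q (algebraMap ℂ _ z) = algebraMap ℂ _ z := AlgHom.commutes _ _
    refine ⟨algebraMap ℂ _ z, e ▸ Subalgebra.algebraMap_mem _ z, ?_⟩
    have : (⟨algebraMap ℂ _ z, Subalgebra.algebraMap_mem _ z⟩ : monomialAlgebra K) -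
        ⟨laurentHom (n + 1) q (algebraMap ℂ _ z), e ▸ Subalgebra.algebraMap_mem _ z⟩ = 0 :=
      Subtype.ext (sub_eq_zero.2 e.symm)
    rw [this, mul_zero]
    exact zero_mem J
  | add f g hf hg ihf ihg =>
    obtain ⟨r, hr, h⟩ := ihf
    obtain ⟨t, ht, h'⟩ := ihg
    refine ⟨r + t, (map_add (laurentHom (n + 1) q) r t).symm ▸ add_mem hr ht, ?_⟩
    have := J.add_mem h h'
    rw [← mul_add, sub_add_sub_comm] at this
    convert this using 3
    · rfl
    · exact Subtype.ext (map_add (laurentHom (n + 1) q) r t)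
  | mul f g hf hg ihf ihg =>
    obtain ⟨r, hr, h⟩ := ihf
    obtain ⟨t, ht, h'⟩ := ihg
    refine ⟨r * t, (map_mul (laurentHom (n + 1) q) r t).symm ▸ mul_mem hr ht, ?_⟩
    -- The identity used is `s(fg - rt) = s(f - r) g + r s(g - t)`, with `s` central.
    have := J.add_mem (J.mul_mem_right _ ⟨g, hg⟩ h)
      (J.mul_mem_left ⟨laurentHom (n + 1) q r, hr⟩ _ h')
    have hs : (⟨laurentHom (n + 1) q r, hr⟩ : monomialAlgebra K) * s =
        s * ⟨laurentHom (n + 1) q r, hr⟩ :=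
      Subtype.ext (evenProduct_comm _).eq.symm
    rw [← mul_assoc, hs, mul_assoc, mul_assoc, ← mul_add, sub_mul, mul_sub,
      sub_add_sub_cancel] at this
    convert this using 3
    · rfl
    · exact Subtype.ext (map_mul (laurentHom (n + 1) q) r t)

include hK_closed hK in
theorem monomialAlgebra_isIntegralSuperRing
    (hK_odd : ∀ i : Fin q, ∃ m : Fin n → ℕ, (Pi.single i 1, m) ∈ K) :
    IsIntegralSuperRing (restrictGrading (monomialAlgebra K)) where
  nontrivial := inferInstance
  nilpotent_or_regular a _ := by
    rw [or_iff_not_imp_left, ← isNilpotent_coe_iff]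
    intro ha b hab
    exact Subtype.ext (eq_zero_of_mul_eq_zero_of_not_isNilpotent ha (congrArg Subtype.val hab))
  exists_mul_mem_span a _ hn := by
    -- The regular factor is `u = s`. For nilpotent `a`, with `s(a - r)` in the odd ideal, `s r` is
    -- nilpotent too. As `s r` would become a unit for `r ≠ 0`, this gives `r = 0`.
    refine ⟨⟨_, evenProduct_mem⟩, evenProduct_even, fun b hb => Subtype.ext ?_, ?_⟩
    · exact isUnit_evenProduct.mul_right_eq_zero.1 (congrArg Subtype.val hb)
    · obtain ⟨r, hr, h⟩ := monomialAlgebra_exists_mul_sub_mem_span hK_closed hK hK_odd a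
      suffices hr0 : r = 0 by
        have : (⟨laurentHom (n + 1) q r, hr⟩ : monomialAlgebra K) = 0 := Subtype.ext (by
          change laurentHom (n + 1) q r = 0
          rw [hr0, map_zero])
        rwa [this, sub_zero] at h
      by_contra hr0
      have h1 := isNilpotent_of_mem_span_odd _ h
      rw [← bodyHom_eq_zero_iff (restrictGrading (monomialAlgebra K)), map_mul, map_sub,
        (bodyHom_eq_zero_iff _).2 hn, zero_sub, mul_neg, neg_eq_zero, ← map_mul,
        bodyHom_eq_zero_iff, ← isNilpotent_coe_iff] at h1
      have h2 : IsUnit (torusFractionHom (n + 1) q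
          (evenProduct K * laurentHom (n + 1) q r)) := by
        rw [map_mul]
        exact (isUnit_evenProduct.map _).mul (isUnit_torusFractionHom_laurentHom hr0)
      exact (h1.map (torusFractionHom (n + 1) q)).not_isUnit h2

include hK_even hK_closed hK in
theorem monomialAlgebra_isAffineSupervariety
    (hK_odd : ∀ i : Fin q, ∃ m : Fin n → ℕ, (Pi.single i 1, m) ∈ K) :
    IsAffineSupervariety (restrictGrading (monomialAlgebra K)) where
  algebraMap_mem z := by
    have : laurentHom (n + 1) q (algebraMap ℂ _ z) = algebraMap ℂ _ z := AlgHom.commutes _ _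
    change algebraMap ℂ (TorusRing (n + 1) q) z ∈ torusGrading (n + 1) q 0
    rw [← this]
    exact laurentHom_mem _
  finiteType := by
    classical
    have : monomialAlgebra K = Algebra.adjoin ℂ
        ((K.image superMonomial : Finset (TorusRing (n + 1) q)) : Set (TorusRing (n + 1) q)) := by
      rw [Finset.coe_image]
      rfl
    rw [this]
    exact (Subalgebra.fg_iff_finiteType _).1 (Subalgebra.fg_adjoin_finset _)
  separated a := ⟨a ⊗ₜ 1, by simp⟩
  gfr := by
    have hint := monomialAlgebra_isIntegralSuperRing hK_closed hK hK_odd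
    refine ⟨{hint.genericPoint}, hint.closure_genericPoint, ?_⟩
    rintro _ rfl
    have hunit : ∀ s : hint.genericPoint.asIdeal.primeCompl,
        IsUnit (torusFractionHom (n + 1) q ((s : evenPart (restrictGrading (monomialAlgebra K))) : monomialAlgebra K)) := by
      intro s
      refine isUnit_torusFractionHom_of_not_isNilpotent fun h => s.2 ?_
      rw [isNilpotent_coe_iff, isNilpotent_evenPart_iff] at h
      exact h
    -- The generic stalk is the exterior algebra over the field of rational functions on the torus.
    refine isFermionicallyRegular_localization _
      ((torusFractionHom (n + 1) q).comp (monomialAlgebra K).val.toRingHom)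
      (torusFractionHom_injective.comp Subtype.coe_injective)
      (fun i a ha => torusFractionHom_mem ha) hunit fun x => ?_
    obtain ⟨r, hr, f, hf⟩ := exists_laurentHom_mul_eq x
    obtain ⟨N, hN⟩ := exists_evenProduct_pow_mul_mem hK_even hK_closed hK_odd
      (laurentHom (n + 1) q r)
    obtain ⟨M, hM⟩ := exists_evenProduct_pow_mul_mem hK_even hK_closed hK_odd f
    have hpow : ∀ N, evenProduct K ^ N ∈ monomialAlgebra K := fun N => pow_mem evenProduct_mem N
    -- From `r x = f` in `ℂ[T]`, multiplication by `s^(M+N)` moves both the denominator `r` and the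
    -- numerator `f` into the algebra.
    have hd : evenProduct K ^ M * (evenProduct K ^ N * laurentHom (n + 1) q r) ∈
        torusGrading (n + 1) q 0 :=
      even_mul_even_mem _ (even_pow_mem _ evenProduct_even M)
        (even_mul_even_mem _ (even_pow_mem _ evenProduct_even N) (laurentHom_mem r))
    let d : evenPart (restrictGrading (monomialAlgebra K)) := ⟨⟨_, mul_mem (hpow M) hN⟩, hd⟩
    have hdu : IsUnit (torusFractionHom (n + 1) q (d : monomialAlgebra K)) := by
      change IsUnit (torusFractionHom (n + 1) q
        (evenProduct K ^ M * (evenProduct K ^ N * laurentHom (n + 1) q r)))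
      rw [map_mul, map_mul]
      exact ((isUnit_evenProduct.pow M).map _).mul
        (((isUnit_evenProduct.pow N).map _).mul (isUnit_torusFractionHom_laurentHom hr))
    refine ⟨⟨d, fun hmem => ?_⟩, ⟨_, mul_mem (hpow N) hM⟩, ?_⟩
    · have h := mem_nilradical.1 hmem
      rw [← isNilpotent_evenPart_iff, ← isNilpotent_coe_iff] at h
      exact (h.map (torusFractionHom (n + 1) q)).not_isUnit hdu
    · change torusFractionHom (n + 1) q
        (evenProduct K ^ M * (evenProduct K ^ N * laurentHom (n + 1) q r)) * x =
        torusFractionHom (n + 1) q (evenProduct K ^ N * (evenProduct K ^ M * f))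
      rw [map_mul, map_mul, mul_assoc, mul_assoc, hf, ← map_mul, ← map_mul, ← mul_assoc,
        ← mul_assoc, ← pow_add, ← pow_add, add_comm M N]
  reduced := (monomialAlgebra_isIntegralSuperRing hK_closed hK hK_odd).isReducedSuperSpec

include hK_even hK_closed in
theorem monomialAlgebra_factors (T : Supertorus (n + 1) q)
    (hK_odd : ∀ i : Fin q, ∃ m : Fin n → ℕ, (Pi.single i 1, m) ∈ K) :
    ∃ 𝔥 : Submodule ℂ (Fin q → ℂ), T.IsOddSubgroup 𝔥 ∧
      ∃ ψ : SuperHom (restrictGrading (monomialAlgebra K))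
          (restrictGrading (T.homogeneousRing 𝔥)),
        (∀ a, (ψ.toRingHom a : TorusRing (n + 1) q) = (monomialAlgebra K).val a) ∧
          ψ.IsOpenImmersion := by
  -- The subgroup `H` is trivial, so `ℂ[T/H]` is all of `ℂ[T]`.
  have hbot : ∀ f, f ∈ T.homogeneousRing ⊥ := by
    intro f v hv
    rw [(Submodule.mem_bot ℂ).1 hv]
    simp [Supertorus.rightOddVec]
  refine ⟨⊥, ?_, ?_⟩
  · intro v hv w hw k
    rw [(Submodule.mem_bot ℂ).1 hv]
    simp
  let ψ : SuperHom (restrictGrading (monomialAlgebra K))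
      (restrictGrading (T.homogeneousRing ⊥)) :=
    { toRingHom := (Subalgebra.inclusion
        (fun f _ => hbot f : monomialAlgebra K ≤ T.homogeneousRing ⊥)).toRingHom
      map_mem := fun _ _ ha => ha }
  refine ⟨ψ, fun _ => rfl, ψ.isOpenImmersion_of_away (Subalgebra.inclusion_injective _)
    ⟨⟨_, evenProduct_mem⟩, evenProduct_even⟩ ?_ fun c => ?_⟩
  · refine IsUnit.of_mul_eq_one (⟨⟨AddMonoidAlgebra.single (-evenCharSum K) 1, hbot _⟩, ?_⟩ :
      evenPart (restrictGrading (T.homogeneousRing ⊥))) (Subtype.ext (Subtype.ext ?_))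
    · change AddMonoidAlgebra.single (-evenCharSum K) 1 ∈ torusGrading (n + 1) q 0
      exact single_one_mem _
    · change evenProduct K * AddMonoidAlgebra.single (-evenCharSum K) 1 = 1
      rw [evenProduct, AddMonoidAlgebra.single_mul_single, add_neg_cancel, one_mul]
      rfl
  · obtain ⟨N, hN⟩ := exists_evenProduct_pow_mul_mem hK_even hK_closed hK_odd
      (c : TorusRing (n + 1) q)
    exact ⟨N, ⟨_, hN⟩, Subtype.ext rfl⟩

end

end MonomialAlgebras

end

noncomputable section

/-! ### The left translation operators on `ℂ[T]` -/

section TorusOperators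

variable {p q : ℕ}

theorem weightScale_oddCoord_mul (w : (Fin p → ℤ) → ℂ) (j : Fin q) (f : TorusRing p q) :
    weightScale w (oddCoord j * f) = oddCoord j * weightScale w f := by
  induction f using AddMonoidAlgebra.induction_linear with
  | zero => simp
  | add x y hx hy => simp only [mul_add, map_add, hx, hy]
  | single χ a =>
    simp only [oddCoord, AddMonoidAlgebra.single_mul_single, weightScale_single, zero_add,
      mul_smul_comm]

theorem weightScale_comm (w w' : (Fin p → ℤ) → ℂ) (f : TorusRing p q) :
    weightScale w (weightScale w' f) = weightScale w' (weightScale w f) := by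
  ext χ : 2
  exact smul_comm (w χ) (w' χ) (f.coeff χ)

theorem oddDeriv_weightScale (i : Fin q) (w : (Fin p → ℤ) → ℂ) (f : TorusRing p q) :
    oddDeriv i (weightScale w f) = weightScale w (oddDeriv i f) := by
  ext χ : 2
  exact map_smul (CliffordAlgebra.contractLeft (Q := (0 : QuadraticForm ℂ (Fin q → ℂ)))
      (LinearMap.proj i)) (w χ) (f.coeff χ)

theorem weightScale_mul (w : (Fin p → ℤ) → ℂ) (hw : ∀ χ ψ, w (χ + ψ) = w χ * w ψ)
    (f g : TorusRing p q) : weightScale w (f * g) = weightScale w f * weightScale w g := by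
  induction f using AddMonoidAlgebra.induction_linear with
  | zero => simp
  | add x y hx hy => simp only [add_mul, map_add, hx, hy]
  | single χ a =>
    induction g using AddMonoidAlgebra.induction_linear with
    | zero => simp
    | add x y hx hy => simp only [mul_add, map_add, hx, hy]
    | single ψ b =>
      simp only [AddMonoidAlgebra.single_mul_single, weightScale_single, hw, smul_mul_smul_comm]

theorem oddDeriv_comm (i j : Fin q) (f : TorusRing p q) :
    oddDeriv i (oddDeriv j f) = -oddDeriv j (oddDeriv i f) := by
  ext χ : 2
  exact CliffordAlgebra.contractLeft_comm (Q := (0 : QuadraticForm ℂ (Fin q → ℂ)))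
    (d := LinearMap.proj i) (d' := LinearMap.proj j) (f.coeff χ)

theorem evenDeriv_eq_sum (x : Fin p → ℂ) (f : TorusRing p q) :
    evenDeriv x f = ∑ k, x k • evenDeriv (Pi.single k 1) f := by
  induction f using AddMonoidAlgebra.induction_linear with
  | zero => simp
  | add f g hf hg => simp only [map_add, smul_add, Finset.sum_add_distrib, hf, hg]
  | single χ a =>
    have h : ∀ k, (∑ l, (χ l : ℂ) * (Pi.single k 1 : Fin p → ℂ) l) = χ k := fun k => by
      simp [Pi.single_apply]
    simp only [evenDeriv, weightScale_single, h, AddMonoidAlgebra.smul_single, smul_smul]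
    rw [Finset.sum_smul]
    refine (map_sum (AddMonoidAlgebra.singleAddHom χ) _ _).trans ?_
    simp only [mul_comm]
    rfl

theorem Supertorus.leftOdd_apply (T : Supertorus p q) (i : Fin q) (f : TorusRing p q) :
    T.leftOdd i f = (1 / 2 : ℂ) • ∑ j, oddCoord j * evenDeriv (T.bracket i j) f -
      oddDeriv i f := by
  simp [Supertorus.leftOdd]

/-- The supertorus with the opposite bracket. -/
def Supertorus.opposite (T : Supertorus p q) : Supertorus p q where
  bracket i j k := -T.bracket i j k
  symm i j := by rw [T.symm]

/-- Passing to the opposite bracket transfers the Leibniz rule and the parity statement from right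
to left translation. -/
theorem Supertorus.leftOdd_eq_neg_rightOdd (T : Supertorus p q) (i : Fin q)
    (f : TorusRing p q) : T.leftOdd i f = -T.opposite.rightOdd i f := by
  have h : ∀ j, evenDeriv (T.opposite.bracket i j) f = -evenDeriv (T.bracket i j) f := by
    intro j
    rw [evenDeriv_eq_sum, evenDeriv_eq_sum (T.bracket i j), ← Finset.sum_neg_distrib]
    exact Finset.sum_congr rfl fun k _ => neg_smul _ _
  simp only [Supertorus.leftOdd, Supertorus.rightOdd, LinearMap.sub_apply, LinearMap.add_apply,
    LinearMap.smul_apply, LinearMap.sum_apply, LinearMap.comp_apply, LinearMap.mulLeft_apply, h,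
    mul_neg, Finset.sum_neg_distrib, smul_neg]
  abel

theorem Supertorus.leftOdd_mul (T : Supertorus p q) (i : Fin q) (f g : TorusRing p q) :
    T.leftOdd i (f * g) = T.leftOdd i f * g + parityInvolution p q f * T.leftOdd i g := by
  simp only [leftOdd_eq_neg_rightOdd, rightOdd_mul, neg_mul, mul_neg, neg_add]

theorem Supertorus.leftOdd_mem (T : Supertorus p q) (i : Fin q) {j : ZMod 2} {f : TorusRing p q}
    (hf : f ∈ torusGrading p q j) : T.leftOdd i f ∈ torusGrading p q (j + 1) := by
  have h : T.leftOdd i (parityInvolution p q f) = -parityInvolution p q (T.leftOdd i f) := by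
    simp only [leftOdd_eq_neg_rightOdd, rightOdd_parityInvolution, map_neg]
  fin_cases j
  · rw [(mem_torusGrading_zero _).1 hf] at h
    exact (mem_torusGrading_one _).2 (neg_eq_iff_eq_neg.2 h).symm
  · rw [(mem_torusGrading_one _).1 hf, map_neg, neg_inj] at h
    exact (mem_torusGrading_zero _).2 h.symm

theorem weightScale_leftOdd (T : Supertorus p q) (i : Fin q) (w : (Fin p → ℤ) → ℂ)
    (f : TorusRing p q) : weightScale w (T.leftOdd i f) = T.leftOdd i (weightScale w f) := by
  simp only [T.leftOdd_apply, map_sub, map_smul, map_sum, weightScale_oddCoord_mul,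
    oddDeriv_weightScale, evenDeriv, weightScale_comm w]

/-- Expansion by `∂_i ξ_b = δ_ib - ξ_b ∂_i`. The Kronecker delta produces the term with `[θ_i,
θ_j]`, the only one that survives symmetrization in `i` and `j`. -/
theorem Supertorus.leftOdd_leftOdd (T : Supertorus p q) (i j : Fin q) (f : TorusRing p q) :
    T.leftOdd i (T.leftOdd j f) =
      (1 / 4 : ℂ) • ∑ a, ∑ b, oddCoord a * (oddCoord b *
        evenDeriv (T.bracket i a) (evenDeriv (T.bracket j b) f)) -
      (1 / 2 : ℂ) • ∑ a, oddCoord a * evenDeriv (T.bracket i a) (oddDeriv j f) -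
      (1 / 2 : ℂ) • evenDeriv (T.bracket i j) f +
      (1 / 2 : ℂ) • ∑ b, oddCoord b * evenDeriv (T.bracket j b) (oddDeriv i f) +
      oddDeriv i (oddDeriv j f) := by
  have h1 : ∀ x g b, evenDeriv x (oddCoord b * g : TorusRing p q) = oddCoord b * evenDeriv x g :=
    fun x g b => weightScale_oddCoord_mul _ _ _
  have h2 : ∀ x (g : TorusRing p q), oddDeriv i (evenDeriv x g) = evenDeriv x (oddDeriv i g) :=
    fun x g => oddDeriv_weightScale _ _ _
  rw [T.leftOdd_apply i, T.leftOdd_apply j]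
  simp only [map_sub, map_smul, map_sum, h1, oddDeriv_oddCoord_mul, h2, mul_sub, mul_smul_comm,
    Finset.mul_sum, Finset.sum_sub_distrib, ← Finset.smul_sum, smul_sub, smul_smul,
    Finset.sum_ite_eq, Finset.mem_univ, if_true, T.symm j i]
  norm_num
  abel

/-- The quadratic terms cancel because the `ξ_a` anticommute, the second derivatives because the
`∂_i` do, and the mixed terms cancel in pairs. The sign is that of left translation, where `𝔱₀` acts
by `-t∂/∂t`. -/
theorem Supertorus.leftOdd_bracket (T : Supertorus p q) (i j : Fin q) (f : TorusRing p q) :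
    T.leftOdd i (T.leftOdd j f) + T.leftOdd j (T.leftOdd i f) =
      -evenDeriv (T.bracket i j) f := by
  have h : ∑ a, ∑ b, oddCoord a * (oddCoord b *
        evenDeriv (T.bracket i a) (evenDeriv (T.bracket j b) f)) =
      -∑ a, ∑ b, oddCoord a * (oddCoord b *
        evenDeriv (T.bracket j a) (evenDeriv (T.bracket i b) f)) := by
    rw [Finset.sum_comm, ← Finset.sum_neg_distrib]
    refine Finset.sum_congr rfl fun b _ => ?_
    rw [← Finset.sum_neg_distrib]
    refine Finset.sum_congr rfl fun a _ => ?_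
    rw [← mul_assoc, ← mul_assoc,
      SuperRing.odd_anticomm (𝒜 := torusGrading p q) (oddCoord_mem a) (oddCoord_mem b), neg_mul,
      evenDeriv, evenDeriv, weightScale_comm]
  rw [T.leftOdd_leftOdd, T.leftOdd_leftOdd j i, h, oddDeriv_comm i j, T.symm j i]
  module

theorem leftTranslate_weight_mul (z : Fin p → ℂˣ) (χ ψ : Fin p → ℤ) :
    (∏ k, ((z k ^ (-(χ + ψ) k) : ℂˣ) : ℂ)) =
      (∏ k, ((z k ^ (-χ k) : ℂˣ) : ℂ)) * ∏ k, ((z k ^ (-ψ k) : ℂˣ) : ℂ) := by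
  rw [← Finset.prod_mul_distrib]
  refine Finset.prod_congr rfl fun k _ => ?_
  rw [Pi.add_apply, neg_add, zpow_add, Units.val_mul]

theorem leftTranslate_one_apply (z : Fin p → ℂˣ) :
    leftTranslate z (1 : TorusRing p q) = 1 := by
  rw [AddMonoidAlgebra.one_def, leftTranslate, weightScale_single]
  simp

theorem weightScale_mem (w : (Fin p → ℤ) → ℂ) {i : ZMod 2} {f : TorusRing p q}
    (hf : f ∈ torusGrading p q i) : weightScale w f ∈ torusGrading p q i :=
  fun χ => Submodule.smul_mem _ _ (hf χ)

theorem leftTranslate_mul (z : Fin p → ℂˣ) (f g : TorusRing p q) :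
    leftTranslate z (f * g) = leftTranslate z f * leftTranslate z g := by
  unfold leftTranslate
  exact weightScale_mul (fun χ => ∏ k, ((z k ^ (-χ k) : ℂˣ) : ℂ)) (leftTranslate_weight_mul z) f g

theorem leftTranslate_mem (z : Fin p → ℂˣ) {i : ZMod 2} {f : TorusRing p q}
    (hf : f ∈ torusGrading p q i) : leftTranslate z f ∈ torusGrading p q i := by
  unfold leftTranslate
  exact weightScale_mem (fun χ => ∏ k, ((z k ^ (-χ k) : ℂˣ) : ℂ)) hf

theorem leftTranslate_leftOdd (T : Supertorus p q) (z : Fin p → ℂˣ) (i : Fin q)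
    (f : TorusRing p q) :
    leftTranslate z (T.leftOdd i f) = T.leftOdd i (leftTranslate z f) := by
  unfold leftTranslate
  exact weightScale_leftOdd T i (fun χ => ∏ k, ((z k ^ (-χ k) : ℂˣ) : ℂ)) f

theorem leftTranslate_mul_apply (z z' : Fin p → ℂˣ) (f : TorusRing p q) :
    leftTranslate (z * z') f = leftTranslate z (leftTranslate z' f) := by
  ext χ : 2
  change (∏ k, (((z * z') k ^ (-χ k) : ℂˣ) : ℂ)) • f.coeff χ =
    (∏ k, ((z k ^ (-χ k) : ℂˣ) : ℂ)) • (∏ k, ((z' k ^ (-χ k) : ℂˣ) : ℂ)) • f.coeff χ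
  rw [smul_smul, ← Finset.prod_mul_distrib]
  congr 1
  refine Finset.prod_congr rfl fun k _ => ?_
  rw [Pi.mul_apply, mul_zpow, Units.val_mul]

theorem leftTranslate_one (f : TorusRing p q) : leftTranslate 1 f = f := by
  ext χ : 2
  change (∏ k, (((1 : Fin p → ℂˣ) k ^ (-χ k) : ℂˣ) : ℂ)) • f.coeff χ = _
  simp

theorem laurentMonomial_injective {χ ψ : Fin p → ℤ}
    (h : ∀ z : Fin p → ℂˣ, ((∏ k, z k ^ χ k : ℂˣ) : ℂ) = ((∏ k, z k ^ ψ k : ℂˣ) : ℂ)) :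
    χ = ψ := by
  ext k
  -- At the point with `2` in position `k` and `1` elsewhere the monomials become `2^(χ k)` and
  -- `2^(ψ k)`, which determine the exponents.
  have h1 := h (Pi.mulSingle k (Units.mk0 2 two_ne_zero))
  have h2 : ∀ φ : Fin p → ℤ, (∏ l, (Pi.mulSingle k (Units.mk0 (2 : ℂ) two_ne_zero) :
      Fin p → ℂˣ) l ^ φ l) = Units.mk0 (2 : ℂ) two_ne_zero ^ φ k := by
    intro φ
    rw [Finset.prod_eq_single k]
    · rw [Pi.mulSingle_eq_same]
    · intro l _ hl
      rw [Pi.mulSingle_eq_of_ne hl, one_zpow]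
    · simp
  rw [h2, h2, Units.val_zpow_eq_zpow_val, Units.val_zpow_eq_zpow_val, Units.val_mk0] at h1
  have h3 := congrArg norm h1
  rw [norm_zpow, norm_zpow, Complex.norm_ofNat] at h3
  exact zpow_right_injective₀ (by norm_num) (by norm_num) h3

/-- Laurent polynomials with vector coefficients which vanish on the torus are zero. -/
theorem laurent_eq_zero {V : Type*} [AddCommGroup V] [Module ℂ V] (g : (Fin p → ℤ) →₀ V)
    (h : ∀ z : Fin p → ℂˣ, (g.sum fun χ b => ((∏ k, z k ^ χ k : ℂˣ) : ℂ) • b) = 0) : g = 0 := by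
  let c : (Fin p → ℤ) → ((Fin p → ℂˣ) →* ℂ) := fun χ =>
    { toFun := fun z => ((∏ k, z k ^ χ k : ℂˣ) : ℂ)
      map_one' := by simp
      map_mul' := fun z z' => by
        rw [← Units.val_mul, ← Finset.prod_mul_distrib]
        congr 2
        ext k
        rw [Pi.mul_apply, mul_zpow] }
  have hc : Function.Injective c := fun χ ψ hχ =>
    laurentMonomial_injective fun z => DFunLike.congr_fun hχ z
  -- Dedekind independence of characters settles scalar coefficients. Linear functionals reduce
  -- vector coefficients to that case.
  have hli := (linearIndependent_monoidHom (Fin p → ℂˣ) ℂ).comp c hc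
  ext χ
  rw [Finsupp.zero_apply, ← Module.forall_dual_apply_eq_zero_iff ℂ]
  intro l
  have h0 := linearIndependent_iff.1 hli (g.mapRange l (map_zero l)) (by
    ext z
    rw [Finsupp.linearCombination_apply, Finsupp.sum_mapRange_index (by simp), Finsupp.sum,
      Finset.sum_apply]
    have := congrArg l (h z)
    rw [Finsupp.sum, map_sum, map_zero] at this
    rw [Pi.zero_apply, ← this]
    refine Finset.sum_congr rfl fun χ _ => ?_
    rw [map_smul, Pi.smul_apply, smul_eq_mul, smul_eq_mul, mul_comm]
    rfl)
  exact DFunLike.congr_fun h0 χ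

/-- The skew Leibniz rule reduces stability of a subalgebra to its generators. It also forces `D 1 =
0`. The twist `σ` covers both odd derivations and, for `σ = id`, even ones. -/
theorem derivation_mem_adjoin {X : Set (TorusRing p q)} {D : TorusRing p q →ₗ[ℂ] TorusRing p q}
    {σ : TorusRing p q →ₐ[ℂ] TorusRing p q} (hD : ∀ f g, D (f * g) = D f * g + σ f * D g)
    (hσ : ∀ f ∈ Algebra.adjoin ℂ X, σ f ∈ Algebra.adjoin ℂ X)
    (hX : ∀ x ∈ X, D x ∈ Algebra.adjoin ℂ X) {f : TorusRing p q} (hf : f ∈ Algebra.adjoin ℂ X) :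
    D f ∈ Algebra.adjoin ℂ X := by
  induction hf using Algebra.adjoin_induction with
  | mem x hx => exact hX x hx
  | algebraMap z =>
    have h := hD 1 1
    rw [map_one σ, one_mul, mul_one, one_mul, left_eq_add] at h
    rw [Algebra.algebraMap_eq_smul_one, map_smul, h, smul_zero]
    exact zero_mem _
  | add f g _ _ hf hg =>
    rw [map_add]
    exact add_mem hf hg
  | mul f g hf hg ihf ihg =>
    rw [hD]
    exact add_mem (mul_mem ihf hg) (mul_mem (hσ f hf) ihg)

end TorusOperators

/-! ### Supertorus actions on monomial superalgebras -/

section MonomialActions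

variable {q n : ℕ} {K : Finset ((Fin q → ℕ) × (Fin n → ℕ))}

theorem monomialAlgebra_induction {P : TorusRing (n + 1) q → Prop} (zero : P 0)
    (add : ∀ f g, P f → P g → P (f + g)) (smul : ∀ (z : ℂ) f, P f → P (z • f))
    (closure : ∀ f ∈ Submonoid.closure
      (superMonomial '' (K : Set ((Fin q → ℕ) × (Fin n → ℕ)))), P f)
    {f : TorusRing (n + 1) q} (hf : f ∈ monomialAlgebra K) : P f := by
  have hf' : f ∈ Subalgebra.toSubmodule (monomialAlgebra K) := hf
  rw [monomialAlgebra, Algebra.adjoin_eq_span] at hf'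
  exact Submodule.span_induction (p := fun f _ => P f) closure zero
    (fun f g _ _ => add f g) (fun z f _ => smul z f) hf'

theorem eq_single_of_mem_closure {f : TorusRing (n + 1) q}
    (hf : f ∈ Submonoid.closure (superMonomial '' (K : Set ((Fin q → ℕ) × (Fin n → ℕ))))) :
    ∃ χ a, f = AddMonoidAlgebra.single χ a := by
  induction hf using Submonoid.closure_induction with
  | mem x hx =>
    obtain ⟨k, _, rfl⟩ := hx
    exact ⟨_, _, rfl⟩
  | one => exact ⟨0, 1, rfl⟩
  | mul x y _ _ hx hy =>
    obtain ⟨χ, a, rfl⟩ := hx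
    obtain ⟨ψ, b, rfl⟩ := hy
    exact ⟨_, _, AddMonoidAlgebra.single_mul_single _ _ _ _⟩

/-- The algebra is spanned by products of generators, each of which is a weight vector. The weight
function is arbitrary, so this covers translations, the derivations of `𝔱₀` and the projections onto
weight spaces. -/
theorem weightScale_mem_monomialAlgebra (w : (Fin (n + 1) → ℤ) → ℂ) {f : TorusRing (n + 1) q}
    (hf : f ∈ monomialAlgebra K) : weightScale w f ∈ monomialAlgebra K := by
  refine monomialAlgebra_induction (P := fun f => weightScale w f ∈ monomialAlgebra K)
    ?_ ?_ ?_ ?_ hf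
  · rw [map_zero]
    exact zero_mem _
  · intro f g hf hg
    rw [map_add]
    exact add_mem hf hg
  · intro z f hf
    rw [map_smul]
    exact Subalgebra.smul_mem _ hf z
  · intro f hf
    have hmem : f ∈ monomialAlgebra K :=
      (Submonoid.closure_le (S := (monomialAlgebra K).toSubmonoid)).2 Algebra.subset_adjoin hf
    obtain ⟨χ, a, rfl⟩ := eq_single_of_mem_closure hf
    rw [weightScale_single, ← AddMonoidAlgebra.smul_single]
    exact Subalgebra.smul_mem _ hmem _

/-- The restriction of an endomorphism to a subalgebra. -/
def restrictEnd (S : Subalgebra ℂ (TorusRing (n + 1) q))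
    (D : TorusRing (n + 1) q →ₗ[ℂ] TorusRing (n + 1) q) (hD : ∀ f ∈ S, D f ∈ S) :
    Module.End ℂ S where
  toFun f := ⟨D f, hD f f.2⟩
  map_add' _ _ := Subtype.ext (map_add D _ _)
  map_smul' _ _ := Subtype.ext (map_smul D _ _)

theorem leftTranslate_mem_monomialAlgebra (z : Fin (n + 1) → ℂˣ) {f : TorusRing (n + 1) q}
    (hf : f ∈ monomialAlgebra K) : leftTranslate z f ∈ monomialAlgebra K := by
  unfold leftTranslate
  exact weightScale_mem_monomialAlgebra (fun χ => ∏ k, ((z k ^ (-χ k) : ℂˣ) : ℂ)) hf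

variable (K) in
/-- The automorphism of a monomial superalgebra given by an element of the torus. -/
def torusAlgHom (z : Fin (n + 1) → ℂˣ) : monomialAlgebra K →ₐ[ℂ] monomialAlgebra K :=
  AlgHom.ofLinearMap (restrictEnd (monomialAlgebra K) (leftTranslate z)
    fun _ hf => leftTranslate_mem_monomialAlgebra z hf)
    (Subtype.ext (leftTranslate_one_apply z))
    fun f g => Subtype.ext (leftTranslate_mul z (f : TorusRing (n + 1) q) g)

theorem coe_torusAlgHom (z : Fin (n + 1) → ℂˣ) (a : monomialAlgebra K) :
    (torusAlgHom K z a : TorusRing (n + 1) q) = leftTranslate z (a : TorusRing (n + 1) q) := rfl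

theorem torusAlgHom_comp (z z' : Fin (n + 1) → ℂˣ) :
    (torusAlgHom K z).comp (torusAlgHom K z') = torusAlgHom K (z * z') := by
  refine AlgHom.ext fun a => Subtype.ext ?_
  rw [AlgHom.comp_apply, coe_torusAlgHom, coe_torusAlgHom, coe_torusAlgHom,
    leftTranslate_mul_apply]

theorem torusAlgHom_one : torusAlgHom K 1 = AlgHom.id ℂ _ := by
  refine AlgHom.ext fun a => Subtype.ext ?_
  rw [coe_torusAlgHom, leftTranslate_one]
  rfl

variable (K) in
/-- The action of the torus on a monomial superalgebra. -/
def torusAction : (Fin (n + 1) → ℂˣ) →* (monomialAlgebra K ≃ₐ[ℂ] monomialAlgebra K) where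
  toFun z := AlgEquiv.ofAlgHom (torusAlgHom K z) (torusAlgHom K z⁻¹)
    (by rw [torusAlgHom_comp, mul_inv_cancel, torusAlgHom_one])
    (by rw [torusAlgHom_comp, inv_mul_cancel, torusAlgHom_one])
  map_one' := AlgEquiv.ext fun a => DFunLike.congr_fun torusAlgHom_one a
  map_mul' z z' := AlgEquiv.ext fun a => (DFunLike.congr_fun (torusAlgHom_comp z z') a).symm

theorem coe_torusAction (z : Fin (n + 1) → ℂˣ) (a : monomialAlgebra K) :
    (torusAction K z a : TorusRing (n + 1) q) = leftTranslate z (a : TorusRing (n + 1) q) := rfl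

theorem coe_finsupp_sum (f : (Fin (n + 1) → ℤ) →₀ monomialAlgebra K)
    (w : (Fin (n + 1) → ℤ) → ℂ) :
    ((f.sum fun χ b => w χ • b : monomialAlgebra K) : TorusRing (n + 1) q) =
      f.sum fun χ b => w χ • (b : TorusRing (n + 1) q) := by
  rw [Finsupp.sum, Finsupp.sum, AddSubmonoidClass.coe_finsetSum]
  rfl

theorem torusAction_rational (a : monomialAlgebra K) :
    ∃ f : (Fin (n + 1) → ℤ) →₀ monomialAlgebra K,
      ∀ z, torusAction K z a = f.sum fun χ b => ((∏ k, z k ^ χ k : ℂˣ) : ℂ) • b := by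
  classical
  let c : (Fin (n + 1) → ℤ) → monomialAlgebra K := fun χ =>
    ⟨weightScale (Pi.single χ 1) a, weightScale_mem_monomialAlgebra _ a.2⟩
  have hsingle : ∀ (w : (Fin (n + 1) → ℤ) → ℂ) (χ : Fin (n + 1) → ℤ) (x : monomialAlgebra K),
      (Finsupp.single χ x).sum (fun ψ b => w ψ • b) = w χ • x :=
    fun w χ x => Finsupp.sum_single_index (smul_zero _)
  -- Left translation multiplies the component of weight `χ` by `z^(-χ)`, so that component is the
  -- coefficient at `-χ`.
  refine ⟨∑ χ ∈ (a : TorusRing (n + 1) q).coeff.support, Finsupp.single (-χ) (c χ), fun z => ?_⟩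
  rw [← Finsupp.sum_finsetSum_index (fun _ => smul_zero _) fun _ _ _ => smul_add _ _ _]
  refine Subtype.ext ?_
  rw [coe_torusAction, AddSubmonoidClass.coe_finsetSum]
  conv_lhs => rw [torus_sum_single (a : TorusRing (n + 1) q), map_sum]
  refine Finset.sum_congr rfl fun χ _ => ?_
  rw [hsingle fun χ => ((∏ k, z k ^ χ k : ℂˣ) : ℂ), leftTranslate, weightScale_single,
    ← AddMonoidAlgebra.smul_single]
  change _ = _ • weightScale (Pi.single χ 1) (a : TorusRing (n + 1) q)
  congr 1
  · rw [Units.coe_prod]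
    rfl
  · ext ψ : 2
    change (AddMonoidAlgebra.single χ ((a : TorusRing (n + 1) q).coeff χ)).coeff ψ =
      (Pi.single χ 1 : (Fin (n + 1) → ℤ) → ℂ) ψ • (a : TorusRing (n + 1) q).coeff ψ
    rw [AddMonoidAlgebra.coeff_single]
    rcases eq_or_ne ψ χ with rfl | h
    · rw [Finsupp.single_eq_same, Pi.single_eq_same, one_smul]
    · rw [Finsupp.single_eq_of_ne h, Pi.single_eq_of_ne h, zero_smul]

/-- Any Laurent expansion of the orbit map must be the weight decomposition, since such expansions
are unique by `laurent_eq_zero`. The comparison is made separately in each coefficient `ψ`, where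
only the exponent `-ψ` can occur. -/
theorem torusAction_differential (a : monomialAlgebra K)
    (f : (Fin (n + 1) → ℤ) →₀ monomialAlgebra K)
    (h : ∀ z, torusAction K z a = f.sum fun χ b => ((∏ k, z k ^ χ k : ℂˣ) : ℂ) • b)
    (k : Fin (n + 1)) :
    -evenDeriv (Pi.single k 1) (a : TorusRing (n + 1) q) =
      ((f.sum fun χ b => (χ k : ℂ) • b : monomialAlgebra K) : TorusRing (n + 1) q) := by
  classical
  rw [coe_finsupp_sum f fun χ => (χ k : ℂ)]
  ext ψ : 2
  let F : (Fin (n + 1) → ℤ) →₀ ExteriorAlgebra ℂ (Fin q → ℂ) :=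
    f.mapRange (fun b : monomialAlgebra K => (b : TorusRing (n + 1) q).coeff ψ) rfl
  have hcoeff : ∀ w : (Fin (n + 1) → ℤ) → ℂ,
      (f.sum fun χ b => w χ • (b : TorusRing (n + 1) q)).coeff ψ = F.sum fun χ b => w χ • b := by
    intro w
    have hF : F.sum (fun χ b => w χ • b) =
        f.sum fun χ b => w χ • (b : TorusRing (n + 1) q).coeff ψ :=
      Finsupp.sum_mapRange_index fun _ => smul_zero _
    rw [hF, Finsupp.sum, Finsupp.sum,
      AddMonoidAlgebra.coeff_sum, Finsupp.finsetSum_apply]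
    rfl
  have hsingle : ∀ (w : (Fin (n + 1) → ℤ) → ℂ) (x : ExteriorAlgebra ℂ (Fin q → ℂ)),
      (Finsupp.single (-ψ) x).sum (fun χ b => w χ • b) = w (-ψ) • x :=
    fun w x => Finsupp.sum_single_index (smul_zero _)
  have hF : F - Finsupp.single (-ψ) ((a : TorusRing (n + 1) q).coeff ψ) = 0 := by
    refine laurent_eq_zero _ fun z => ?_
    rw [Finsupp.sum_sub_index fun _ _ _ => smul_sub _ _ _,
      hsingle fun χ => ((∏ k, z k ^ χ k : ℂˣ) : ℂ), sub_eq_zero,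
      ← hcoeff fun χ => ((∏ k, z k ^ χ k : ℂˣ) : ℂ),
      ← coe_finsupp_sum f fun χ => ((∏ k, z k ^ χ k : ℂˣ) : ℂ), ← h z, coe_torusAction,
      Units.coe_prod]
    rfl
  rw [hcoeff fun χ => (χ k : ℂ), sub_eq_zero.1 hF, hsingle fun χ => (χ k : ℂ)]
  change -((∑ l, (ψ l : ℂ) * (Pi.single k 1 : Fin (n + 1) → ℂ) l) •
    (a : TorusRing (n + 1) q).coeff ψ) = _
  simp [Pi.single_apply]

/-- A supertorus whose odd vector fields preserve a monomial superalgebra acts on it. -/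
def supertorusAction (T : Supertorus (n + 1) q)
    (hT : ∀ i, ∀ f ∈ monomialAlgebra K, T.leftOdd i f ∈ monomialAlgebra K) :
    SupertorusAction T (restrictGrading (monomialAlgebra K)) where
  grp := torusAction K
  grp_mem z i a ha := leftTranslate_mem z (f := (a : TorusRing (n + 1) q)) ha
  rational := torusAction_rational
  -- The sign comes from differentiating `f(z⁻¹ t)` in `z`.
  even k := restrictEnd _ (-evenDeriv (Pi.single k 1)) fun _ hf =>
    neg_mem (weightScale_mem_monomialAlgebra _ hf)
  even_apply a f h k := Subtype.ext (torusAction_differential a f h k)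
  odd i := restrictEnd _ (T.leftOdd i) (hT i)
  odd_mem i j a ha := T.leftOdd_mem i ha
  odd_mul i j a b ha := by
    refine Subtype.ext ((T.leftOdd_mul i a b).trans ?_)
    have h : parityInvolution (n + 1) q a = (-1 : ℂ) ^ j.val • (a : TorusRing (n + 1) q) := by
      fin_cases j
      · refine ((mem_torusGrading_zero _).1 ha).trans ?_
        change _ = (-1 : ℂ) ^ (0 : ℕ) • _
        rw [pow_zero, one_smul]
      · refine ((mem_torusGrading_one _).1 ha).trans ?_
        change _ = (-1 : ℂ) ^ (1 : ℕ) • _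
        rw [pow_one, neg_one_smul]
    rw [h, smul_mul_assoc]
    rfl
  odd_bracket i j a := by
    refine Subtype.ext ((T.leftOdd_bracket i j a).trans ?_)
    rw [evenDeriv_eq_sum, ← Finset.sum_neg_distrib, AddSubmonoidClass.coe_finsetSum]
    exact Finset.sum_congr rfl fun k _ => (smul_neg _ _).symm
  grp_odd z i a := Subtype.ext (leftTranslate_leftOdd T z i (a : TorusRing (n + 1) q))

/-- The brackets have no component along `v`, so only the exponents of the `x_l` enter and the
coefficient is `⟨m, c_ij⟩`. -/
theorem leftOdd_superMonomial (c : Fin q → Fin q → Fin n → ℂ) (hc : ∀ i j, c i j = c j i)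
    (i : Fin q) (k : (Fin q → ℕ) × (Fin n → ℕ)) :
    (supertorusOf c hc).leftOdd i (superMonomial k) =
      (1 / 2 : ℂ) • ∑ j, (∑ l, (k.2 l : ℂ) * c i j l) • (oddCoord j * superMonomial k) -
        oddDeriv i (superMonomial k) := by
  rw [Supertorus.leftOdd_apply]
  congr 2
  refine Finset.sum_congr rfl fun j _ => ?_
  have h : evenDeriv ((supertorusOf c hc).bracket i j) (superMonomial k) =
      (∑ l, (k.2 l : ℂ) * c i j l) • superMonomial k := by
    rw [superMonomial_eq_single, evenDeriv, weightScale_single, ← AddMonoidAlgebra.smul_single,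
      Fin.sum_univ_succ]
    simp [supertorusOf, charXV]
  rw [h, mul_smul_comm]

theorem parityInvolution_mem_monomialAlgebra {f : TorusRing (n + 1) q}
    (hf : f ∈ monomialAlgebra K) : parityInvolution (n + 1) q f ∈ monomialAlgebra K := by
  have h : monomialAlgebra K ≤ (monomialAlgebra K).comap (parityInvolution (n + 1) q) := by
    refine Algebra.adjoin_le ?_
    rintro _ ⟨k, hk, rfl⟩
    rw [SetLike.mem_coe, Subalgebra.mem_comap]
    rcases parityInvolution_superMonomial k with h | h <;> rw [h]
    · exact superMonomial_mem hk
    · exact neg_mem (superMonomial_mem hk)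
  exact h hf

theorem oddCoord_mul_superMonomial_eq_zero {k : (Fin q → ℕ) × (Fin n → ℕ)} {j : Fin q}
    (hk : ∀ i, k.1 i ≤ 1) (hj : k.1 j = 1) : oddCoord j * superMonomial k = 0 := by
  have h : (oddCoord j * oddCoord j : TorusRing (n + 1) q) = 0 :=
    SuperRing.odd_sq (oddCoord_mem j)
  rcases superMonomial_eq_oddCoord_mul hk hj with h1 | h1 <;>
    simp [h1, ← mul_assoc, h]

section

variable (hK : ∀ k ∈ K, ∀ i, k.1 i ≤ 1)
  (hK_closed : ∀ k ∈ K, ∀ i, k.1 i = 1 → (k.1 - Pi.single i 1, k.2) ∈ K)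

include hK

include hK_closed in
theorem oddDeriv_superMonomial_mem (i : Fin q) {k : (Fin q → ℕ) × (Fin n → ℕ)} (hk : k ∈ K) :
    oddDeriv i (superMonomial k) ∈ monomialAlgebra K := by
  have hi := hK k hk i
  interval_cases h : k.1 i
  · rw [oddDeriv_superMonomial_eq_zero (hK k hk) h]
    exact zero_mem _
  · rcases oddDeriv_superMonomial (hK k hk) h with h1 | h1 <;> rw [h1]
    · exact superMonomial_mem (hK_closed k hk i h)
    · exact neg_mem (superMonomial_mem (hK_closed k hk i h))

include hK_closed in
/-- The odd vector fields preserve a monomial superalgebra if the bracket satisfies the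
orthogonality conditions. -/
theorem leftOdd_mem_monomialAlgebra (c : Fin q → Fin q → Fin n → ℂ) (hc : ∀ i j, c i j = c j i)
    (h : ∀ i j, ∀ k ∈ K, k.1 j = 0 → (k.1 + Pi.single j 1, k.2) ∉ K →
      ∑ l, (k.2 l : ℂ) * c i j l = 0) (i : Fin q) (f : TorusRing (n + 1) q)
    (hf : f ∈ monomialAlgebra K) : (supertorusOf c hc).leftOdd i f ∈ monomialAlgebra K := by
  refine derivation_mem_adjoin ((supertorusOf c hc).leftOdd_mul i)
    (fun f hf => parityInvolution_mem_monomialAlgebra hf) ?_ hf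
  rintro _ ⟨k, hk, rfl⟩
  change _ ∈ monomialAlgebra K
  rw [leftOdd_superMonomial]
  refine sub_mem (Subalgebra.smul_mem _ (sum_mem fun j _ => ?_) _)
    (oddDeriv_superMonomial_mem hK hK_closed i hk)
  have hj := hK k hk j
  interval_cases hkj : k.1 j
  · by_cases hmem : (k.1 + Pi.single j 1, k.2) ∈ K
    · refine Subalgebra.smul_mem _ ?_ _
      rcases oddCoord_mul_superMonomial (hK k hk) hkj with h1 | h1 <;> rw [h1]
      · exact superMonomial_mem hmem
      · exact neg_mem (superMonomial_mem hmem)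
    -- If `ξ_j ξ^I x^m v` is not a generator up to sign, orthogonality makes its coefficient vanish.
    · rw [h i j k hk hkj hmem, zero_smul]
      exact zero_mem _
  · rw [oddCoord_mul_superMonomial_eq_zero (hK k hk) hkj, smul_zero]
    exact zero_mem _

/-- The projection onto the multiples of an odd coordinate preserves a monomial superalgebra. -/
theorem oddCoord_mul_oddDeriv_mem (j : Fin q) {f : TorusRing (n + 1) q}
    (hf : f ∈ monomialAlgebra K) : oddCoord j * oddDeriv j f ∈ monomialAlgebra K := by
  -- The operator `ξ_j ∂_j` is an even derivation, so no twist is needed. It multiplies a monomial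
  -- by its degree in `ξ_j`.
  refine derivation_mem_adjoin (D := LinearMap.mulLeft ℂ (oddCoord j) ∘ₗ oddDeriv j)
    (σ := AlgHom.id ℂ _) (fun f g => ?_) (fun f hf => hf) ?_ hf
  · simp only [LinearMap.comp_apply, LinearMap.mulLeft_apply, oddDeriv_mul, AlgHom.id_apply,
      mul_add, ← mul_assoc]
    rw [oddCoord_mul j (parityInvolution (n + 1) q f), parityInvolution_parityInvolution]
  · rintro _ ⟨k, hk, rfl⟩
    change oddCoord j * oddDeriv j (superMonomial k) ∈ monomialAlgebra K
    have hj := hK k hk j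
    interval_cases hkj : k.1 j
    · rw [oddDeriv_superMonomial_eq_zero (hK k hk) hkj, mul_zero]
      exact zero_mem _
    · have h : oddCoord j * oddDeriv j (superMonomial k) = superMonomial k := by
        have h0 := oddDeriv_oddCoord_mul j j (superMonomial k)
        rw [oddCoord_mul_superMonomial_eq_zero (hK k hk) hkj, map_zero, if_pos rfl, eq_comm,
          sub_eq_zero] at h0
        exact h0.symm
      rw [h]
      exact superMonomial_mem hk

/-- A monomial of degree one in `v` lies in a monomial superalgebra only if it is one of the
generators. -/
theorem mem_of_superMonomial_mem {k : (Fin q → ℕ) × (Fin n → ℕ)} (hk : ∀ i, k.1 i ≤ 1)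
    (hmem : superMonomial k ∈ monomialAlgebra K) : k ∈ K := by
  by_contra hkK
  let s : Finset (Fin q) := Finset.univ.filter fun i => k.1 i = 1
  let b := (Pi.basisFun ℂ (Fin q)).ExteriorAlgebra
  -- The degree in `v` separates the products of generators: the empty product has degree zero,
  -- single generators have degree one, and longer products have degree at least two.
  have hcl : ∀ f ∈ Submonoid.closure
      (superMonomial '' (K : Set ((Fin q → ℕ) × (Fin n → ℕ)))),
      f = 1 ∨ (∃ k' ∈ K, f = superMonomial k') ∨
        ∃ (χ : Fin (n + 1) → ℤ) (a : _), 2 ≤ χ 0 ∧ f = AddMonoidAlgebra.single χ a := by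
    intro f hf
    induction hf using Submonoid.closure_induction_left with
    | one => exact Or.inl rfl
    | mul_left x hx y _ hy =>
      obtain ⟨k', hk', rfl⟩ := hx
      right
      rcases hy with rfl | ⟨l, hl, rfl⟩ | ⟨χ, a, hχ, rfl⟩
      · exact Or.inl ⟨k', hk', mul_one _⟩
      · refine Or.inr ⟨_, _, ?_, AddMonoidAlgebra.single_mul_single _ _ _ _⟩
        simp [charXV]
      · refine Or.inr ⟨_, _, ?_, AddMonoidAlgebra.single_mul_single _ _ _ _⟩
        simp only [charXV, Pi.add_apply, Fin.cons_zero]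
        omega
  have hsingle : ∀ (χ : Fin (n + 1) → ℤ) (a : ExteriorAlgebra ℂ (Fin q → ℂ)), χ ≠ charXV k.2 →
      b.repr ((AddMonoidAlgebra.single χ a : TorusRing (n + 1) q).coeff (charXV k.2)) s = 0 := by
    intro χ a h
    rw [AddMonoidAlgebra.coeff_single, Finsupp.single_eq_of_ne h.symm, map_zero,
      Finsupp.zero_apply]
  -- The coefficient functional of `ξ^I x^m v` vanishes on the unit, on the generators other than
  -- this monomial and on everything of higher degree in `v`, hence on the whole algebra. Its value
  -- on the monomial itself is `1`.
  have hzero : b.repr ((superMonomial k).coeff (charXV k.2)) s = 0 := by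
    refine monomialAlgebra_induction (P := fun f => b.repr (f.coeff (charXV k.2)) s = 0)
      ?_ ?_ ?_ ?_ hmem
    · rw [AddMonoidAlgebra.coeff_zero, Finsupp.zero_apply, map_zero, Finsupp.zero_apply]
    · intro f g hf hg
      rw [AddMonoidAlgebra.coeff_add, Finsupp.add_apply, map_add, Finsupp.add_apply, hf, hg,
        add_zero]
    · intro z f hf
      rw [AddMonoidAlgebra.coeff_smul, Finsupp.smul_apply, map_smul, Finsupp.smul_apply, hf,
        smul_zero]
    · intro f hf
      rcases hcl f hf with rfl | ⟨l, hl, rfl⟩ | ⟨χ, a, hχ, rfl⟩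
      · refine hsingle 0 1 fun h => ?_
        have := congrFun h 0
        simp [charXV] at this
      · by_cases h : charXV l.2 = charXV k.2
        · rw [superMonomial_eq_single, AddMonoidAlgebra.coeff_single, h, Finsupp.single_eq_same,
            extMonomial_eq_basis ℂ (hK l hl), Module.Basis.repr_self, Finsupp.single_apply,
            if_neg]
          intro hls
          refine hkK ?_
          have h1 : l.1 = k.1 := by
            ext i
            have h2 : l.1 i = 1 ↔ k.1 i = 1 := by
              have := Finset.ext_iff.1 hls i
              simpa [s] using this
            have := hK l hl i
            have := hk i
            omega
          have h2 : l.2 = k.2 := by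
            ext i
            have := congrFun h i.succ
            simpa [charXV] using this
          rwa [← Prod.ext h1 h2]
        · exact hsingle _ _ h
      · refine hsingle χ a fun h => ?_
        have := congrFun h 0
        simp only [charXV, Fin.cons_zero] at this
        omega
  rw [superMonomial_eq_single, AddMonoidAlgebra.coeff_single, Finsupp.single_eq_same,
    extMonomial_eq_basis ℂ hk, Module.Basis.repr_self, Finsupp.single_eq_same] at hzero
  exact one_ne_zero hzero

/-- The orthogonality conditions hold if the odd vector fields preserve a monomial
superalgebra. -/
theorem sum_eq_zero_of_leftOdd_mem (c : Fin q → Fin q → Fin n → ℂ) (hc : ∀ i j, c i j = c j i)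
    (h : ∀ i, ∀ f ∈ monomialAlgebra K, (supertorusOf c hc).leftOdd i f ∈ monomialAlgebra K)
    (i j : Fin q) {k : (Fin q → ℕ) × (Fin n → ℕ)} (hk : k ∈ K) (hj : k.1 j = 0)
    (hkj : (k.1 + Pi.single j 1, k.2) ∉ K) : ∑ l, (k.2 l : ℂ) * c i j l = 0 := by
  by_contra hne
  refine hkj (mem_of_superMonomial_mem hK (fun a => ?_) ?_)
  · rcases eq_or_ne a j with rfl | ha
    · simp [hj]
    · simpa [ha] using hK k hk a
  -- Applying `ξ_j ∂_j` to `θ_i(ξ^I x^m v)` isolates the `j`-th summand. The term with `∂_i` is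
  -- killed because `∂_j` anticommutes with `∂_i` and annihilates the monomial.
  have hmem := oddCoord_mul_oddDeriv_mem hK j (h i _ (superMonomial_mem hk))
  have h0 := oddDeriv_superMonomial_eq_zero (hK k hk) hj
  rw [leftOdd_superMonomial] at hmem
  simp only [map_sub, map_smul, map_sum, oddDeriv_oddCoord_mul, h0, mul_zero, sub_zero,
    oddDeriv_comm j i, map_zero, neg_zero, smul_ite, smul_zero, Finset.sum_ite_eq,
    Finset.mem_univ, if_true, mul_smul_comm, smul_smul] at hmem
  have hmem' : oddCoord j * superMonomial k ∈ monomialAlgebra K := by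
    -- The coefficient is nonzero by assumption and can be divided out.
    have := Subalgebra.smul_mem _ hmem (1 / 2 * ∑ l, (k.2 l : ℂ) * c i j l)⁻¹
    rwa [smul_smul, inv_mul_cancel₀ (mul_ne_zero (by norm_num) hne), one_smul] at this
  rcases oddCoord_mul_superMonomial (hK k hk) hj with h1 | h1 <;> rw [h1] at hmem'
  · exact hmem'
  · exact neg_mem_iff.1 hmem'

end

end MonomialActions

/-! ### The criterion and the main theorem -/

section MainTheorem

variable {q n : ℕ} {K : Finset ((Fin q → ℕ) × (Fin n → ℕ))}

/-- Equivariance along the inclusion makes any action of `θ_i` a restriction of `leftOdd`. So an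
action amounts to stability of the algebra under the `θ_i`, which is equivalent to the orthogonality
conditions. The geometric conditions do not depend on `c`. -/
theorem exists_isToric_iff (hK : ∀ k ∈ K, ∀ i, k.1 i ≤ 1)
    (hK_closed : ∀ k ∈ K, ∀ i, k.1 i = 1 → (k.1 - Pi.single i 1, k.2) ∈ K)
    (hK_even : Algebra.adjoin ℂ
      {f : AddMonoidAlgebra ℂ (Fin (n + 1) → ℤ) | ∃ m : Fin n → ℕ, ((0, m) : _ × _) ∈ K ∧
        (f = AddMonoidAlgebra.single (charXV m) 1 ∨ f = AddMonoidAlgebra.single (-charXV m) 1)} = ⊤)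
    (hK_odd : ∀ i : Fin q, ∃ m : Fin n → ℕ, (Pi.single i 1, m) ∈ K)
    (c : Fin q → Fin q → Fin n → ℂ) (hc : ∀ i j, c i j = c j i) :
    (∃ act : SupertorusAction (supertorusOf c hc) (restrictGrading (monomialAlgebra K)),
        IsToric act (monomialAlgebra K).val) ↔
      ∀ i j, ∀ k ∈ K, k.1 j = 0 → (k.1 + Pi.single j 1, k.2) ∉ K →
        ∑ l, (k.2 l : ℂ) * c i j l = 0 := by
  constructor
  · rintro ⟨act, hact⟩ i j k hk hj hkj
    refine sum_eq_zero_of_leftOdd_mem hK c hc (fun i f hf => ?_) i j hk hj hkj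
    have := hact.map_odd i ⟨f, hf⟩
    exact this ▸ (act.odd i ⟨f, hf⟩).2
  · intro h
    exact ⟨supertorusAction _ (leftOdd_mem_monomialAlgebra hK hK_closed c hc h),
      { irreducible := (monomialAlgebra_isIntegralSuperRing hK_closed hK hK_odd).irreducibleSpace
        supervariety := monomialAlgebra_isAffineSupervariety hK_even hK_closed hK hK_odd
        map_grp := fun _ _ => rfl
        map_odd := fun _ _ => rfl
        factors := monomialAlgebra_factors hK_even hK_closed _ hK_odd }⟩

end MainTheorem

end

theorem mainTheorem3 (q n : ℕ) (K : Finset ((Fin q → ℕ) × (Fin n → ℕ)))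
    (hK : ∀ k ∈ K, ∀ i, k.1 i ≤ 1)
    (hK_closed : ∀ k ∈ K, ∀ i, k.1 i = 1 → (k.1 - Pi.single i 1, k.2) ∈ K)
    (hK_even : Algebra.adjoin ℂ
      {f : AddMonoidAlgebra ℂ (Fin (n + 1) → ℤ) | ∃ m : Fin n → ℕ, ((0, m) : _ × _) ∈ K ∧
        (f = AddMonoidAlgebra.single (charXV m) 1 ∨ f = AddMonoidAlgebra.single (-charXV m) 1)} = ⊤)
    (hK_odd : ∀ i : Fin q, ∃ m : Fin n → ℕ, (Pi.single i 1, m) ∈ boundedSums K) :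
    IsToricSupervariety (restrictGrading (monomialAlgebra K)) ∧
    ∀ (c : Fin q → Fin q → Fin n → ℂ) (hc : ∀ i j, c i j = c j i),
      ((∃ act : SupertorusAction (supertorusOf c hc) (restrictGrading (monomialAlgebra K)),
          IsToric act (monomialAlgebra K).val) ↔
        ∀ i j, ∀ k ∈ K, k.1 j = 0 → (k.1 + Pi.single j 1, k.2) ∉ K →
          ∑ l, (k.2 l : ℂ) * c i j l = 0) ∧
      ((∃ act : SupertorusAction (supertorusOf c hc) (restrictGrading (monomialAlgebra K)),
          IsToric act (monomialAlgebra K).val) →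
        ∀ i j, ∀ k ∈ K, k.1 j = 0 → (k.1 + Pi.single j 1, k.2) ∉ boundedSums K →
          ∑ l, (k.2 l : ℂ) * c i j l = 0) := by
  have hK_odd' : ∀ i : Fin q, ∃ m : Fin n → ℕ, (Pi.single i 1, m) ∈ K := fun i =>
    let ⟨_, hm⟩ := hK_odd i
    exists_single_mem_of_mem_boundedSums hm
  have key := exists_isToric_iff hK hK_closed hK_even hK_odd'
  refine ⟨?_, fun c hc => ⟨key c hc, fun hact i j k hk hj hkj =>
    -- A pair outside `⟨K⟩` is also outside `K`, because `K ⊆ ⟨K⟩`.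
    (key c hc).1 hact i j k hk hj fun hmem =>
      hkj ⟨AddSubmonoid.subset_closure hmem, hK _ hmem⟩⟩⟩
  -- For the bracket `c = 0` the orthogonality conditions are empty, so this supertorus always acts.
  obtain ⟨act, hact⟩ := (key 0 (fun _ _ => rfl)).2 (by intros; simp)
  exact ⟨n + 1, q, _, act, _, hact⟩
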